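/- Let $P:\{-1,1\}^k\to\{0,1\}$ be a predicate. An instance $\mathcal I$ of $\mathrm{CSP}(P)$ on $n$ variables is a finite multiset of constraints $(c,S)$ with $c\in\{-1,1\}^k$ and $S\in[n]^k$; an assignment $x\in\{-1,1\}^n$ satisfies $(c,S)$ if $P(c_1x_{S_1},\dots,c_kx_{S_k})=1$, and $\mathrm{Opt}(\mathcal I)$ is the maximum over $x$ of the fraction of constraints of $\mathcal I$ satisfied by $x$ (with $\mathrm{Opt}=0$ for the empty instance). Let $\mathcal F_P(n,p)$ be the random instance that includes each of the $2^kn^k$ possible constraints independently with probability $p$; the expected number of constraints is $\overline m=2^kn^kp$. A probability distribution on $\{-1,1\}^k$ is $t$-wise uniform if its marginal on every set of $t$ coordinates is uniform. $P$ is $\delta$-far from supporting a $t$-wise uniform distribution if every $t$-wise uniform distribution has mass at least $\delta$ on $P^{-1}(0)$. There is an absolute constant $K$ such that the following holds for all $2\le t\le k$, every $P:\{-1,1\}^k\to\{0,1\}$ and every real $\delta$ such that $P$ is $\delta$-far from supporting a $t$-wise uniform distribution. There is a deterministic algorithm $\mathcal A$ which, given $n$, an instance $\mathcal I$ on $n$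 variables with $m$ constraints and a rational $\gamma\ge 0$, outputs either "$\mathrm{Opt}(\mathcal I)\le 1-\delta+\gamma$" or "fail", such that: 1. (Efficiency.) $\mathcal A$ runs in time polynomial in $n$, $m$ and the bit length of $\gamma$ (the polynomial may depend on $P$, $t$ and $\delta$), time being the bit cost on a random access machine with logarithmic cost. 2. (No errors.) For all $n$, $\mathcal I$ and $\gamma$: if $\mathcal A$ outputs "$\mathrm{Opt}(\mathcal I)\le 1-\delta+\gamma$", then indeed $\mathrm{Opt}(\mathcal I)\le 1-\delta+\gamma$. 3. (Success with high probability.) For all sequences $p=p(n)\in[0,1]$ and rational $\gamma=\gamma(n)>0$ such that, for all sufficiently large $n$, $$\overline m=2^kn^kp\ \ge\ \frac{k^{Kt}\,n^{t/2}\,\log^5 n}{\gamma^2},$$ we have $\Pr_{\mathcal I\sim\mathcal F_P(n,p)}[\mathcal A(\mathcal I,\gamma)=\text{"fail"}]\to 0$ as $n\to\infty$. -/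

import Mathlib

open Filter Topology MeasureTheory ProbabilityTheory

/-! ## Random access machine with logarithmic cost

Programs over finitely many (statically named) arrays of natural numbers. Every elementary
operation is charged according to the bit lengths of the numbers and addresses it touches. -/

namespace RAM

/-- Contents of memory: `s a i` is the entry with index `i` of the array named `a`. -/
abbrev State : Type := ℕ → ℕ → ℕ

/-- Binary arithmetic operations (subtraction is truncated, `x / 0 = 0`, `x % 0 = x`). -/
inductive Op : Type
  | add | sub | mul | div | mod

/-- Value of an arithmetic operation. -/
def Op.eval : Op → ℕ → ℕ → ℕ
  | .add, x, y => x + y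
  | .sub, x, y => x - y
  | .mul, x, y => x * y
  | .div, x, y => x / y
  | .mod, x, y => x % y

/-- Expressions: constants, array reads and arithmetic operations. -/
inductive Expr : Type
  | const (v : ℕ)
  | read (a : ℕ) (i : Expr)
  | op (o : Op) (e₁ e₂ : Expr)

/-- Value of an expression in a state. -/
def Expr.eval (s : State) : Expr → ℕ
  | .const v => v
  | .read a i => s a (i.eval s)
  | .op o e₁ e₂ => o.eval (e₁.eval s) (e₂.eval s)

/-- Bit cost of evaluating an expression (`Nat.size` is the binary length). -/
def Expr.cost (s : State) : Expr → ℕ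
  | .const v => Nat.size v + 1
  | .read a i => i.cost s + Nat.size (i.eval s) + Nat.size (s a (i.eval s)) + 1
  | .op _ e₁ e₂ =>
      e₁.cost s + e₂.cost s + (Nat.size (e₁.eval s) + 1) * (Nat.size (e₂.eval s) + 1)

/-- Programs: `write a i e` is the assignment `a[i] := e`; a test holds when its value is nonzero. -/
inductive Prog : Type
  | skip
  | write (a : ℕ) (i e : Expr)
  | seq (c d : Prog)
  | ite (e : Expr) (c d : Prog)
  | loop (e : Expr) (c : Prog)

/-- The state after the assignment `a[i] := v`. -/
def State.set (s : State) (a i v : ℕ) : State :=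
  fun b j => if b = a ∧ j = i then v else s b j

/-- `Exec c s s' T`: the program `c`, started in state `s`, halts in state `s'`, with total bit
cost `T`. The program `loop e c` repeats `c` while `e` is nonzero. -/
inductive Exec : Prog → State → State → ℕ → Prop
  | skip (s : State) : Exec .skip s s 1
  | write (s : State) (a : ℕ) (i e : Expr) :
      Exec (.write a i e) s (s.set a (i.eval s) (e.eval s))
        (i.cost s + e.cost s + Nat.size (i.eval s) + Nat.size (e.eval s) + 1)
  | seq (c d : Prog) (s s' s'' : State) (T T' : ℕ) :
      Exec c s s' T → Exec d s' s'' T' → Exec (.seq c d) s s'' (T + T' + 1)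
  | ite_true (e : Expr) (c d : Prog) (s s' : State) (T : ℕ) :
      e.eval s ≠ 0 → Exec c s s' T → Exec (.ite e c d) s s' (e.cost s + T + 1)
  | ite_false (e : Expr) (c d : Prog) (s s' : State) (T : ℕ) :
      e.eval s = 0 → Exec d s s' T → Exec (.ite e c d) s s' (e.cost s + T + 1)
  | loop_stop (e : Expr) (c : Prog) (s : State) :
      e.eval s = 0 → Exec (.loop e c) s s (e.cost s + 1)
  | loop_step (e : Expr) (c : Prog) (s s' s'' : State) (T T' : ℕ) :
      e.eval s ≠ 0 → Exec c s s' T → Exec (.loop e c) s' s'' T' →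
        Exec (.loop e c) s s'' (e.cost s + T + T' + 1)

/-- Initial state: the input is stored in array `0`, all other cells are `0`. -/
def init (input : List ℕ) : State :=
  fun a i => if a = 0 then input.getD i 0 else 0

/-- On the given input, the program halts with total bit cost at most `T`, leaving the given output
in cell `0` of array `1`. -/
def OutputsInTime (c : Prog) (input : List ℕ) (output T : ℕ) : Prop :=
  ∃ (s : State) (T' : ℕ), Exec c (init input) s T' ∧ T' ≤ T ∧ s 1 0 = output

end RAM

/-! ## Constraint satisfaction problems

The set `{-1, 1}` is represented by the units `ℤˣ` of the integers. -/

namespace CSP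

/-- A constraint on `n` variables: a negation pattern and a scope. -/
abbrev Constraint (k n : ℕ) : Type := (Fin k → ℤˣ) × (Fin k → Fin n)

/-- An instance on `n` variables is a multiset of constraints. -/
abbrev Instance (k n : ℕ) : Type := Multiset (Constraint k n)

/-- The point `c ∘ x_S` at which the predicate is evaluated. -/
def Constraint.point {k n : ℕ} (C : Constraint k n) (x : Fin n → ℤˣ) : Fin k → ℤˣ :=
  fun i => C.1 i * x (C.2 i)

/-- Fraction of the constraints satisfied by `x` (zero for the instance without constraints). -/
noncomputable def val {k n : ℕ} (P : (Fin k → ℤˣ) → Bool) (I : Instance k n)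
    (x : Fin n → ℤˣ) : ℝ :=
  (I.countP (fun C => P (C.point x) = true) : ℝ) / (Multiset.card I : ℝ)

/-- The optimum: the largest fraction of simultaneously satisfiable constraints. -/
noncomputable def opt {k n : ℕ} (P : (Fin k → ℤˣ) → Bool) (I : Instance k n) : ℝ :=
  ⨆ x : Fin n → ℤˣ, val P I x

/-- A probability distribution on `{-1, 1}^k` is `t`-wise uniform when its marginal on any `t`
coordinates is uniform. -/
def IsTWiseUniform {k : ℕ} (t : ℕ) (D : (Fin k → ℤˣ) → ℝ) : Prop :=
  ∀ S : Finset (Fin k), S.card = t → ∀ y : S → ℤˣ,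
    ∑ z : Fin k → ℤˣ with S.restrict z = y, D z = 1 / 2 ^ t

/-- `P` is `δ`-far from supporting a `t`-wise uniform distribution: every `t`-wise uniform
probability distribution has mass at least `δ` on the points that falsify `P`. -/
def IsFarFromTWiseSupporting {k : ℕ} (P : (Fin k → ℤˣ) → Bool) (t : ℕ) (δ : ℝ) : Prop :=
  ∀ D ∈ stdSimplex ℝ (Fin k → ℤˣ), IsTWiseUniform t D →
    δ ≤ ∑ z : Fin k → ℤˣ with P z = false, D z

open Classical in
/-- The instance in which each constraint of a given set occurs exactly once. -/
noncomputable def Instance.ofSet {k n : ℕ} (s : Set (Constraint k n)) : Instance k n :=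
  s.toFinset.val

/-- The probability that the random instance, in which each of the `2 ^ k * n ^ k` constraints is
included independently with probability `p`, has the property `E`. -/
noncomputable def prob (k n : ℕ) (p : unitInterval) (E : Instance k n → Prop) : ℝ :=
  (setBernoulli (Set.univ : Set (Constraint k n)) p).real {s | E (Instance.ofSet s)}

/-- Encoding of a constraint: for each position, the variable and the sign (`1` for negated). -/
def encodeConstraint {k n : ℕ} (C : Constraint k n) : List ℕ :=
  (List.finRange k).flatMap fun i => [(C.2 i : ℕ), if C.1 i = -1 then 1 else 0]

/-- Encoding of the input of a certification algorithm: number of variables, number of constraints,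
numerator and denominator of the accuracy `γ`, and the list of all constraints. -/
def encodeInput {k : ℕ} (n : ℕ) (L : List (Constraint k n)) (γ : ℚ≥0) : List ℕ :=
  [n, L.length, γ.num, γ.den] ++ L.flatMap encodeConstraint

/-- Size of the input: number of variables, plus number of constraints, plus bit length of `γ`. -/
def inputSize (n m : ℕ) (γ : ℚ≥0) : ℕ :=
  n + m + Nat.size γ.num + Nat.size γ.den

/-- `A` is computed by one program in polynomial time, whatever the order in which the constraints
of the instance are listed. The answer `true` is output as `1`, and `false` as `0`. -/
def IsPolyTime {k : ℕ} (A : (n : ℕ) → Instance k n → ℚ≥0 → Bool) : Prop :=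
  ∃ (c : RAM.Prog) (q : Polynomial ℕ), ∀ (n : ℕ) (L : List (Constraint k n)) (γ : ℚ≥0),
    RAM.OutputsInTime c (encodeInput n L γ) (if A n (L : Multiset (Constraint k n)) γ then 1 else 0)
      (q.eval (inputSize n L.length γ))

end CSP

/-! Fix an assignment `x` and let `D` be the distribution on sign vectors of the point `c ∘ x_S` of
a uniformly random constraint, so that `x` violates a fraction `D(P⁻¹(0))` of the constraints.
Suppose that all Fourier coefficients of `D` at nonempty sets of at most `t` coordinates are bounded
by `ε`. Deleting them, adding a constant to restore nonnegativity and normalizing gives a `t`-wise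
uniform distribution, whence `D(P⁻¹(0)) ≥ δ - 2ε2^k` (`CSP.IsFarFromTWiseSupporting.mass_ge`). With
`ε = γ/2^(k+1)` it is enough to certify, for each such set, that no assignment correlates with its
parity by more than `ε`.

For a set of size `a + 2h` with `a ≤ 1`, this correlation is a form `∑ w_{juv} X_j Y_u Z_v` in
tensor powers of `x`, where `w` counts constraints with signs. Cauchy-Schwarz in `j` removes `X`.
The products of two entries at the same position `(u,v)` contribute `∑ w²`; the other products form
a bilinear form with a matrix `M`, which is controlled by `tr((M Mᵀ)^(r+1))` for `r` of order `log
n` (`sq_sum_le_of_offDiagonal`). Both quantities are integers, and the algorithm compares them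
exactly with thresholds (`CSP.Shape.Test`). Soundness is therefore deterministic
(`CSP.certify_sound`).

Success requires a bound on the expected trace. Negating a constraint at one position of the shape
reverses its sign and keeps its place in `w`, so exchanging the bits of the two constraints
preserves the measure. This symmetry yields a matrix Efron-Stein inequality for moments
(`Matrix.sum_trace_pow_le_of_involutions`). As `M` is quadratic in the bits, it is first written as
an average over random two-colorings of the positions (`SignedEntries.offDiagonal_eq_sum`); then the
inequality is applied once for each color, with the other color frozen
(`SignedEntries.moment_decoupled_le`, `SignedEntries.moment_gram_le`). What remains are scalar
moments of counts of selected constraints (`bernoulliExp_linear_pow_le`). The outcome is that `M`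
has norm of order `(r+1)² m̄ / n^((a+2h)/2)`. Markov's inequality concludes
(`CSP.prob_certify_false_le`), and since constants depending on `k` are absorbed by spare
logarithms, `K = 0` works.

For efficiency, the tests are written in a small language whose only instructions are additions to
cells inside loops with prescribed numbers of repetitions. Memory is then monotone, so a bound on
the final state bounds the whole run (`RAM.Cmd.exists_exec_compile`). -/

set_option linter.unusedSectionVars false

/-! ### Trace inequalities for real symmetric matrices -/

open Matrix in
/-- Orthogonal diagonalization of a real symmetric matrix, with all its powers. -/
theorem Matrix.exists_orthogonal_diagonalization {n : Type*} [Fintype n] [DecidableEq n]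
    {A : Matrix n n ℝ} (hA : A.IsHermitian) :
    ∃ (U : Matrix n n ℝ) (ev : n → ℝ), U * Uᵀ = 1 ∧ Uᵀ * U = 1 ∧
      (A.PosSemidef → ∀ i, 0 ≤ ev i) ∧
      ∀ j : ℕ, A ^ j = U * diagonal (fun i => ev i ^ j) * Uᵀ := by
  have h1 : (hA.eigenvectorUnitary : Matrix n n ℝ) * (hA.eigenvectorUnitary : Matrix n n ℝ)ᵀ = 1 := by
    have := Unitary.coe_mul_star_self hA.eigenvectorUnitary
    rwa [Unitary.coe_star, Matrix.star_eq_conjTranspose, conjTranspose_eq_transpose_of_trivial] at this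
  have h2 : (hA.eigenvectorUnitary : Matrix n n ℝ)ᵀ * (hA.eigenvectorUnitary : Matrix n n ℝ) = 1 := by
    have := Unitary.coe_star_mul_self hA.eigenvectorUnitary
    rwa [Matrix.star_eq_conjTranspose, conjTranspose_eq_transpose_of_trivial] at this
  refine ⟨hA.eigenvectorUnitary, hA.eigenvalues, h1, h2, fun h => h.eigenvalues_nonneg, ?_⟩
  have h3 : A = (hA.eigenvectorUnitary : Matrix n n ℝ) * diagonal hA.eigenvalues *
      (hA.eigenvectorUnitary : Matrix n n ℝ)ᵀ := by
    conv_lhs => rw [hA.spectral_theorem, Unitary.conjStarAlgAut_apply, Matrix.star_eq_conjTranspose,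
      conjTranspose_eq_transpose_of_trivial]
    rfl
  generalize (hA.eigenvectorUnitary : Matrix n n ℝ) = U at *
  generalize hA.eigenvalues = ev at *
  intro j
  induction j with
  | zero => simp [h1]
  | succ j ih =>
    rw [pow_succ, ih]
    nth_rw 1 [h3]
    rw [show U * diagonal (fun i => ev i ^ j) * Uᵀ * (U * diagonal ev * Uᵀ)
      = U * diagonal (fun i => ev i ^ j) * (Uᵀ * U) * diagonal ev * Uᵀ by
        simp only [Matrix.mul_assoc], h2, Matrix.mul_one, Matrix.mul_assoc U, diagonal_mul_diagonal]
    simp only [pow_succ]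

open Matrix in
/-- Traces of products of powers of two symmetric matrices, in terms of their eigenvalues. -/
theorem Matrix.exists_trace_pow_mul_pow {n : Type*} [Fintype n] [DecidableEq n]
    {A C : Matrix n n ℝ} (hA : A.IsHermitian) (hC : C.IsHermitian) :
    ∃ (ev fv : n → ℝ) (w : n → n → ℝ), (∀ a b, 0 ≤ w a b) ∧
      (A.PosSemidef → ∀ i, 0 ≤ ev i) ∧
      ∀ j l : ℕ, trace (A ^ j * C ^ l) = ∑ a, ∑ b, w a b * (ev a ^ j * fv b ^ l) := by
  obtain ⟨U, ev, hU, hU', hev, hAj⟩ := exists_orthogonal_diagonalization hA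
  obtain ⟨V, fv, hV, hV', -, hCj⟩ := exists_orthogonal_diagonalization hC
  -- The weights are the squared inner products of the two eigenbases. They allow scalar
  -- inequalities to be used termwise although the matrices need not commute.
  refine ⟨ev, fv, fun a b => ((Uᵀ * V) a b) ^ 2, fun a b => sq_nonneg _, hev, fun j l => ?_⟩
  have : trace (A ^ j * C ^ l) = trace (diagonal (fun i => ev i ^ j) * (Uᵀ * V) *
      (diagonal (fun i => fv i ^ l) * (Uᵀ * V)ᵀ)) := by
    rw [hAj, hCj, show U * diagonal (fun i => ev i ^ j) * Uᵀ * (V * diagonal (fun i => fv i ^ l) * Vᵀ)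
      = U * (diagonal (fun i => ev i ^ j) * Uᵀ * (V * diagonal (fun i => fv i ^ l) * Vᵀ)) by
        simp only [Matrix.mul_assoc], trace_mul_comm, transpose_mul, transpose_transpose]
    simp only [Matrix.mul_assoc]
  rw [this, trace]
  refine Finset.sum_congr rfl fun a _ => ?_
  rw [diag_apply, mul_apply]
  refine Finset.sum_congr rfl fun b _ => ?_
  rw [diagonal_mul, diagonal_mul, transpose_apply]
  ring

/-- Weighted AM-GM for one `a` and `p` copies of `y`. The induction step multiplies the previous
case by `a`; the defect is `(p+1) y^p (a-y)²`. -/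
theorem young_pow_succ {a y : ℝ} (ha : 0 ≤ a) (hy : 0 ≤ y) (p : ℕ) :
    (p + 1) * (a * y ^ p) ≤ a ^ (p + 1) + p * y ^ (p + 1) := by
  induction p with
  | zero => simp
  | succ p ih =>
    have h1 := mul_le_mul_of_nonneg_left ih ha
    have h2 : 0 ≤ (p + 1) * y ^ p * (a - y) ^ 2 := by positivity
    push_cast
    ring_nf at h1 h2 ⊢
    linarith

theorem young_pow_even (x y : ℝ) (p : ℕ) :
    (2 * p + 2) * (x ^ (2 * p + 1) * y) ≤ (2 * p + 1) * x ^ (2 * p + 2) + y ^ (2 * p + 2) := by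
  have h := young_pow_succ (abs_nonneg y) (abs_nonneg x) (2 * p + 1)
  have e : Even (2 * p + 1 + 1) := ⟨p + 1, by ring⟩
  rw [e.pow_abs, e.pow_abs] at h
  have h2 : x ^ (2 * p + 1) * y ≤ |y| * |x| ^ (2 * p + 1) := by
    rw [← abs_pow, mul_comm, ← abs_mul]; exact le_abs_self _
  push_cast at h
  have h3 := mul_le_mul_of_nonneg_left h2 (show (0 : ℝ) ≤ 2 * p + 2 by positivity)
  rw [show 2 * p + 2 = 2 * p + 1 + 1 by ring]
  linarith

/-- The quotient of `x^(2p+1) - y^(2p+1)` by `x - y` is a geometric sum. Its terms `i` and `2p - i`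
together are at most `x^(2p) + y^(2p)`, because `|x|^i - |y|^i` and `|x|^(2p-i) - |y|^(2p-i)` have
the same sign. This is the scalar core of the Efron-Stein inequality. -/
theorem sub_mul_pow_sub_pow_le (x y : ℝ) (p : ℕ) :
    (x - y) * (x ^ (2 * p + 1) - y ^ (2 * p + 1)) ≤
      (2 * p + 1) / 2 * ((x - y) ^ 2 * (x ^ (2 * p) + y ^ (2 * p))) := by
  have h1 := geom_sum₂_mul x y (2 * p + 1)
  rw [← h1]
  have key : ∀ i ∈ Finset.range (2 * p + 1), x ^ i * y ^ (2 * p - i) + x ^ (2 * p - i) * y ^ i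
      ≤ x ^ (2 * p) + y ^ (2 * p) := by
    intro i hi
    have hi' : i ≤ 2 * p := by simp at hi; omega
    have hev : Even (2 * p) := even_two_mul p
    have h3 : 0 ≤ (|x| ^ i - |y| ^ i) * (|x| ^ (2 * p - i) - |y| ^ (2 * p - i)) := by
      rcases le_total (|x|) (|y|) with h | h
      · exact mul_nonneg_of_nonpos_of_nonpos
          (sub_nonpos.2 (pow_le_pow_left₀ (abs_nonneg _) h _))
          (sub_nonpos.2 (pow_le_pow_left₀ (abs_nonneg _) h _))
      · exact mul_nonneg (sub_nonneg.2 (pow_le_pow_left₀ (abs_nonneg _) h _))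
          (sub_nonneg.2 (pow_le_pow_left₀ (abs_nonneg _) h _))
    have h4 : x ^ i * y ^ (2 * p - i) ≤ |x| ^ i * |y| ^ (2 * p - i) := by
      rw [← abs_pow, ← abs_pow, ← abs_mul]; exact le_abs_self _
    have h5 : x ^ (2 * p - i) * y ^ i ≤ |x| ^ (2 * p - i) * |y| ^ i := by
      rw [← abs_pow, ← abs_pow, ← abs_mul]; exact le_abs_self _
    have h6 : |x| ^ i * |x| ^ (2 * p - i) = x ^ (2 * p) := by
      rw [← pow_add, Nat.add_sub_cancel' hi', hev.pow_abs]
    have h7 : |y| ^ i * |y| ^ (2 * p - i) = y ^ (2 * p) := by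
      rw [← pow_add, Nat.add_sub_cancel' hi', hev.pow_abs]
    nlinarith
  have h2 : 2 * ∑ i ∈ Finset.range (2 * p + 1), x ^ i * y ^ (2 * p + 1 - 1 - i)
      ≤ (2 * p + 1) * (x ^ (2 * p) + y ^ (2 * p)) := by
    have hr : ∑ i ∈ Finset.range (2 * p + 1), x ^ i * y ^ (2 * p + 1 - 1 - i)
        = ∑ i ∈ Finset.range (2 * p + 1), x ^ (2 * p - i) * y ^ i := by
      rw [← Finset.sum_range_reflect]
      refine Finset.sum_congr rfl fun i hi => ?_
      have hi' : i ≤ 2 * p := by simp at hi; omega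
      rw [show 2 * p + 1 - 1 - i = 2 * p - i by omega, show 2 * p + 1 - 1 - (2 * p - i) = i by omega]
    rw [two_mul]
    nth_rw 2 [hr]
    rw [← Finset.sum_add_distrib]
    calc _ ≤ ∑ i ∈ Finset.range (2 * p + 1), (x ^ (2 * p) + y ^ (2 * p)) := Finset.sum_le_sum key
      _ = _ := by rw [Finset.sum_const, Finset.card_range, nsmul_eq_mul]; push_cast; ring
  have h3 := mul_le_mul_of_nonneg_left h2 (sq_nonneg (x - y))
  linarith

open Matrix in
/-- A moment inequality for random symmetric matrices (matrix Efron-Stein inequality). -/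
theorem Matrix.sum_trace_pow_le_of_involutions {Ω ι n : Type*} [Fintype Ω] [Fintype n] [DecidableEq n]
    (μ : Ω → ℝ) (hμ : ∀ ω, 0 ≤ μ ω) (X : Ω → Matrix n n ℝ) (hX : ∀ ω, (X ω).IsHermitian)
    (A : Finset ι) (K : ι → Ω → Matrix n n ℝ) (τ : ι → Equiv.Perm Ω)
    (hτμ : ∀ e ∈ A, ∀ ω, μ (τ e ω) = μ ω) (hττ : ∀ e ∈ A, ∀ ω, τ e (τ e ω) = ω)
    (hXK : ∀ ω, X ω = ∑ e ∈ A, K e ω) {c : ℝ} (hc : 0 < c)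
    (hXτ : ∀ e ∈ A, ∀ ω, X (τ e ω) = X ω - c • K e ω) (p : ℕ) :
    ∑ ω, μ ω * trace (X ω ^ (2 * p + 2)) ≤
      (c * (2 * p + 1) / 2) ^ (p + 1) * ∑ ω, μ ω * trace ((∑ e ∈ A, K e ω ^ 2) ^ (p + 1)) := by
  have hKX : ∀ e ∈ A, ∀ ω, K e ω = c⁻¹ • (X ω - X (τ e ω)) := by
    intro e he ω
    rw [hXτ e he, sub_sub_cancel, smul_smul, inv_mul_cancel₀ hc.ne', one_smul]
  have hKh : ∀ e ∈ A, ∀ ω, (K e ω).IsHermitian := by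
    intro e he ω
    have h : (X ω - X (τ e ω)).IsHermitian := (hX ω).sub (hX _)
    rw [hKX e he ω, IsHermitian, conjTranspose_smul, h.eq, star_trivial]
  have hKτ : ∀ e ∈ A, ∀ ω, K e (τ e ω) = - K e ω := by
    intro e he ω
    rw [hKX e he, hKX e he, hττ e he, ← smul_neg, neg_sub]
  have hreindex : ∀ e ∈ A, ∀ f : Ω → ℝ, ∑ ω, μ ω * f ω = ∑ ω, μ ω * f (τ e ω) := by
    intro e he f
    rw [← Equiv.sum_comp (τ e)]
    exact Finset.sum_congr rfl fun ω _ => by rw [hτμ e he]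
  -- Exchangeable pairs: averaging the integrand over `ω` and `τ e ω`, where `K e` changes sign,
  -- turns `X^(2p+1)` into the difference `X(ω)^(2p+1) - X(τ e ω)^(2p+1)`.
  have hstep : ∀ e ∈ A, ∑ ω, μ ω * trace (K e ω * X ω ^ (2 * p + 1)) ≤
      c * (2 * p + 1) / 2 * ∑ ω, μ ω * trace (K e ω ^ 2 * X ω ^ (2 * p)) := by
    intro e he
    have hpt : ∀ ω, trace (K e ω * X ω ^ (2 * p + 1)) + trace (K e (τ e ω) * X (τ e ω) ^ (2 * p + 1))
        ≤ c * (2 * p + 1) / 2 * (trace (K e ω ^ 2 * X ω ^ (2 * p)) +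
          trace (K e (τ e ω) ^ 2 * X (τ e ω) ^ (2 * p))) := by
      intro ω
      rw [hKτ e he, neg_mul, trace_neg, neg_sq, hKX e he ω]
      -- All traces below have the form `tr(Y^j Z^l)` up to cyclicity, so they become sums over
      -- pairs of eigenvalues with common nonnegative weights.
      obtain ⟨ev, fv, w, hw, -, hj⟩ := exists_trace_pow_mul_pow (hX ω) (hX (τ e ω))
      set Y := X ω with hY
      set Z := X (τ e ω) with hZ
      have e1 : trace ((Y - Z) * Y ^ (2 * p + 1)) - trace ((Y - Z) * Z ^ (2 * p + 1)) =
          ∑ a, ∑ b, w a b * ((ev a - fv b) * (ev a ^ (2 * p + 1) - fv b ^ (2 * p + 1))) := by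
        have a1 := hj (2 * p + 2) 0
        have a2 := hj (2 * p + 1) 1
        have a3 := hj 1 (2 * p + 1)
        have a4 := hj 0 (2 * p + 2)
        rw [pow_zero, Matrix.mul_one] at a1
        rw [pow_one] at a2 a3
        rw [pow_zero, Matrix.one_mul] at a4
        rw [Matrix.sub_mul, Matrix.sub_mul, trace_sub, trace_sub, ← pow_succ', ← pow_succ',
          trace_mul_comm Z, a1, a2, a3, a4]
        simp only [← Finset.sum_sub_distrib]
        refine Finset.sum_congr rfl fun a _ => Finset.sum_congr rfl fun b _ => ?_
        ring
      have e2 : trace ((Y - Z) ^ 2 * Y ^ (2 * p)) + trace ((Y - Z) ^ 2 * Z ^ (2 * p)) =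
          ∑ a, ∑ b, w a b * ((ev a - fv b) ^ 2 * (ev a ^ (2 * p) + fv b ^ (2 * p))) := by
        have b1 : trace ((Y - Z) ^ 2 * Y ^ (2 * p)) = trace (Y ^ (2 * p + 2) * Z ^ 0)
            - 2 * trace (Y ^ (2 * p + 1) * Z ^ 1) + trace (Y ^ (2 * p) * Z ^ 2) := by
          rw [sq (Y - Z), Matrix.sub_mul, Matrix.mul_sub, Matrix.mul_sub, Matrix.sub_mul,
            Matrix.sub_mul, Matrix.sub_mul, trace_sub, trace_sub, trace_sub]
          have c1 : trace (Y * Z * Y ^ (2 * p)) = trace (Y ^ (2 * p + 1) * Z ^ 1) := by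
            rw [trace_mul_comm, ← Matrix.mul_assoc, ← pow_succ, pow_one]
          have c2 : trace (Z * Y * Y ^ (2 * p)) = trace (Y ^ (2 * p + 1) * Z ^ 1) := by
            rw [Matrix.mul_assoc, ← pow_succ', trace_mul_comm, pow_one]
          have c3 : trace (Z * Z * Y ^ (2 * p)) = trace (Y ^ (2 * p) * Z ^ 2) := by
            rw [trace_mul_comm, sq]
          have c4 : trace (Y * Y * Y ^ (2 * p)) = trace (Y ^ (2 * p + 2) * Z ^ 0) := by
            rw [pow_zero, Matrix.mul_one, Matrix.mul_assoc, ← pow_succ', ← pow_succ']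
          rw [c1, c2, c3, c4]; ring
        have b2 : trace ((Y - Z) ^ 2 * Z ^ (2 * p)) = trace (Y ^ 0 * Z ^ (2 * p + 2))
            - 2 * trace (Y ^ 1 * Z ^ (2 * p + 1)) + trace (Y ^ 2 * Z ^ (2 * p)) := by
          rw [sq (Y - Z), Matrix.sub_mul, Matrix.mul_sub, Matrix.mul_sub, Matrix.sub_mul,
            Matrix.sub_mul, Matrix.sub_mul, trace_sub, trace_sub, trace_sub]
          have c1 : trace (Y * Z * Z ^ (2 * p)) = trace (Y ^ 1 * Z ^ (2 * p + 1)) := by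
            rw [Matrix.mul_assoc, ← pow_succ', pow_one]
          have c2 : trace (Z * Y * Z ^ (2 * p)) = trace (Y ^ 1 * Z ^ (2 * p + 1)) := by
            rw [Matrix.mul_assoc, trace_mul_comm, Matrix.mul_assoc, ← pow_succ, pow_one]
          have c3 : trace (Y * Y * Z ^ (2 * p)) = trace (Y ^ 2 * Z ^ (2 * p)) := by
            rw [sq]
          have c4 : trace (Z * Z * Z ^ (2 * p)) = trace (Y ^ 0 * Z ^ (2 * p + 2)) := by
            rw [pow_zero, Matrix.one_mul, Matrix.mul_assoc, ← pow_succ', ← pow_succ']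
          rw [c1, c2, c3, c4]; ring
        rw [b1, b2]
        simp only [hj, Finset.mul_sum, ← Finset.sum_sub_distrib, ← Finset.sum_add_distrib]
        refine Finset.sum_congr rfl fun a _ => Finset.sum_congr rfl fun b _ => ?_
        ring
      have e3 : ∑ a, ∑ b, w a b * ((ev a - fv b) * (ev a ^ (2 * p + 1) - fv b ^ (2 * p + 1))) ≤
          (2 * p + 1) / 2 *
            ∑ a, ∑ b, w a b * ((ev a - fv b) ^ 2 * (ev a ^ (2 * p) + fv b ^ (2 * p))) := by
        simp only [Finset.mul_sum]
        refine Finset.sum_le_sum fun a _ => Finset.sum_le_sum fun b _ => ?_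
        have := mul_le_mul_of_nonneg_left (sub_mul_pow_sub_pow_le (ev a) (fv b) p) (hw a b)
        linarith
      rw [← e1, ← e2] at e3
      rw [smul_pow, smul_mul_assoc, smul_mul_assoc, smul_mul_assoc, smul_mul_assoc, trace_smul,
        trace_smul, trace_smul, trace_smul, smul_eq_mul, smul_eq_mul, smul_eq_mul, smul_eq_mul,
        ← mul_add, ← sub_eq_add_neg, ← mul_sub]
      have hci : 0 < c⁻¹ := inv_pos.2 hc
      calc _ ≤ c⁻¹ * ((2 * p + 1) / 2 * (trace ((Y - Z) ^ 2 * Y ^ (2 * p)) +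
            trace ((Y - Z) ^ 2 * Z ^ (2 * p)))) := mul_le_mul_of_nonneg_left e3 hci.le
        _ = _ := by field_simp
    have h1 := hreindex e he fun ω => trace (K e ω * X ω ^ (2 * p + 1))
    have h2 := hreindex e he fun ω => trace (K e ω ^ 2 * X ω ^ (2 * p))
    have h3 : ∑ ω, μ ω * (trace (K e ω * X ω ^ (2 * p + 1)) +
        trace (K e (τ e ω) * X (τ e ω) ^ (2 * p + 1))) ≤
        ∑ ω, μ ω * (c * (2 * p + 1) / 2 * (trace (K e ω ^ 2 * X ω ^ (2 * p)) +
          trace (K e (τ e ω) ^ 2 * X (τ e ω) ^ (2 * p)))) :=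
      Finset.sum_le_sum fun ω _ => mul_le_mul_of_nonneg_left (hpt ω) (hμ ω)
    have h4 : ∑ ω, μ ω * (c * (2 * p + 1) / 2 * (trace (K e ω ^ 2 * X ω ^ (2 * p)) +
          trace (K e (τ e ω) ^ 2 * X (τ e ω) ^ (2 * p)))) = c * (2 * p + 1) / 2 *
        (∑ ω, μ ω * trace (K e ω ^ 2 * X ω ^ (2 * p)) +
          ∑ ω, μ ω * trace (K e (τ e ω) ^ 2 * X (τ e ω) ^ (2 * p))) := by
      rw [← Finset.sum_add_distrib, Finset.mul_sum]
      exact Finset.sum_congr rfl fun ω _ => by ring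
    rw [h4, ← h2] at h3
    simp only [mul_add, Finset.sum_add_distrib] at h3
    rw [← h1] at h3
    linarith
  have hV : ∀ ω, (∑ e ∈ A, K e ω ^ 2).PosSemidef := by
    intro ω
    refine posSemidef_sum _ fun e he => ?_
    have := posSemidef_conjTranspose_mul_self (K e ω)
    rwa [(hKh e he ω).eq, ← sq] at this
  set d : ℝ := c * (2 * p + 1) / 2 with hd
  have hd0 : 0 < d := by positivity
  have h1 : ∑ ω, μ ω * trace (X ω ^ (2 * p + 2)) ≤
      d * ∑ ω, μ ω * trace ((∑ e ∈ A, K e ω ^ 2) * X ω ^ (2 * p)) := by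
    calc ∑ ω, μ ω * trace (X ω ^ (2 * p + 2))
        = ∑ e ∈ A, ∑ ω, μ ω * trace (K e ω * X ω ^ (2 * p + 1)) := by
          rw [Finset.sum_comm]
          refine Finset.sum_congr rfl fun ω _ => ?_
          rw [← Finset.mul_sum, ← trace_sum, ← Matrix.sum_mul, ← hXK, ← pow_succ']
      _ ≤ ∑ e ∈ A, d * ∑ ω, μ ω * trace (K e ω ^ 2 * X ω ^ (2 * p)) :=
          Finset.sum_le_sum hstep
      _ = _ := by
          rw [← Finset.mul_sum, Finset.sum_comm]
          congr 1
          refine Finset.sum_congr rfl fun ω _ => ?_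
          rw [← Finset.mul_sum, ← trace_sum, ← Matrix.sum_mul]
  -- Young's inequality separates the variance from `X^(2p)`. It produces `p` copies of the moment
  -- being estimated, against `p + 1` on the left after scaling `h1`, so they can be subtracted at
  -- the end.
  have h2 : ∀ ω, (p + 1) * (d * trace ((∑ e ∈ A, K e ω ^ 2) * X ω ^ (2 * p))) ≤
      d ^ (p + 1) * trace ((∑ e ∈ A, K e ω ^ 2) ^ (p + 1)) + p * trace (X ω ^ (2 * p + 2)) := by
    intro ω
    obtain ⟨ev, fv, w, hw, hpos, hj⟩ := exists_trace_pow_mul_pow (hV ω).isHermitian (hX ω)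
    have a1 := hj 1 (2 * p)
    have a2 := hj (p + 1) 0
    have a3 := hj 0 (2 * p + 2)
    rw [pow_one] at a1
    rw [pow_zero, Matrix.mul_one] at a2
    rw [pow_zero, Matrix.one_mul] at a3
    rw [a1, a2, a3]
    simp only [Finset.mul_sum, ← Finset.sum_add_distrib]
    refine Finset.sum_le_sum fun a _ => Finset.sum_le_sum fun b _ => ?_
    have := young_pow_succ (mul_nonneg hd0.le (hpos (hV ω) a)) (sq_nonneg (fv b)) p
    have := mul_le_mul_of_nonneg_left this (hw a b)
    rw [mul_pow, ← pow_mul, ← pow_mul, show 2 * (p + 1) = 2 * p + 2 by ring] at this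
    linarith
  have h3 : (p + 1) * (d * ∑ ω, μ ω * trace ((∑ e ∈ A, K e ω ^ 2) * X ω ^ (2 * p))) ≤
      d ^ (p + 1) * ∑ ω, μ ω * trace ((∑ e ∈ A, K e ω ^ 2) ^ (p + 1)) +
        p * ∑ ω, μ ω * trace (X ω ^ (2 * p + 2)) := by
    simp only [Finset.mul_sum, ← Finset.sum_add_distrib]
    refine Finset.sum_le_sum fun ω _ => ?_
    have := mul_le_mul_of_nonneg_left (h2 ω) (hμ ω)
    linarith
  have h4 := mul_le_mul_of_nonneg_left h1 (show (0 : ℝ) ≤ p + 1 by positivity)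
  linarith

open Matrix in
/-- Convexity of the trace of an even power. -/
theorem Matrix.trace_pow_sum_smul_le {n κ : Type*} [Fintype n] [DecidableEq n] (A : Finset κ)
    (ν : κ → ℝ) (hν : ∀ i ∈ A, 0 ≤ ν i) (hν1 : ∑ i ∈ A, ν i = 1) (X : κ → Matrix n n ℝ)
    (hX : ∀ i ∈ A, (X i).IsHermitian) (p : ℕ) :
    trace ((∑ i ∈ A, ν i • X i) ^ (2 * p + 2)) ≤ ∑ i ∈ A, ν i * trace (X i ^ (2 * p + 2)) := by
  set Y := ∑ i ∈ A, ν i • X i with hY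
  have hYh : Y.IsHermitian := by
    rw [IsHermitian, hY, conjTranspose_sum]
    exact Finset.sum_congr rfl fun i hi => by rw [conjTranspose_smul, (hX i hi).eq, star_trivial]
  -- The tangent inequality at the mean `Y`. Averaging it over `i` turns `X i` into `Y` on the left.
  have h1 : ∀ i ∈ A, (2 * p + 2) * trace (Y ^ (2 * p + 1) * X i) ≤
      (2 * p + 1) * trace (Y ^ (2 * p + 2)) + trace (X i ^ (2 * p + 2)) := by
    intro i hi
    obtain ⟨ev, fv, w, hw, -, hj⟩ := exists_trace_pow_mul_pow hYh (hX i hi)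
    have a1 := hj (2 * p + 1) 1
    have a2 := hj (2 * p + 2) 0
    have a3 := hj 0 (2 * p + 2)
    rw [pow_one] at a1
    rw [pow_zero, Matrix.mul_one] at a2
    rw [pow_zero, Matrix.one_mul] at a3
    rw [a1, a2, a3]
    simp only [Finset.mul_sum, ← Finset.sum_add_distrib]
    refine Finset.sum_le_sum fun a _ => Finset.sum_le_sum fun b _ => ?_
    have := mul_le_mul_of_nonneg_left (young_pow_even (ev a) (fv b) p) (hw a b)
    rw [pow_one, pow_zero, pow_zero]
    linarith
  have h2 : trace (Y ^ (2 * p + 2)) = ∑ i ∈ A, ν i * trace (Y ^ (2 * p + 1) * X i) := by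
    rw [pow_succ _ (2 * p + 1)]
    nth_rw 2 [hY]
    rw [Matrix.mul_sum, trace_sum]
    exact Finset.sum_congr rfl fun i _ => by rw [Matrix.mul_smul, trace_smul, smul_eq_mul]
  have h3 : (2 * p + 2) * trace (Y ^ (2 * p + 2)) ≤
      (2 * p + 1) * trace (Y ^ (2 * p + 2)) + ∑ i ∈ A, ν i * trace (X i ^ (2 * p + 2)) := by
    calc (2 * p + 2) * trace (Y ^ (2 * p + 2))
        = ∑ i ∈ A, ν i * ((2 * p + 2) * trace (Y ^ (2 * p + 1) * X i)) := by
          rw [h2, Finset.mul_sum]; exact Finset.sum_congr rfl fun i _ => by ring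
      _ ≤ ∑ i ∈ A, ν i * ((2 * p + 1) * trace (Y ^ (2 * p + 2)) + trace (X i ^ (2 * p + 2))) :=
          Finset.sum_le_sum fun i hi => mul_le_mul_of_nonneg_left (h1 i hi) (hν i hi)
      _ = _ := by
          simp only [mul_add, Finset.sum_add_distrib]
          rw [← Finset.sum_mul, hν1, one_mul]
  linarith

open Matrix in
/-- A bilinear form is bounded by the trace of a power of the Gram matrix. -/
theorem Matrix.dotProduct_mulVec_pow_le {m n : Type*} [Fintype m] [DecidableEq m] [Fintype n]
    (B : Matrix m n ℝ) (x : m → ℝ) (y : n → ℝ) (p : ℕ) :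
    (x ⬝ᵥ B *ᵥ y) ^ (2 * p + 2) ≤ trace ((B * Bᵀ) ^ (p + 1)) * ((x ⬝ᵥ x) * (y ⬝ᵥ y)) ^ (p + 1) := by
  have hM : (B * Bᵀ).PosSemidef := by
    have := posSemidef_self_mul_conjTranspose B
    rwa [conjTranspose_eq_transpose_of_trivial] at this
  obtain ⟨U, ev, hU, hU', hev, hj⟩ := exists_orthogonal_diagonalization hM.isHermitian
  have hev := hev hM
  set z := Uᵀ *ᵥ x with hz
  have hquad : ∀ j : ℕ, x ⬝ᵥ ((B * Bᵀ) ^ j) *ᵥ x = ∑ i, ev i ^ j * z i ^ 2 := by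
    intro j
    rw [hj, ← mulVec_mulVec, ← mulVec_mulVec, ← hz, dotProduct_mulVec, ← mulVec_transpose, ← hz]
    rw [dotProduct]
    exact Finset.sum_congr rfl fun i _ => by rw [mulVec_diagonal]; ring
  have htr : trace ((B * Bᵀ) ^ (p + 1)) = ∑ i, ev i ^ (p + 1) := by
    rw [hj, trace_mul_comm, ← Matrix.mul_assoc, hU', Matrix.one_mul, trace_diagonal]
  have h1 : (x ⬝ᵥ B *ᵥ y) ^ 2 ≤ (x ⬝ᵥ (B * Bᵀ) *ᵥ x) * (y ⬝ᵥ y) := by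
    have e1 : x ⬝ᵥ B *ᵥ y = ∑ j, (Bᵀ *ᵥ x) j * y j := by
      rw [dotProduct_mulVec, ← mulVec_transpose]; rfl
    have e2 : x ⬝ᵥ (B * Bᵀ) *ᵥ x = ∑ j, (Bᵀ *ᵥ x) j ^ 2 := by
      rw [← mulVec_mulVec, dotProduct_mulVec, ← mulVec_transpose]
      exact Finset.sum_congr rfl fun j _ => by ring
    have e3 : y ⬝ᵥ y = ∑ j, y j ^ 2 := Finset.sum_congr rfl fun j _ => by ring
    rw [e1, e2, e3]
    exact Finset.sum_mul_sq_le_sq_mul_sq _ _ _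
  have hx2 : x ⬝ᵥ x = ∑ i, z i ^ 2 := by
    have := hquad 0
    simpa using this
  have hq1 : x ⬝ᵥ (B * Bᵀ) *ᵥ x = ∑ i, ev i * z i ^ 2 := by
    have := hquad 1
    simpa using this
  have hyy : 0 ≤ y ⬝ᵥ y := Finset.sum_nonneg fun i _ => mul_self_nonneg _
  -- The quadratic form is at most the largest eigenvalue times the norm squared, and a power of the
  -- largest eigenvalue is at most the sum of the powers, all being nonnegative.
  have h2 : (∑ i, ev i * z i ^ 2) ^ (p + 1) ≤ (∑ i, ev i ^ (p + 1)) * (∑ i, z i ^ 2) ^ (p + 1) := by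
    rcases isEmpty_or_nonempty m with hm | hm
    · simp
    · obtain ⟨i₀, hi₀⟩ := Finite.exists_max ev
      calc (∑ i, ev i * z i ^ 2) ^ (p + 1) ≤ (ev i₀ * ∑ i, z i ^ 2) ^ (p + 1) := by
            refine pow_le_pow_left₀ (Finset.sum_nonneg fun i _ => mul_nonneg (hev i) (sq_nonneg _)) ?_ _
            rw [Finset.mul_sum]
            exact Finset.sum_le_sum fun i _ => mul_le_mul_of_nonneg_right (hi₀ i) (sq_nonneg _)
        _ = ev i₀ ^ (p + 1) * (∑ i, z i ^ 2) ^ (p + 1) := mul_pow _ _ _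
        _ ≤ _ := by
            refine mul_le_mul_of_nonneg_right ?_ (pow_nonneg (Finset.sum_nonneg fun i _ => sq_nonneg _) _)
            exact Finset.single_le_sum (f := fun i => ev i ^ (p + 1))
              (fun i _ => pow_nonneg (hev i) _) (Finset.mem_univ i₀)
  calc (x ⬝ᵥ B *ᵥ y) ^ (2 * p + 2) = ((x ⬝ᵥ B *ᵥ y) ^ 2) ^ (p + 1) := by rw [← pow_mul]; ring_nf
    _ ≤ ((x ⬝ᵥ (B * Bᵀ) *ᵥ x) * (y ⬝ᵥ y)) ^ (p + 1) := pow_le_pow_left₀ (sq_nonneg _) h1 _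
    _ = (∑ i, ev i * z i ^ 2) ^ (p + 1) * (y ⬝ᵥ y) ^ (p + 1) := by rw [mul_pow, hq1]
    _ ≤ (∑ i, ev i ^ (p + 1)) * (∑ i, z i ^ 2) ^ (p + 1) * (y ⬝ᵥ y) ^ (p + 1) :=
        mul_le_mul_of_nonneg_right h2 (pow_nonneg hyy _)
    _ = _ := by rw [htr, hx2, mul_pow, mul_assoc]

/-! ### Rectangular matrices through the symmetric dilation -/

section Dilation
open Matrix

variable {m n : Type*} [Fintype m] [DecidableEq m] [Fintype n] [DecidableEq n]

theorem Matrix.trace_fromBlocks_eq (M : Matrix m m ℝ) (B : Matrix m n ℝ) (B' : Matrix n m ℝ)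
    (N : Matrix n n ℝ) : trace (fromBlocks M B B' N) = trace M + trace N := by
  simp [trace]

/-- The square of the dilation is block diagonal with blocks `B Bᵀ` and `Bᵀ B`, whose powers have
the same trace by cyclicity. -/
theorem Matrix.trace_dilation_pow (B : Matrix m n ℝ) (p : ℕ) :
    trace (fromBlocks 0 B Bᵀ 0 ^ (2 * p + 2)) = 2 * trace ((B * Bᵀ) ^ (p + 1)) := by
  have h1 : fromBlocks 0 B Bᵀ 0 ^ 2 = fromBlocks (B * Bᵀ) 0 0 (Bᵀ * B) := by
    rw [sq, fromBlocks_multiply]; simp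
  have h2 : trace ((Bᵀ * B) ^ (p + 1)) = trace ((B * Bᵀ) ^ (p + 1)) := by
    have h3 : ∀ q : ℕ, (Bᵀ * B) ^ (q + 1) = Bᵀ * (B * Bᵀ) ^ q * B := by
      intro q
      induction q with
      | zero => simp
      | succ q ih => rw [pow_succ, ih, pow_succ (B * Bᵀ)]; simp only [Matrix.mul_assoc]
    rw [h3, Matrix.mul_assoc, trace_mul_comm, Matrix.mul_assoc, ← pow_succ]
  rw [show 2 * p + 2 = 2 * (p + 1) by ring, pow_mul, h1, fromBlocks_diagonal_pow, trace_fromBlocks_eq,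
    h2]
  ring

theorem Matrix.isHermitian_dilation (B : Matrix m n ℝ) :
    (fromBlocks 0 B Bᵀ 0 : Matrix (m ⊕ n) (m ⊕ n) ℝ).IsHermitian := by
  rw [IsHermitian, fromBlocks_conjTranspose]
  simp [conjTranspose_eq_transpose_of_trivial]

theorem Matrix.dilation_sum {ι : Type*} (A : Finset ι) (K : ι → Matrix m n ℝ) :
    (fromBlocks 0 (∑ e ∈ A, K e) (∑ e ∈ A, K e)ᵀ 0 : Matrix (m ⊕ n) (m ⊕ n) ℝ) =
      ∑ e ∈ A, fromBlocks 0 (K e) (K e)ᵀ 0 := by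
  ext i j
  rw [Matrix.sum_apply]
  cases i <;> cases j <;> simp [Matrix.sum_apply]

/-- Dilation is linear, so it carries the hypotheses over to the symmetric case. The square of a
dilated summand has two blocks, which is why both a row variance and a column variance occur. -/
theorem Matrix.sum_trace_gram_pow_le_of_involutions {Ω ι : Type*} [Fintype Ω]
    (μ : Ω → ℝ) (hμ : ∀ ω, 0 ≤ μ ω) (X : Ω → Matrix m n ℝ)
    (A : Finset ι) (K : ι → Ω → Matrix m n ℝ) (τ : ι → Equiv.Perm Ω)
    (hτμ : ∀ e ∈ A, ∀ ω, μ (τ e ω) = μ ω) (hττ : ∀ e ∈ A, ∀ ω, τ e (τ e ω) = ω)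
    (hXK : ∀ ω, X ω = ∑ e ∈ A, K e ω) {c : ℝ} (hc : 0 < c)
    (hXτ : ∀ e ∈ A, ∀ ω, X (τ e ω) = X ω - c • K e ω) (p : ℕ) :
    2 * ∑ ω, μ ω * trace ((X ω * (X ω)ᵀ) ^ (p + 1)) ≤
      (c * (2 * p + 1) / 2) ^ (p + 1) *
        (∑ ω, μ ω * trace ((∑ e ∈ A, K e ω * (K e ω)ᵀ) ^ (p + 1)) +
          ∑ ω, μ ω * trace ((∑ e ∈ A, (K e ω)ᵀ * K e ω) ^ (p + 1))) := by
  have h := sum_trace_pow_le_of_involutions μ hμ (fun ω => fromBlocks 0 (X ω) (X ω)ᵀ 0)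
    (fun ω => isHermitian_dilation _) A (fun e ω => fromBlocks 0 (K e ω) (K e ω)ᵀ 0) τ hτμ hττ
    (fun ω => by rw [← dilation_sum, ← hXK]) hc (fun e he ω => by
      rw [hXτ e he, fromBlocks_smul, sub_eq_add_neg (fromBlocks _ _ _ _), fromBlocks_neg,
        fromBlocks_add]
      simp [sub_eq_add_neg]) p
  simp only [trace_dilation_pow] at h
  have h2 : ∀ ω, trace ((∑ e ∈ A, fromBlocks 0 (K e ω) (K e ω)ᵀ 0 ^ 2) ^ (p + 1)) =
      trace ((∑ e ∈ A, K e ω * (K e ω)ᵀ) ^ (p + 1)) +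
        trace ((∑ e ∈ A, (K e ω)ᵀ * K e ω) ^ (p + 1)) := by
    intro ω
    have : ∑ e ∈ A, fromBlocks 0 (K e ω) (K e ω)ᵀ 0 ^ 2 =
        fromBlocks (∑ e ∈ A, K e ω * (K e ω)ᵀ) 0 0 (∑ e ∈ A, (K e ω)ᵀ * K e ω) := by
      ext i j
      rw [Matrix.sum_apply]
      simp only [sq, fromBlocks_multiply]
      cases i <;> cases j <;> simp [Matrix.sum_apply]
    rw [this, fromBlocks_diagonal_pow, trace_fromBlocks_eq]
  rw [Finset.mul_sum, ← Finset.sum_add_distrib]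
  refine le_trans (le_of_eq (Finset.sum_congr rfl fun ω _ => by ring)) (h.trans (le_of_eq ?_))
  congr 1
  exact Finset.sum_congr rfl fun ω _ => by rw [h2, mul_add]

theorem Matrix.trace_gram_pow_sum_smul_le {κ : Type*} (A : Finset κ)
    (ν : κ → ℝ) (hν : ∀ i ∈ A, 0 ≤ ν i) (hν1 : ∑ i ∈ A, ν i = 1) (X : κ → Matrix m n ℝ) (p : ℕ) :
    trace (((∑ i ∈ A, ν i • X i) * (∑ i ∈ A, ν i • X i)ᵀ) ^ (p + 1)) ≤
      ∑ i ∈ A, ν i * trace ((X i * (X i)ᵀ) ^ (p + 1)) := by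
  have h := trace_pow_sum_smul_le A ν hν hν1 (fun i => fromBlocks 0 (X i) (X i)ᵀ 0)
    (fun i _ => isHermitian_dilation _) p
  have h1 : ∑ i ∈ A, ν i • (fromBlocks 0 (X i) (X i)ᵀ 0 : Matrix (m ⊕ n) (m ⊕ n) ℝ) =
      fromBlocks 0 (∑ i ∈ A, ν i • X i) (∑ i ∈ A, ν i • X i)ᵀ 0 := by
    rw [dilation_sum]
    refine Finset.sum_congr rfl fun i _ => ?_
    rw [fromBlocks_smul]; simp
  simp only [h1, trace_dilation_pow] at h
  have h2 : ∑ i ∈ A, ν i * (2 * trace ((X i * (X i)ᵀ) ^ (p + 1))) =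
      2 * ∑ i ∈ A, ν i * trace ((X i * (X i)ᵀ) ^ (p + 1)) := by
    rw [Finset.mul_sum]; exact Finset.sum_congr rfl fun i _ => by ring
  rw [h2] at h
  linarith

end Dilation

/-! ### Products of Bernoulli distributions and moments of linear forms -/

section Bernoulli

variable {E : Type*} [Fintype E] [DecidableEq E]

/-- The weight of a bit string under the product of Bernoulli distributions. -/
noncomputable def bernoulliWeight (p : ℝ) (b : E → Bool) : ℝ := ∏ e, if b e then p else 1 - p

/-- Expectation under the product of Bernoulli distributions. -/
noncomputable def bernoulliExp (p : ℝ) (f : (E → Bool) → ℝ) : ℝ := ∑ b, bernoulliWeight p b * f b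

/-- The numerical value of a bit. -/
def bitVal (x : Bool) : ℝ := if x then 1 else 0

theorem bitVal_nonneg (x : Bool) : 0 ≤ bitVal x := by cases x <;> simp [bitVal]

theorem bernoulliWeight_nonneg {p : ℝ} (h0 : 0 ≤ p) (h1 : p ≤ 1) (b : E → Bool) :
    0 ≤ bernoulliWeight p b :=
  Finset.prod_nonneg fun e _ => by split_ifs <;> linarith

theorem sum_bernoulliWeight (p : ℝ) : ∑ b : E → Bool, bernoulliWeight p b = 1 := by
  have := Finset.prod_univ_sum (fun _ : E => (Finset.univ : Finset Bool))
    (fun _ x => if x then p else 1 - p)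
  simp only [Fintype.piFinset_univ] at this
  unfold bernoulliWeight
  rw [← this]
  simp

theorem bernoulliWeight_comp (p : ℝ) (σ : Equiv.Perm E) (b : E → Bool) :
    bernoulliWeight p (b ∘ σ) = bernoulliWeight p b :=
  Equiv.prod_comp σ fun e => if b e then p else 1 - p

theorem bernoulliExp_mono {p : ℝ} (h0 : 0 ≤ p) (h1 : p ≤ 1) {f g : (E → Bool) → ℝ}
    (h : ∀ b, f b ≤ g b) : bernoulliExp p f ≤ bernoulliExp p g :=
  Finset.sum_le_sum fun b _ => mul_le_mul_of_nonneg_left (h b) (bernoulliWeight_nonneg h0 h1 b)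

theorem bernoulliExp_add (p : ℝ) (f g : (E → Bool) → ℝ) :
    bernoulliExp p (fun b => f b + g b) = bernoulliExp p f + bernoulliExp p g := by
  simp only [bernoulliExp, mul_add, Finset.sum_add_distrib]

theorem bernoulliExp_sum {ι : Type*} (A : Finset ι) (p : ℝ) (f : ι → (E → Bool) → ℝ) :
    bernoulliExp p (fun b => ∑ i ∈ A, f i b) = ∑ i ∈ A, bernoulliExp p (f i) := by
  simp only [bernoulliExp, Finset.mul_sum]
  exact Finset.sum_comm

theorem bernoulliExp_const_mul (p c : ℝ) (f : (E → Bool) → ℝ) :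
    bernoulliExp p (fun b => c * f b) = c * bernoulliExp p f := by
  simp only [bernoulliExp, Finset.mul_sum]
  exact Finset.sum_congr rfl fun b _ => by ring

theorem bernoulliExp_const (p c : ℝ) : bernoulliExp (E := E) p (fun _ => c) = c := by
  simp only [bernoulliExp, ← Finset.sum_mul, sum_bernoulliWeight, one_mul]

theorem bernoulliExp_nonneg {p : ℝ} (h0 : 0 ≤ p) (h1 : p ≤ 1) {f : (E → Bool) → ℝ}
    (h : ∀ b, 0 ≤ f b) : 0 ≤ bernoulliExp p f :=
  Finset.sum_nonneg fun b _ => mul_nonneg (bernoulliWeight_nonneg h0 h1 b) (h b)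

/-- Conditioning on one bit. -/
theorem bernoulliExp_update (p : ℝ) (e : E) (f : (E → Bool) → ℝ) :
    bernoulliExp p f = bernoulliExp p (fun b => p * f (Function.update b e true) +
      (1 - p) * f (Function.update b e false)) := by
  have key : ∀ g : (E → Bool) → ℝ, bernoulliExp p g = ∑ r : {j // j ≠ e} → Bool,
      (∏ j, if r j then p else 1 - p) * (p * g ((Equiv.funSplitAt e Bool).symm (true, r)) +
        (1 - p) * g ((Equiv.funSplitAt e Bool).symm (false, r))) := by
    intro g
    unfold bernoulliExp
    rw [← Equiv.sum_comp (Equiv.funSplitAt e Bool).symm, Fintype.sum_prod_type_right]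
    refine Finset.sum_congr rfl fun r _ => ?_
    have hw : ∀ x, bernoulliWeight p ((Equiv.funSplitAt e Bool).symm (x, r)) =
        (if x then p else 1 - p) * ∏ j, if r j then p else 1 - p := by
      intro x
      unfold bernoulliWeight
      rw [Fintype.prod_eq_mul_prod_subtype_ne _ e]
      congr 1
      · simp
      · refine Finset.prod_congr rfl fun j _ => ?_
        simp [j.2]
    rw [Fintype.sum_bool, hw, hw]
    simp only [if_true, Bool.false_eq_true, if_false]
    ring
  rw [key f, key]
  refine Finset.sum_congr rfl fun r _ => ?_
  have hu : ∀ x y, Function.update ((Equiv.funSplitAt e Bool).symm (x, r)) e y =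
      (Equiv.funSplitAt e Bool).symm (y, r) := by
    intro x y
    ext j
    by_cases hj : j = e
    · subst hj; simp
    · simp [hj]
  simp only [hu]
  ring

theorem bernoulliExp_bitVal_mul (p : ℝ) (e : E) (f : (E → Bool) → ℝ) :
    bernoulliExp p (fun b => bitVal (b e) * f b) =
      p * bernoulliExp p (fun b => f (Function.update b e true)) := by
  rw [bernoulliExp_update p e, ← bernoulliExp_const_mul]
  congr 1
  ext b
  simp [bitVal]

/-- The function does not depend on the bits in `A`. -/
def IgnoresBits (A : Finset E) (g : (E → Bool) → ℝ) : Prop :=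
  ∀ b, ∀ e ∈ A, ∀ x, g (Function.update b e x) = g b

/-- Moments of a linear form in independent bits. -/
theorem bernoulliExp_linear_pow_le {p : ℝ} (h0 : 0 ≤ p) (h1 : p ≤ 1) (A : Finset E)
    (c : E → (E → Bool) → ℝ) (d : (E → Bool) → ℝ)
    (hc : ∀ e ∈ A, IgnoresBits A (c e)) (hc0 : ∀ e ∈ A, ∀ b, 0 ≤ c e b) (hcd : ∀ e ∈ A, ∀ b, c e b ≤ d b)
    (hd : IgnoresBits A d) (hd0 : ∀ b, 0 ≤ d b) (r : ℕ) :
    ∀ (F a : (E → Bool) → ℝ), IgnoresBits A F → IgnoresBits A a → (∀ b, 0 ≤ F b) → (∀ b, 0 ≤ a b) →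
    bernoulliExp p (fun b => F b * (a b + ∑ e ∈ A, c e b * bitVal (b e)) ^ r) ≤
      bernoulliExp p (fun b => F b * (a b + p * ∑ e ∈ A, c e b + r * d b) ^ r) := by
  -- The offset `a` and the weight `F` vary in the induction: the step adds `d` to the offset and
  -- moves the factor `a + p ∑ c` into the weight.
  induction r with
  | zero => intro F a _ _ _ _; simp
  | succ r ih =>
    intro F a hF ha hF0 ha0
    have hs0 : ∀ b, 0 ≤ ∑ e ∈ A, c e b * bitVal (b e) := fun b =>
      Finset.sum_nonneg fun e he => mul_nonneg (hc0 e he b) (bitVal_nonneg _)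
    have hm0 : ∀ b, 0 ≤ p * ∑ e ∈ A, c e b := fun b =>
      mul_nonneg h0 (Finset.sum_nonneg fun e he => hc0 e he b)
    -- Splitting off one factor of the power leaves a bit `b e`, which may be replaced by the factor
    -- `p` and the value `1`. Forcing the bit to be `1` raises the linear form by at most `c e ≤ d`.
    have hstep : ∀ e ∈ A, bernoulliExp p (fun b => bitVal (b e) *
          (F b * c e b * (a b + ∑ e ∈ A, c e b * bitVal (b e)) ^ r)) ≤
        bernoulliExp p (fun b => p * (F b * c e b * (a b + d b + ∑ e ∈ A, c e b * bitVal (b e)) ^ r)) := by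
      intro e he
      rw [bernoulliExp_bitVal_mul, ← bernoulliExp_const_mul]
      refine bernoulliExp_mono h0 h1 fun b => mul_le_mul_of_nonneg_left ?_ h0
      rw [hF b e he, hc e he b e he, ha b e he]
      refine mul_le_mul_of_nonneg_left (pow_le_pow_left₀ ?_ ?_ r) (mul_nonneg (hF0 b) (hc0 e he b))
      · refine add_nonneg (ha0 b) (Finset.sum_nonneg fun f hf => mul_nonneg ?_ (bitVal_nonneg _))
        rw [hc f hf b e he]; exact hc0 f hf b
      · rw [add_assoc]
        gcongr
        rw [← Finset.add_sum_erase _ _ he, ← Finset.add_sum_erase A (fun f => c f b * bitVal (b f)) he,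
          hc e he b e he]
        have e1 : ∑ f ∈ A.erase e, c f (Function.update b e true) *
            bitVal (Function.update b e true f) = ∑ f ∈ A.erase e, c f b * bitVal (b f) := by
          refine Finset.sum_congr rfl fun f hf => ?_
          rw [Finset.mem_erase] at hf
          rw [hc f hf.2 b e he, Function.update_of_ne hf.1]
        rw [e1, Function.update_self]
        have e2 := mul_nonneg (hc0 e he b) (bitVal_nonneg (b e))
        have e3 := hcd e he b
        simp only [bitVal, if_true, mul_one] at e2 ⊢
        linarith
    calc bernoulliExp p (fun b => F b * (a b + ∑ e ∈ A, c e b * bitVal (b e)) ^ (r + 1))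
        = bernoulliExp p (fun b => F b * a b * (a b + ∑ e ∈ A, c e b * bitVal (b e)) ^ r) +
          ∑ e ∈ A, bernoulliExp p (fun b => bitVal (b e) *
            (F b * c e b * (a b + ∑ e ∈ A, c e b * bitVal (b e)) ^ r)) := by
          rw [← bernoulliExp_sum, ← bernoulliExp_add]
          congr 1
          ext b
          have : ∑ e ∈ A, bitVal (b e) * (F b * c e b * (a b + ∑ e ∈ A, c e b * bitVal (b e)) ^ r) =
              F b * (∑ e ∈ A, c e b * bitVal (b e)) * (a b + ∑ e ∈ A, c e b * bitVal (b e)) ^ r := by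
            rw [Finset.mul_sum, Finset.sum_mul]
            exact Finset.sum_congr rfl fun e _ => by ring
          rw [this]
          ring
      _ ≤ bernoulliExp p (fun b => F b * a b * (a b + d b + ∑ e ∈ A, c e b * bitVal (b e)) ^ r) +
          ∑ e ∈ A, bernoulliExp p (fun b =>
            p * (F b * c e b * (a b + d b + ∑ e ∈ A, c e b * bitVal (b e)) ^ r)) := by
          refine add_le_add (bernoulliExp_mono h0 h1 fun b => ?_) (Finset.sum_le_sum hstep)
          refine mul_le_mul_of_nonneg_left (pow_le_pow_left₀ (add_nonneg (ha0 b) (hs0 b)) ?_ r)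
            (mul_nonneg (hF0 b) (ha0 b))
          have := hd0 b
          linarith
      _ = bernoulliExp p (fun b => (F b * (a b + p * ∑ e ∈ A, c e b)) *
            ((a b + d b) + ∑ e ∈ A, c e b * bitVal (b e)) ^ r) := by
          rw [← bernoulliExp_sum, ← bernoulliExp_add]
          congr 1
          ext b
          rw [← Finset.mul_sum, ← Finset.sum_mul, ← Finset.mul_sum]
          ring
      _ ≤ bernoulliExp p (fun b => (F b * (a b + p * ∑ e ∈ A, c e b)) *
            ((a b + d b) + p * ∑ e ∈ A, c e b + r * d b) ^ r) := by
          refine ih _ _ ?_ ?_ (fun b => mul_nonneg (hF0 b) (add_nonneg (ha0 b) (hm0 b)))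
            (fun b => add_nonneg (ha0 b) (hd0 b))
          · intro b e he x
            beta_reduce
            rw [hF b e he, ha b e he, Finset.sum_congr rfl fun f hf => hc f hf b e he x]
          · intro b e he x
            beta_reduce
            rw [ha b e he, hd b e he]
      _ ≤ _ := by
          refine bernoulliExp_mono h0 h1 fun b => ?_
          rw [mul_assoc, pow_succ']
          have g1 := hd0 b
          have g2 := ha0 b
          have g3 := hm0 b
          have g4 : (0 : ℝ) ≤ r * d b := by positivity
          refine mul_le_mul_of_nonneg_left (mul_le_mul ?_ (pow_le_pow_left₀ (by linarith) ?_ r)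
            (pow_nonneg (by linarith) r) ?_) (hF0 b)
          · push_cast; nlinarith
          · push_cast; nlinarith
          · push_cast; nlinarith

/-- Covariances of distinct bits vanish. This serves twice: for Chebyshev's inequality on the number
of constraints, and for the mean of the sum of squared entries. -/
theorem bernoulliExp_linear_sub_mean_sq (p : ℝ) (t : E → ℝ) :
    bernoulliExp p (fun b => (∑ e, t e * (bitVal (b e) - p)) ^ 2) = p * (1 - p) * ∑ e, t e ^ 2 := by
  have h : ∀ e f : E, bernoulliExp p (fun b => (bitVal (b e) - p) * (bitVal (b f) - p)) =
      if e = f then p * (1 - p) else 0 := by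
    intro e f
    rw [bernoulliExp_update p e]
    split_ifs with hef
    · subst hef
      simp only [Function.update_self]
      rw [bernoulliExp_const]
      simp [bitVal]; ring
    · have : (fun b : E → Bool => p * ((bitVal (Function.update b e true e) - p) *
          (bitVal (Function.update b e true f) - p)) + (1 - p) *
          ((bitVal (Function.update b e false e) - p) * (bitVal (Function.update b e false f) - p)))
          = fun _ => 0 := by
        ext b
        rw [Function.update_of_ne (Ne.symm hef), Function.update_of_ne (Ne.symm hef)]
        simp [bitVal]; ring
      rw [this, bernoulliExp_const]
  have h2 : ∀ b : E → Bool, (∑ e, t e * (bitVal (b e) - p)) ^ 2 =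
      ∑ e, ∑ f, t e * t f * ((bitVal (b e) - p) * (bitVal (b f) - p)) := by
    intro b
    rw [sq, Finset.sum_mul_sum]
    exact Finset.sum_congr rfl fun e _ => Finset.sum_congr rfl fun f _ => by ring
  simp only [h2, bernoulliExp_sum, bernoulliExp_const_mul, h, mul_ite, mul_zero,
    Finset.sum_ite_eq, Finset.mem_univ, if_true]
  rw [Finset.mul_sum]
  exact Finset.sum_congr rfl fun e _ => by ring

end Bernoulli

/-! ### Signed matrix series: decoupled moments conditioned on one half of the bits -/

/-- A finite set `E` of signed entries of a family of matrices indexed by `J`, with rows `R` and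
columns `C`, together with an involution that preserves positions and reverses signs. -/
structure SignedEntries (E J R C : Type*) where
  idx : E → J
  row : E → R
  col : E → C
  sgn : E → ℝ
  flip : E → E
  flip_flip : ∀ e, flip (flip e) = e
  idx_flip : ∀ e, idx (flip e) = idx e
  row_flip : ∀ e, row (flip e) = row e
  col_flip : ∀ e, col (flip e) = col e
  sgn_flip : ∀ e, sgn (flip e) = - sgn e
  sgn_sq : ∀ e, sgn e ^ 2 = 1

namespace SignedEntries
open Matrix

variable {E J R C : Type*} [Fintype E] [DecidableEq E] [Fintype J] [DecidableEq J]
  [Fintype R] [DecidableEq R] [Fintype C] [DecidableEq C] (D : SignedEntries E J R C)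

/-- Exchange of rows and columns. -/
def transpose : SignedEntries E J C R where
  idx := D.idx
  row := D.col
  col := D.row
  sgn := D.sgn
  flip := D.flip
  flip_flip := D.flip_flip
  idx_flip := D.idx_flip
  row_flip := D.col_flip
  col_flip := D.row_flip
  sgn_flip := D.sgn_flip
  sgn_sq := D.sgn_sq

theorem flip_ne (e : E) : D.flip e ≠ e := by
  intro h
  have h1 := D.sgn_flip e
  have h2 := D.sgn_sq e
  rw [h] at h1
  have : D.sgn e = 0 := by linarith
  rw [this] at h2
  norm_num at h2

/-- The antisymmetrized signed bit. -/
noncomputable def coef (b : E → Bool) (e : E) : ℝ :=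
  D.sgn e * (bitVal (b e) - bitVal (b (D.flip e))) / 2

/-- The permutation of bit strings that exchanges the bits at `e` and at its flip. -/
def swapBits (e : E) : Equiv.Perm (E → Bool) where
  toFun b := b ∘ Equiv.swap e (D.flip e)
  invFun b := b ∘ Equiv.swap e (D.flip e)
  left_inv b := by ext; simp
  right_inv b := by ext; simp

theorem swapBits_apply (e : E) (b : E → Bool) : D.swapBits e b = b ∘ Equiv.swap e (D.flip e) := rfl

/-- The swap negates the coefficients of `e` and of its flip and touches no other coefficient. This
is the involution to which the Efron-Stein inequality is applied. -/
theorem coef_swapBits (b : E → Bool) (e f : E) :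
    D.coef (D.swapBits e b) f = D.coef b f -
      ((if f = e then 2 * D.coef b e else 0) + if f = D.flip e then 2 * D.coef b e else 0) := by
  unfold coef
  rw [swapBits_apply]
  simp only [Function.comp]
  by_cases h1 : f = e
  · subst h1
    rw [Equiv.swap_apply_left, Equiv.swap_apply_right, if_pos rfl, if_neg (D.flip_ne f).symm]
    ring
  · by_cases h2 : f = D.flip e
    · subst h2
      rw [Equiv.swap_apply_right, D.flip_flip, Equiv.swap_apply_left, if_neg (D.flip_ne e),
        if_pos rfl, D.sgn_flip]
      ring
    · have h3 : D.flip f ≠ e := fun h => h2 (by rw [← h, D.flip_flip])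
      have h4 : D.flip f ≠ D.flip e := fun h => h1 (by rw [← D.flip_flip f, h, D.flip_flip])
      rw [Equiv.swap_apply_of_ne_of_ne h1 h2, Equiv.swap_apply_of_ne_of_ne h3 h4, if_neg h1,
        if_neg h2]
      ring

theorem sum_flip (A : Finset E) (hA : ∀ e ∈ A, D.flip e ∈ A) (f : E → ℝ) :
    ∑ e ∈ A, f (D.flip e) = ∑ e ∈ A, f e :=
  Finset.sum_nbij' D.flip D.flip hA hA (fun e _ => D.flip_flip e) (fun e _ => D.flip_flip e)
    fun _ _ => rfl

/-- Reindexing by the flip reverses the sign and keeps `g`, so the sum equals the average of itself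
and its reindexed form. The antisymmetrized coefficients are the ones that change sign under swaps.
-/
theorem sum_sgn_mul_eq (A : Finset E) (hA : ∀ e ∈ A, D.flip e ∈ A) (b : E → Bool) (g : E → ℝ)
    (hg : ∀ e, g (D.flip e) = g e) :
    ∑ e ∈ A, D.sgn e * bitVal (b e) * g e = ∑ e ∈ A, D.coef b e * g e := by
  have h := D.sum_flip A hA fun e => D.sgn e * bitVal (b e) * g e
  have h2 : ∑ e ∈ A, D.coef b e * g e = (∑ e ∈ A, D.sgn e * bitVal (b e) * g e +
      ∑ e ∈ A, D.sgn (D.flip e) * bitVal (b (D.flip e)) * g (D.flip e)) / 2 := by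
    rw [← Finset.sum_add_distrib, Finset.sum_div]
    refine Finset.sum_congr rfl fun e _ => ?_
    rw [hg, D.sgn_flip, coef]
    ring
  rw [h2, h]
  ring

/-- For bits `x` and `y` one has `(x - y)²/4 ≤ (x + y)/2`. This leads from the variances of the
matrix inequality back to nonnegative combinations of independent bits. -/
theorem sum_coef_sq_mul_le (A : Finset E) (hA : ∀ e ∈ A, D.flip e ∈ A) (b : E → Bool) (g : E → ℝ)
    (hg : ∀ e, g (D.flip e) = g e) (hg0 : ∀ e, 0 ≤ g e) :
    ∑ e ∈ A, D.coef b e ^ 2 * g e ≤ ∑ e ∈ A, bitVal (b e) * g e := by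
  have h := D.sum_flip A hA fun e => bitVal (b e) * g e
  have h2 : ∑ e ∈ A, D.coef b e ^ 2 * g e ≤
      ∑ e ∈ A, (bitVal (b e) * g e + bitVal (b (D.flip e)) * g (D.flip e)) / 2 := by
    refine Finset.sum_le_sum fun e _ => ?_
    rw [hg, coef, div_pow, mul_pow, D.sgn_sq, ← add_mul]
    have : 1 * (bitVal (b e) - bitVal (b (D.flip e))) ^ 2 / 2 ^ 2 ≤
        (bitVal (b e) + bitVal (b (D.flip e))) / 2 := by
      cases b e <;> cases b (D.flip e) <;> norm_num [bitVal]
    have := mul_le_mul_of_nonneg_right this (hg0 e)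
    linarith
  refine h2.trans (le_of_eq ?_)
  rw [← Finset.sum_div, Finset.sum_add_distrib, h]
  ring

/-- Moments of a signed matrix series. -/
theorem moment_series_le {m n : Type*} [Fintype m] [DecidableEq m] [Fintype n] [DecidableEq n]
    {p : ℝ} (h0 : 0 ≤ p) (h1 : p ≤ 1) (A : Finset E) (hA : ∀ e ∈ A, D.flip e ∈ A)
    (M : E → (E → Bool) → Matrix m n ℝ) (hMflip : ∀ e b, M (D.flip e) b = M e b)
    (hMswap : ∀ e ∈ A, ∀ f b, M f (D.swapBits e b) = M f b) (r : ℕ) :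
    2 * bernoulliExp p (fun b => trace (((∑ e ∈ A, D.coef b e • M e b) *
        (∑ e ∈ A, D.coef b e • M e b)ᵀ) ^ (r + 1))) ≤
      (2 * (2 * r + 1)) ^ (r + 1) *
        (bernoulliExp p (fun b => trace ((∑ e ∈ A, D.coef b e ^ 2 • (M e b * (M e b)ᵀ)) ^ (r + 1))) +
          bernoulliExp p (fun b =>
            trace ((∑ e ∈ A, D.coef b e ^ 2 • ((M e b)ᵀ * M e b)) ^ (r + 1)))) := by
  have h := sum_trace_gram_pow_le_of_involutions (bernoulliWeight p) (bernoulliWeight_nonneg h0 h1)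
    (fun b => ∑ e ∈ A, D.coef b e • M e b) A (fun e b => D.coef b e • M e b) D.swapBits
    (fun e _ b => bernoulliWeight_comp p _ b)
    -- The constant is `4` because the summands at `e` and at its flip are equal and both change
    -- sign.
    (fun e _ b => by ext; simp [swapBits_apply]) (fun b => rfl) (c := 4) (by norm_num)
    (fun e he b => by
      simp only [hMswap e he, coef_swapBits]
      simp only [sub_smul, Finset.sum_sub_distrib, add_smul, Finset.sum_add_distrib, ite_smul,
        zero_smul, Finset.sum_ite_eq', if_pos he, if_pos (hA e he), hMflip]
      congr 1
      rw [smul_smul, ← add_smul]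
      congr 1
      ring) r
  have e1 : ∀ e b, (D.coef b e • M e b) * (D.coef b e • M e b)ᵀ =
      D.coef b e ^ 2 • (M e b * (M e b)ᵀ) := fun e b => by
    rw [transpose_smul, Matrix.smul_mul, Matrix.mul_smul, smul_smul, sq]
  have e2 : ∀ e b, (D.coef b e • M e b)ᵀ * (D.coef b e • M e b) =
      D.coef b e ^ 2 • ((M e b)ᵀ * M e b) := fun e b => by
    rw [transpose_smul, Matrix.smul_mul, Matrix.mul_smul, smul_smul, sq]
  simp only [e1, e2] at h
  rw [show (4 : ℝ) * (2 * r + 1) / 2 = 2 * (2 * r + 1) by ring] at h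
  exact h

/-- The matrix with index `j` made of the entries in `A`. -/
noncomputable def mat (A : Finset E) (b : E → Bool) (j : J) : Matrix R C ℝ :=
  fun u v => ∑ e ∈ A, D.coef b e * if D.idx e = j ∧ D.row e = u ∧ D.col e = v then 1 else 0

theorem mat_apply (A : Finset E) (b : E → Bool) (j : J) (u : R) (v : C) : D.mat A b j u v =
    ∑ e ∈ A, D.coef b e * if D.idx e = j ∧ D.row e = u ∧ D.col e = v then 1 else 0 := rfl

/-- The squared mass of a row of the matrix with index `j`. -/
noncomputable def rowMass (A : Finset E) (b : E → Bool) (u : R) (j : J) : ℝ :=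
  ∑ e ∈ A, D.coef b e ^ 2 * if D.idx e = j ∧ D.row e = u then 1 else 0

theorem rowMass_nonneg (A : Finset E) (b : E → Bool) (u : R) (j : J) : 0 ≤ D.rowMass A b u j :=
  Finset.sum_nonneg fun e _ => mul_nonneg (sq_nonneg _) (by split_ifs <;> norm_num)

/-- A set closed under flips contains both entries of each swap. Hence swaps in one class leave the
other class frozen, which replaces conditioning. -/
theorem coef_swapBits_of_notMem {A : Finset E} (hA : ∀ e ∈ A, D.flip e ∈ A) {e f : E} (he : e ∈ A)
    (hf : f ∉ A) (b : E → Bool) : D.coef (D.swapBits e b) f = D.coef b f := by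
  have h1 : f ≠ e := fun h => hf (by rw [h]; exact he)
  have h2 : f ≠ D.flip e := fun h => hf (by rw [h]; exact hA e he)
  rw [coef_swapBits, if_neg h1, if_neg h2]
  ring

theorem rowMass_swapBits {A A' : Finset E} (hA' : ∀ e ∈ A', D.flip e ∈ A') (hd : Disjoint A A')
    {e : E} (he : e ∈ A') (b : E → Bool) (u : R) (j : J) :
    D.rowMass A (D.swapBits e b) u j = D.rowMass A b u j :=
  Finset.sum_congr rfl fun f hf => by
    rw [D.coef_swapBits_of_notMem hA' he (Finset.disjoint_left.1 hd hf)]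

theorem mat_swapBits {A A' : Finset E} (hA : ∀ e ∈ A, D.flip e ∈ A) (hd : Disjoint A A')
    {e : E} (he : e ∈ A) (b : E → Bool) (j : J) : D.mat A' (D.swapBits e b) j = D.mat A' b j := by
  ext u v
  exact Finset.sum_congr rfl fun f hf => by
    rw [D.coef_swapBits_of_notMem hA he (Finset.disjoint_right.1 hd hf)]

/-- The matrix of the decoupled quadratic form. -/
noncomputable def decoupled (A A' : Finset E) (b : E → Bool) : Matrix (R × R) (C × C) ℝ :=
  fun x y => ∑ j, D.mat A b j x.2 y.2 * D.mat A' b j x.1 y.1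

/-- The weighted Gram matrix of the matrices made of the entries in `A'`. -/
noncomputable def gram (A A' : Finset E) (b : E → Bool) (u : R) : Matrix R R ℝ :=
  ∑ j, D.rowMass A b u j • (D.mat A' b j * (D.mat A' b j)ᵀ)

/-- The tensor product of the matrix unit at the position of `e` with a matrix. -/
noncomputable def unitTensor (A' : Finset E) (b : E → Bool) (e : E) : Matrix (R × R) (C × C) ℝ :=
  Matrix.of fun x y =>
    if D.row e = x.2 ∧ D.col e = y.2 then D.mat A' b (D.idx e) x.1 y.1 else 0

theorem unitTensor_apply (A' : Finset E) (b : E → Bool) (e : E) (x : R × R) (y : C × C) :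
    D.unitTensor A' b e x y =
      if D.row e = x.2 ∧ D.col e = y.2 then D.mat A' b (D.idx e) x.1 y.1 else 0 := rfl

/-- The matrix unit at the position of `f`, weighted by the square root of a row mass. -/
noncomputable def weightedUnit (A : Finset E) (b : E → Bool) (u : R) (f : E) : Matrix R (J × C) ℝ :=
  Matrix.of fun x y =>
    if D.row f = x ∧ D.idx f = y.1 ∧ D.col f = y.2 then √(D.rowMass A b u y.1) else 0

theorem weightedUnit_apply (A : Finset E) (b : E → Bool) (u : R) (f : E) (x : R) (y : J × C) :
    D.weightedUnit A b u f x y =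
      if D.row f = x ∧ D.idx f = y.1 ∧ D.col f = y.2 then √(D.rowMass A b u y.1) else 0 := rfl

/-- For a matrix unit `E` in row `u`, `E Eᵀ` is the diagonal unit at `u`. The row variance of the
tensor series is therefore block diagonal in the second row index, with `gram` as its blocks. -/
theorem trace_sum_gram_eq (A A' : Finset E) (b : E → Bool) (r : ℕ) :
    trace ((∑ e ∈ A, D.coef b e ^ 2 •
      (D.unitTensor A' b e *
       (D.unitTensor A' b e)ᵀ)) ^ r) = ∑ u, trace (D.gram A A' b u ^ r) := by
  have : (∑ e ∈ A, D.coef b e ^ 2 •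
      (D.unitTensor A' b e *
       (D.unitTensor A' b e)ᵀ)) = blockDiagonal (D.gram A A' b) := by
    ext ⟨u', u⟩ ⟨w', w⟩
    rw [Matrix.sum_apply, blockDiagonal_apply]
    simp only [Matrix.smul_apply, mul_apply, transpose_apply, smul_eq_mul, Fintype.sum_prod_type,
      unitTensor_apply]
    have h1 : ∀ e, ∑ x : C, ∑ y : C, (if D.row e = u ∧ D.col e = y then
        D.mat A' b (D.idx e) u' x else 0) * (if D.row e = w ∧ D.col e = y then
        D.mat A' b (D.idx e) w' x else 0) = if D.row e = u ∧ D.row e = w then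
        ∑ x, D.mat A' b (D.idx e) u' x * D.mat A' b (D.idx e) w' x else 0 := by
      intro e
      have h2 : ∀ x y, (if D.row e = u ∧ D.col e = y then D.mat A' b (D.idx e) u' x else 0) *
          (if D.row e = w ∧ D.col e = y then D.mat A' b (D.idx e) w' x else 0) =
          if D.col e = y then (if D.row e = u ∧ D.row e = w then
            D.mat A' b (D.idx e) u' x * D.mat A' b (D.idx e) w' x else 0) else 0 := by
        intro x y
        rw [ite_zero_mul_ite_zero, ← ite_and]
        exact if_congr (by tauto) rfl rfl
      simp only [h2, Finset.sum_ite_eq, Finset.mem_univ, if_true]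
      by_cases h3 : D.row e = u ∧ D.row e = w
      · simp only [if_pos h3]
      · simp only [if_neg h3, Finset.sum_const_zero]
    simp only [h1]
    by_cases huw : u = w
    · subst huw
      simp only [and_self, if_true]
      unfold gram rowMass
      rw [Matrix.sum_apply]
      simp only [Matrix.smul_apply, mul_apply, transpose_apply, smul_eq_mul, Finset.sum_mul]
      rw [Finset.sum_comm]
      refine Finset.sum_congr rfl fun e _ => ?_
      rw [Finset.sum_eq_single (D.idx e)]
      · by_cases hu : D.row e = u <;> simp [hu]
      · intro j _ hj
        simp [Ne.symm hj]
      · simp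
    · rw [if_neg huw]
      refine Finset.sum_eq_zero fun e _ => ?_
      rw [if_neg (fun h => huw (h.1.symm.trans h.2)), mul_zero]
  rw [this, ← blockDiagonal_pow, trace]
  simp only [diag_apply, Fintype.sum_prod_type, blockDiagonal_apply_eq, Pi.pow_apply]
  rw [Finset.sum_comm]
  rfl

/-- With the bits of `A'` frozen, the decoupled matrix is a signed series over `A`, with
coefficients "matrix unit at `e`" tensor "matrix of `A'` with the index of `e`". Its column variance
is the row variance of the transposed data. -/
theorem moment_decoupled_le {p : ℝ} (h0 : 0 ≤ p) (h1 : p ≤ 1) {A A' : Finset E}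
    (hA : ∀ e ∈ A, D.flip e ∈ A) (hd : Disjoint A A') (r : ℕ) :
    2 * bernoulliExp p (fun b => trace ((D.decoupled A A' b * (D.decoupled A A' b)ᵀ) ^ (r + 1))) ≤
      (2 * (2 * r + 1)) ^ (r + 1) *
        (∑ u, bernoulliExp p (fun b => trace (D.gram A A' b u ^ (r + 1))) +
          ∑ v, bernoulliExp p (fun b => trace (D.transpose.gram A A' b v ^ (r + 1)))) := by
  have h := D.moment_series_le h0 h1 A hA (m := R × R) (n := C × C) (fun e b => D.unitTensor A' b e)
    (fun e b => by simp only [unitTensor, D.row_flip, D.col_flip, D.idx_flip])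
    (fun e he f b => by simp only [unitTensor, D.mat_swapBits hA hd he]) r
  rw [← bernoulliExp_sum, ← bernoulliExp_sum]
  have e1 : ∀ b, ∑ e ∈ A, D.coef b e • D.unitTensor A' b e = D.decoupled A A' b := by
    intro b
    ext x y
    rw [Matrix.sum_apply, decoupled]
    simp only [Matrix.smul_apply, smul_eq_mul, unitTensor_apply]
    simp_rw [mat_apply D A, Finset.sum_mul]
    rw [Finset.sum_comm]
    refine Finset.sum_congr rfl fun e _ => ?_
    rw [Finset.sum_eq_single (D.idx e)]
    · by_cases hu : D.row e = x.2 ∧ D.col e = y.2 <;> simp [hu]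
    · intro j _ hj
      simp [Ne.symm hj]
    · simp
  have e2 : ∀ b, trace ((∑ e ∈ A, D.coef b e ^ 2 •
      ((D.unitTensor A' b e)ᵀ *
       D.unitTensor A' b e)) ^ (r + 1)) =
      ∑ v, trace (D.transpose.gram A A' b v ^ (r + 1)) := by
    -- Transposing all entries exchanges the two variances, so the block decomposition for rows also
    -- handles the columns.
    intro b
    rw [← D.transpose.trace_sum_gram_eq]
    have hm : ∀ j, D.transpose.mat A' b j = (D.mat A' b j)ᵀ := by
      intro j
      ext v u
      simp only [mat, transpose_apply, transpose, coef]
      refine Finset.sum_congr rfl fun e _ => ?_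
      congr 1
      exact if_congr (by tauto) rfl rfl
    congr 3
    ext1 e
    congr 2
    · ext y x
      simp only [transpose_apply, unitTensor_apply, hm, and_comm (a := D.row e = x.2)]
      rfl
    · ext x y
      simp only [transpose_apply, unitTensor_apply, hm, and_comm (a := D.row e = x.2)]
      rfl
  simp only [e1, e2, trace_sum_gram_eq] at h
  exact h

/-- Now the bits of `A` are frozen. The matrix `gram` equals `Z Zᵀ`, where `Z` is the signed series
over `A'` of matrix units weighted by square roots of row masses. Both variances of this series are
diagonal, indexed by rows `u'` and by pairs `(j, v)`, so their traces are sums of scalar powers and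
the matrix part of the argument ends here. -/
theorem moment_gram_le {p : ℝ} (h0 : 0 ≤ p) (h1 : p ≤ 1) {A A' : Finset E}
    (hA' : ∀ e ∈ A', D.flip e ∈ A') (hd : Disjoint A A') (u : R) (r : ℕ) :
    2 * bernoulliExp p (fun b => trace (D.gram A A' b u ^ (r + 1))) ≤
      (2 * (2 * r + 1)) ^ (r + 1) *
        (∑ u', bernoulliExp p (fun b => (∑ f ∈ A', D.coef b f ^ 2 *
            if D.row f = u' then D.rowMass A b u (D.idx f) else 0) ^ (r + 1)) +
          ∑ j, ∑ v, bernoulliExp p (fun b => (∑ f ∈ A', D.coef b f ^ 2 *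
            if D.idx f = j ∧ D.col f = v then D.rowMass A b u j else 0) ^ (r + 1))) := by
  have h := D.moment_series_le h0 h1 A' hA' (m := R) (n := J × C) (fun f b => D.weightedUnit A b u f)
    (fun e b => by simp only [weightedUnit, D.row_flip, D.col_flip, D.idx_flip])
    (fun e he f b => by simp only [weightedUnit, D.rowMass_swapBits hA' hd he]) r
  have e1 : ∀ b, (∑ f ∈ A', D.coef b f • D.weightedUnit A b u f) *
      (∑ f ∈ A', D.coef b f • D.weightedUnit A b u f)ᵀ = D.gram A A' b u := by
    intro b
    have e0 : (∑ f ∈ A', D.coef b f • D.weightedUnit A b u f) =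
        Matrix.of fun x y => √(D.rowMass A b u y.1) * D.mat A' b y.1 x y.2 := by
      ext x y
      rw [Matrix.sum_apply, of_apply, mat_apply, Finset.mul_sum]
      refine Finset.sum_congr rfl fun f _ => ?_
      rw [Matrix.smul_apply, smul_eq_mul, weightedUnit_apply]
      by_cases h1 : D.row f = x <;> by_cases h2 : D.idx f = y.1 <;> by_cases h3 : D.col f = y.2 <;>
        simp [h1, h2, h3, mul_comm]
    rw [e0]
    ext x x'
    rw [mul_apply, gram, Matrix.sum_apply, Fintype.sum_prod_type]
    refine Finset.sum_congr rfl fun j _ => ?_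
    rw [Matrix.smul_apply, mul_apply, smul_eq_mul, Finset.mul_sum]
    refine Finset.sum_congr rfl fun v _ => ?_
    simp only [transpose_apply, of_apply]
    linear_combination (D.mat A' b j x v * D.mat A' b j x' v) *
      Real.mul_self_sqrt (D.rowMass_nonneg A b u j)
  have e2 : ∀ b, trace ((∑ f ∈ A', D.coef b f ^ 2 • (D.weightedUnit A b u f *
      (D.weightedUnit A b u f)ᵀ)) ^ (r + 1)) =
      ∑ u', (∑ f ∈ A', D.coef b f ^ 2 *
        if D.row f = u' then D.rowMass A b u (D.idx f) else 0) ^ (r + 1) := by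
    intro b
    have : (∑ f ∈ A', D.coef b f ^ 2 • (D.weightedUnit A b u f *
      (D.weightedUnit A b u f)ᵀ)) =
      diagonal fun u' => ∑ f ∈ A', D.coef b f ^ 2 *
        if D.row f = u' then D.rowMass A b u (D.idx f) else 0 := by
      ext x x'
      rw [Matrix.sum_apply, diagonal_apply]
      have hterm : ∀ f, (D.weightedUnit A b u f *
          (D.weightedUnit A b u f)ᵀ) x x' =
          if D.row f = x ∧ D.row f = x' then D.rowMass A b u (D.idx f) else 0 := by
        intro f
        rw [mul_apply, Finset.sum_eq_single (D.idx f, D.col f)]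
        · rw [transpose_apply, weightedUnit_apply, weightedUnit_apply]
          by_cases hx : D.row f = x <;> by_cases hx' : D.row f = x' <;>
            simp [hx, hx', Real.mul_self_sqrt (D.rowMass_nonneg A b u (D.idx f))]
        · rintro ⟨j, v⟩ _ hjv
          rw [transpose_apply, weightedUnit_apply, weightedUnit_apply]
          have : ¬ (D.row f = x ∧ D.idx f = j ∧ D.col f = v) := by
            rintro ⟨_, rfl, rfl⟩; exact hjv rfl
          rw [if_neg this, zero_mul]
        · simp
      simp only [Matrix.smul_apply, hterm, smul_eq_mul]
      by_cases hxx : x = x'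
      · subst hxx
        simp
      · rw [if_neg hxx]
        refine Finset.sum_eq_zero fun f _ => ?_
        rw [if_neg (fun h => hxx (h.1.symm.trans h.2)), mul_zero]
    rw [this, diagonal_pow, trace_diagonal]
    rfl
  have e3 : ∀ b, trace ((∑ f ∈ A', D.coef b f ^ 2 • ((D.weightedUnit A b u f)ᵀ *
      D.weightedUnit A b u f)) ^ (r + 1)) =
      ∑ j, ∑ v, (∑ f ∈ A', D.coef b f ^ 2 *
            if D.idx f = j ∧ D.col f = v then D.rowMass A b u j else 0) ^ (r + 1) := by
    intro b
    have : (∑ f ∈ A', D.coef b f ^ 2 • ((D.weightedUnit A b u f)ᵀ *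
      D.weightedUnit A b u f)) =
      diagonal fun y => ∑ f ∈ A', D.coef b f ^ 2 *
            if D.idx f = y.1 ∧ D.col f = y.2 then D.rowMass A b u y.1 else 0 := by
      ext y y'
      rw [Matrix.sum_apply, diagonal_apply]
      have hterm : ∀ f, ((D.weightedUnit A b u f)ᵀ *
          D.weightedUnit A b u f) y y' =
          if (D.idx f = y.1 ∧ D.col f = y.2) ∧ (D.idx f = y'.1 ∧ D.col f = y'.2) then
            D.rowMass A b u y.1 else 0 := by
        intro f
        rw [mul_apply, Finset.sum_eq_single (D.row f)]
        · rw [transpose_apply, weightedUnit_apply, weightedUnit_apply]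
          rw [ite_zero_mul_ite_zero]
          by_cases hx : (D.idx f = y.1 ∧ D.col f = y.2) ∧ (D.idx f = y'.1 ∧ D.col f = y'.2)
          · have h3 : y'.1 = y.1 := hx.2.1.symm.trans hx.1.1
            rw [if_pos ⟨⟨rfl, hx.1⟩, rfl, hx.2⟩, if_pos hx, h3,
              Real.mul_self_sqrt (D.rowMass_nonneg A b u y.1)]
          · rw [if_neg (fun h => hx ⟨h.1.2, h.2.2⟩), if_neg hx]
        · intro x _ hx
          rw [transpose_apply, weightedUnit_apply, weightedUnit_apply, if_neg (fun h => hx h.1.symm), zero_mul]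
        · simp
      simp only [Matrix.smul_apply, hterm, smul_eq_mul]
      by_cases hxx : y = y'
      · subst hxx
        simp
      · rw [if_neg hxx]
        refine Finset.sum_eq_zero fun f _ => ?_
        rw [if_neg, mul_zero]
        rintro ⟨⟨h1, h2⟩, h3, h4⟩
        exact hxx (Prod.ext (h1.symm.trans h3) (h2.symm.trans h4))
    rw [this, diagonal_pow, trace_diagonal, Fintype.sum_prod_type]
    rfl
  simp only [e1, e2, e3, bernoulliExp_sum] at h
  exact h

end SignedEntries

/-! ### Scalar moments, and decoupling by random two-colorings -/

namespace SignedEntries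
open Matrix

variable {E J R C : Type*} [Fintype E] [DecidableEq E] [Fintype J] [DecidableEq J]
  [Fintype R] [DecidableEq R] [Fintype C] [DecidableEq C] (D : SignedEntries E J R C)

theorem exp_mul_linear_pow_le {p : ℝ} (h0 : 0 ≤ p) (h1 : p ≤ 1) (A : Finset E) (c : E → ℝ)
    (hc0 : ∀ e, 0 ≤ c e) (hc1 : ∀ e, c e ≤ 1) (F : (E → Bool) → ℝ) (hF : IgnoresBits A F)
    (hF0 : ∀ b, 0 ≤ F b) (n : ℕ) :
    bernoulliExp p (fun b => F b * (∑ e ∈ A, c e * bitVal (b e)) ^ n) ≤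
      bernoulliExp p F * (p * ∑ e, c e + n) ^ n := by
  have h := bernoulliExp_linear_pow_le h0 h1 A (fun e _ => c e) (fun _ => 1)
    (fun e _ b e _ x => rfl) (fun e _ b => hc0 e) (fun e _ b => hc1 e) (fun b e _ x => rfl)
    (fun b => zero_le_one) n F (fun _ => 0) hF (fun b e _ x => rfl) hF0 (fun b => le_rfl)
  simp only [zero_add, mul_one] at h
  refine h.trans ?_
  rw [mul_comm (bernoulliExp p F), ← bernoulliExp_const_mul]
  refine bernoulliExp_mono h0 h1 fun b => ?_
  rw [mul_comm]
  refine mul_le_mul_of_nonneg_right (pow_le_pow_left₀ ?_ ?_ n) (hF0 b)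
  · exact add_nonneg (mul_nonneg h0 (Finset.sum_nonneg fun e _ => hc0 e)) (Nat.cast_nonneg n)
  · gcongr
    · exact fun e _ _ => hc0 e
    · exact Finset.subset_univ A

theorem exp_linear_pow_le {p : ℝ} (h0 : 0 ≤ p) (h1 : p ≤ 1) (A : Finset E) (c : E → ℝ)
    (hc0 : ∀ e, 0 ≤ c e) (hc1 : ∀ e, c e ≤ 1) (n : ℕ) :
    bernoulliExp p (fun b => (∑ e ∈ A, c e * bitVal (b e)) ^ n) ≤ (p * ∑ e, c e + n) ^ n := by
  have h := exp_mul_linear_pow_le h0 h1 A c hc0 hc1 (fun _ => 1) (fun _ _ _ _ => rfl)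
    (fun _ => zero_le_one) n
  simpa [bernoulliExp_const] using h

/-- The number of selected entries of a row. -/
noncomputable def rowCount (A : Finset E) (b : E → Bool) (u : R) (j : J) : ℝ :=
  ∑ e ∈ A, (if D.idx e = j ∧ D.row e = u then 1 else 0) * bitVal (b e)

theorem rowCount_nonneg (A : Finset E) (b : E → Bool) (u : R) (j : J) : 0 ≤ D.rowCount A b u j :=
  Finset.sum_nonneg fun e _ => mul_nonneg (by split_ifs <;> norm_num) (bitVal_nonneg _)

/-- Replacing masses by counts leaves expressions linear in the bits of each class separately. -/
theorem rowMass_le_rowCount {A : Finset E} (hA : ∀ e ∈ A, D.flip e ∈ A) (b : E → Bool) (u : R)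
    (j : J) : D.rowMass A b u j ≤ D.rowCount A b u j := by
  refine (D.sum_coef_sq_mul_le A hA b _ (fun e => ?_) (fun e => ?_)).trans (le_of_eq ?_)
  · rw [D.idx_flip, D.row_flip]
  · split_ifs <;> norm_num
  · exact Finset.sum_congr rfl fun e _ => mul_comm _ _

theorem rowCount_ignoresBits {A A' : Finset E} (hd : Disjoint A A') (u : R) (j : J) :
    IgnoresBits A' fun b => D.rowCount A b u j := by
  intro b e he x
  refine Finset.sum_congr rfl fun f hf => ?_
  have : f ≠ e := fun h => Finset.disjoint_left.1 hd hf (h ▸ he)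
  rw [Function.update_of_ne this]

theorem moment_rowCount_le {p : ℝ} (h0 : 0 ≤ p) (h1 : p ≤ 1) (A : Finset E) {β : ℝ}
    (hβ : ∀ j u, p * ∑ e, (if D.idx e = j ∧ D.row e = u then 1 else 0) ≤ β) (u : R) (j : J) (n : ℕ) :
    bernoulliExp p (fun b => D.rowCount A b u j ^ n) ≤ (β + n) ^ n := by
  have hc0 : ∀ e, (0 : ℝ) ≤ if D.idx e = j ∧ D.row e = u then 1 else 0 := fun e => by
    split_ifs <;> norm_num
  refine (exp_linear_pow_le h0 h1 A _ hc0 (fun e => by split_ifs <;> norm_num) n).trans ?_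
  refine pow_le_pow_left₀ ?_ (by linarith [hβ j u]) n
  exact add_nonneg (mul_nonneg h0 (Finset.sum_nonneg fun e _ => hc0 e)) (Nat.cast_nonneg n)

theorem sum_rowCount (A : Finset E) (b : E → Bool) (u : R) :
    ∑ j, D.rowCount A b u j = ∑ e ∈ A, (if D.row e = u then 1 else 0) * bitVal (b e) := by
  unfold rowCount
  rw [Finset.sum_comm]
  refine Finset.sum_congr rfl fun e _ => ?_
  rw [← Finset.sum_mul, Finset.sum_eq_single (D.idx e)]
  · simp
  · intro j _ hj
    simp [Ne.symm hj]
  · simp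

theorem moment_sum_rowCount_le {p : ℝ} (h0 : 0 ≤ p) (h1 : p ≤ 1) (A : Finset E) {β : ℝ}
    (hβ : ∀ j u, p * ∑ e, (if D.idx e = j ∧ D.row e = u then 1 else 0) ≤ β) (u : R) (n : ℕ) :
    bernoulliExp p (fun b => (∑ j, D.rowCount A b u j) ^ n) ≤ (Fintype.card J * β + n) ^ n := by
  have hc0 : ∀ e, (0 : ℝ) ≤ if D.row e = u then 1 else 0 := fun e => by split_ifs <;> norm_num
  simp only [sum_rowCount]
  refine (exp_linear_pow_le h0 h1 A _ hc0 (fun e => by split_ifs <;> norm_num) n).trans ?_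
  refine pow_le_pow_left₀ ?_ ?_ n
  · exact add_nonneg (mul_nonneg h0 (Finset.sum_nonneg fun e _ => hc0 e)) (Nat.cast_nonneg n)
  · have : p * ∑ e, (if D.row e = u then (1 : ℝ) else 0) ≤ Fintype.card J * β := by
      calc p * ∑ e, (if D.row e = u then (1 : ℝ) else 0)
          = ∑ j, p * ∑ e, (if D.idx e = j ∧ D.row e = u then 1 else 0) := by
            rw [← Finset.mul_sum, Finset.sum_comm]
            congr 1
            refine Finset.sum_congr rfl fun e _ => ?_
            rw [Finset.sum_eq_single (D.idx e)]
            · simp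
            · intro j _ hj
              simp [Ne.symm hj]
            · simp
        _ ≤ ∑ _j : J, β := Finset.sum_le_sum fun j _ => hβ j u
        _ = _ := by simp
    linarith

/-- Given the bits of `A`, this is a linear form in the bits of `A'` whose coefficients are at most
the largest row count and whose mean is at most `β` times the sum of the row counts. The power of
the maximum is bounded by the sum of the powers over `j`, at the price of a factor `|J|` that later
is negligible against the high power. -/
theorem moment_cross_le {p : ℝ} (h0 : 0 ≤ p) (h1 : p ≤ 1) {A A' : Finset E} (hd : Disjoint A A')
    {β : ℝ} (hβ0 : 0 ≤ β)
    (hβ : ∀ j u, p * ∑ e, (if D.idx e = j ∧ D.row e = u then 1 else 0) ≤ β) (u u' : R) (r : ℕ) :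
    bernoulliExp p (fun b => (∑ f ∈ A', (if D.row f = u' then D.rowCount A b u (D.idx f) else 0) *
        bitVal (b f)) ^ (r + 1)) ≤
      2 ^ r * (β ^ (r + 1) * (Fintype.card J * β + (r + 1)) ^ (r + 1) +
        (r + 1) ^ (r + 1) * (Fintype.card J * (β + (r + 1)) ^ (r + 1))) := by
  have hle : ∀ b j, D.rowCount A b u j ≤ ⨆ j, D.rowCount A b u j := fun b j =>
    le_ciSup (Set.finite_range fun j => D.rowCount A b u j).bddAbove j
  have hsup0 : ∀ b, 0 ≤ ⨆ j, D.rowCount A b u j := fun b =>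
    Real.iSup_nonneg fun j => D.rowCount_nonneg A b u j
  have hign : ∀ j b, ∀ e ∈ A', ∀ x, D.rowCount A (Function.update b e x) u j = D.rowCount A b u j :=
    fun j => D.rowCount_ignoresBits hd u j
  have h := bernoulliExp_linear_pow_le h0 h1 A'
    (fun f b => if D.row f = u' then D.rowCount A b u (D.idx f) else 0)
    (fun b => ⨆ j, D.rowCount A b u j)
    (fun f _ b e he x => by simp only [hign _ b e he x])
    (fun f _ b => by split_ifs; exacts [D.rowCount_nonneg A b u _, le_rfl])
    (fun f _ b => by split_ifs; exacts [hle b _, hsup0 b])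
    (fun b e he x => by simp only [hign _ b e he x]) hsup0 (r + 1) (fun _ => 1) (fun _ => 0)
    (fun _ _ _ _ => rfl) (fun _ _ _ _ => rfl) (fun _ => zero_le_one) (fun _ => le_rfl)
  simp only [one_mul, zero_add] at h
  have hpt : ∀ b, (p * ∑ e ∈ A', (if D.row e = u' then D.rowCount A b u (D.idx e) else 0) +
        ((r + 1 : ℕ) : ℝ) * ⨆ j, D.rowCount A b u j) ^ (r + 1) ≤
      2 ^ r * (β ^ (r + 1) * (∑ j, D.rowCount A b u j) ^ (r + 1) +
        (r + 1) ^ (r + 1) * ∑ j, D.rowCount A b u j ^ (r + 1)) := by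
    intro b
    have e1 : p * ∑ e ∈ A', (if D.row e = u' then D.rowCount A b u (D.idx e) else 0) ≤
        β * ∑ j, D.rowCount A b u j := by
      have e2 : ∑ e ∈ A', (if D.row e = u' then D.rowCount A b u (D.idx e) else 0) ≤
          ∑ e, (if D.row e = u' then D.rowCount A b u (D.idx e) else 0) := by
        refine Finset.sum_le_sum_of_subset_of_nonneg (Finset.subset_univ _) fun e _ _ => ?_
        split_ifs
        exacts [D.rowCount_nonneg A b u _, le_rfl]
      have e3 : ∑ e, (if D.row e = u' then D.rowCount A b u (D.idx e) else 0) =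
          ∑ j, D.rowCount A b u j * ∑ e, (if D.idx e = j ∧ D.row e = u' then 1 else 0) := by
        simp only [Finset.mul_sum]
        rw [Finset.sum_comm]
        refine Finset.sum_congr rfl fun e _ => ?_
        rw [Finset.sum_eq_single (D.idx e)]
        · by_cases hu : D.row e = u' <;> simp [hu]
        · intro j _ hj
          simp [Ne.symm hj]
        · simp
      refine (mul_le_mul_of_nonneg_left (e2.trans e3.le) h0).trans ?_
      rw [Finset.mul_sum, Finset.mul_sum]
      refine Finset.sum_le_sum fun j _ => ?_
      have := mul_le_mul_of_nonneg_left (hβ j u') (D.rowCount_nonneg A b u j)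
      linarith
    have e4 : (⨆ j, D.rowCount A b u j) ^ (r + 1) ≤ ∑ j, D.rowCount A b u j ^ (r + 1) := by
      rcases isEmpty_or_nonempty J with hJ | hJ
      · simp
      · obtain ⟨j, hj⟩ := exists_eq_ciSup_of_finite (f := fun j => D.rowCount A b u j)
        rw [← hj]
        exact Finset.single_le_sum (f := fun j => D.rowCount A b u j ^ (r + 1))
          (fun j _ => pow_nonneg (D.rowCount_nonneg A b u j) _) (Finset.mem_univ j)
    have e5 : 0 ≤ p * ∑ e ∈ A', (if D.row e = u' then D.rowCount A b u (D.idx e) else 0) :=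
      mul_nonneg h0 (Finset.sum_nonneg fun e _ => by
        split_ifs; exacts [D.rowCount_nonneg A b u _, le_rfl])
    have e6 : 0 ≤ ((r + 1 : ℕ) : ℝ) * ⨆ j, D.rowCount A b u j :=
      mul_nonneg (Nat.cast_nonneg _) (hsup0 b)
    -- Convexity of the power separates mean and fluctuation, which accounts for the factor `2 ^ r`.
    refine (add_pow_le e5 e6 (r + 1)).trans ?_
    rw [Nat.add_sub_cancel, ← mul_pow, mul_pow _ (⨆ j, _)]
    push_cast
    gcongr
  refine h.trans ((bernoulliExp_mono h0 h1 hpt).trans ?_)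
  rw [bernoulliExp_const_mul, bernoulliExp_add, bernoulliExp_const_mul, bernoulliExp_const_mul,
    bernoulliExp_sum]
  have g1 := D.moment_sum_rowCount_le h0 h1 A hβ u (r + 1)
  have g2 : ∑ j, bernoulliExp p (fun b => D.rowCount A b u j ^ (r + 1)) ≤
      Fintype.card J * (β + (r + 1)) ^ (r + 1) := by
    calc _ ≤ ∑ _j : J, (β + ((r + 1 : ℕ) : ℝ)) ^ (r + 1) :=
          Finset.sum_le_sum fun j _ => D.moment_rowCount_le h0 h1 A hβ u j (r + 1)
      _ = _ := by simp
  push_cast at g1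
  gcongr

/-- The number `d` is a common scale: `|J| β²` is the square of the size expected from the means,
and `β ≤ d`, `1 ≤ d` make every fluctuation term at most a power of `(r+1)² d²`. Row sums come from
`moment_cross_le`; column sums factor into a count from `A` and an independent count from `A'`. -/
theorem exp_trace_gram_le {p : ℝ} (h0 : 0 ≤ p) (h1 : p ≤ 1) {A A' : Finset E}
    (hA : ∀ e ∈ A, D.flip e ∈ A) (hA' : ∀ e ∈ A', D.flip e ∈ A') (hd : Disjoint A A') {β d : ℝ}
    (hβ0 : 0 ≤ β)
    (hβ : ∀ j u, p * ∑ e, (if D.idx e = j ∧ D.row e = u then 1 else 0) ≤ β)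
    (hβ' : ∀ j v, p * ∑ e, (if D.idx e = j ∧ D.col e = v then 1 else 0) ≤ β)
    (hd1 : 1 ≤ d) (hβd : β ≤ d) (hJd : Fintype.card J * β ^ 2 ≤ d ^ 2) (u : R) (r : ℕ) :
    bernoulliExp p (fun b => trace (D.gram A A' b u ^ (r + 1))) ≤
      (4 * (r + 1)) ^ (r + 1) * ((Fintype.card R + Fintype.card J * Fintype.card C) *
        ((1 + Fintype.card J) * (4 * (r + 1) ^ 2 * d ^ 2) ^ (r + 1))) := by
  have hn : (0 : ℝ) ≤ r := Nat.cast_nonneg r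
  have hcJ : (0 : ℝ) ≤ Fintype.card J := Nat.cast_nonneg _
  set G : ℝ := (1 + Fintype.card J) * (4 * (r + 1) ^ 2 * d ^ 2) ^ (r + 1) with hG
  have hG0 : 0 ≤ G := by positivity
  have b1 : ∀ u', bernoulliExp p (fun b => (∑ f ∈ A', D.coef b f ^ 2 *
      if D.row f = u' then D.rowMass A b u (D.idx f) else 0) ^ (r + 1)) ≤ G := by
    intro u'
    have step : bernoulliExp p (fun b => (∑ f ∈ A', D.coef b f ^ 2 *
        if D.row f = u' then D.rowMass A b u (D.idx f) else 0) ^ (r + 1)) ≤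
        bernoulliExp p (fun b => (∑ f ∈ A',
          (if D.row f = u' then D.rowCount A b u (D.idx f) else 0) * bitVal (b f)) ^ (r + 1)) := by
      refine bernoulliExp_mono h0 h1 fun b => pow_le_pow_left₀ (Finset.sum_nonneg fun f _ =>
        mul_nonneg (sq_nonneg _) ?_) ?_ _
      · split_ifs; exacts [D.rowMass_nonneg A b u _, le_rfl]
      · refine (D.sum_coef_sq_mul_le A' hA' b _ (fun e => ?_) (fun e => ?_)).trans
          (Finset.sum_le_sum fun f _ => ?_)
        · rw [D.row_flip, D.idx_flip]
        · split_ifs; exacts [D.rowMass_nonneg A b u _, le_rfl]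
        · rw [mul_comm]
          refine mul_le_mul_of_nonneg_right ?_ (bitVal_nonneg _)
          split_ifs; exacts [D.rowMass_le_rowCount hA b u _, le_rfl]
    refine step.trans ((D.moment_cross_le h0 h1 hd hβ0 hβ u u' r).trans ?_)
    have k1 : β * (Fintype.card J * β + (r + 1)) ≤ 2 * ((r + 1) ^ 2 * d ^ 2) := by
      have : β * (r + 1) ≤ (r + 1) ^ 2 * d ^ 2 := by
        calc β * (r + 1) ≤ d * (r + 1) := by gcongr
          _ = (r + 1) * 1 * (d * 1) := by ring
          _ ≤ (r + 1) * (r + 1) * (d * d) := by gcongr; linarith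
          _ = _ := by ring
      have h2 : d ^ 2 ≤ (r + 1) ^ 2 * d ^ 2 := by
        have : (1 : ℝ) ≤ (r + 1) ^ 2 := one_le_pow₀ (by linarith)
        nlinarith [sq_nonneg d]
      nlinarith
    have k2 : (r + 1) * (β + (r + 1)) ≤ 2 * ((r + 1) ^ 2 * d ^ 2) := by
      have : (r + 1 : ℝ) * β ≤ (r + 1) ^ 2 * d ^ 2 := by
        calc (r + 1 : ℝ) * β ≤ (r + 1) * d := by gcongr
          _ = (r + 1) * 1 * (d * 1) := by ring
          _ ≤ (r + 1) * (r + 1) * (d * d) := by gcongr; linarith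
          _ = _ := by ring
      have h3 : (r + 1 : ℝ) ^ 2 ≤ (r + 1) ^ 2 * d ^ 2 := by
        have : (1 : ℝ) ≤ d ^ 2 := one_le_pow₀ hd1
        nlinarith [sq_nonneg ((r : ℝ) + 1)]
      nlinarith
    rw [← mul_pow, show ((r : ℝ) + 1) ^ (r + 1) * (Fintype.card J * (β + (r + 1)) ^ (r + 1)) =
      Fintype.card J * ((r + 1) * (β + (r + 1))) ^ (r + 1) by rw [mul_pow]; ring]
    calc (2 : ℝ) ^ r * ((β * (Fintype.card J * β + (r + 1))) ^ (r + 1) +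
          Fintype.card J * ((r + 1) * (β + (r + 1))) ^ (r + 1))
        ≤ 2 ^ (r + 1) * ((2 * ((r + 1) ^ 2 * d ^ 2)) ^ (r + 1) +
          Fintype.card J * (2 * ((r + 1) ^ 2 * d ^ 2)) ^ (r + 1)) := by
          gcongr
          · norm_num
          · omega
      _ = G := by
          rw [hG, show (4 : ℝ) * (r + 1) ^ 2 * d ^ 2 = 2 * (2 * ((r + 1) ^ 2 * d ^ 2)) by ring,
            mul_pow 2 (2 * (((r : ℝ) + 1) ^ 2 * d ^ 2))]
          ring
  have b2 : ∀ j v, bernoulliExp p (fun b => (∑ f ∈ A', D.coef b f ^ 2 *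
      if D.idx f = j ∧ D.col f = v then D.rowMass A b u j else 0) ^ (r + 1)) ≤ G := by
    intro j v
    have step : bernoulliExp p (fun b => (∑ f ∈ A', D.coef b f ^ 2 *
        if D.idx f = j ∧ D.col f = v then D.rowMass A b u j else 0) ^ (r + 1)) ≤
        bernoulliExp p (fun b => D.rowCount A b u j ^ (r + 1) * (∑ f ∈ A',
          (if D.idx f = j ∧ D.col f = v then 1 else 0) * bitVal (b f)) ^ (r + 1)) := by
      refine bernoulliExp_mono h0 h1 fun b => ?_
      rw [← mul_pow]
      refine pow_le_pow_left₀ (Finset.sum_nonneg fun f _ => mul_nonneg (sq_nonneg _) ?_) ?_ _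
      · split_ifs; exacts [D.rowMass_nonneg A b u _, le_rfl]
      · refine (D.sum_coef_sq_mul_le A' hA' b _ (fun e => ?_) (fun e => ?_)).trans ?_
        · rw [D.col_flip, D.idx_flip]
        · split_ifs; exacts [D.rowMass_nonneg A b u _, le_rfl]
        · rw [Finset.mul_sum]
          refine Finset.sum_le_sum fun f _ => ?_
          split_ifs
          · have := mul_le_mul_of_nonneg_right (D.rowMass_le_rowCount hA b u j)
              (bitVal_nonneg (b f))
            linarith
          · simp
    -- The two counts depend on disjoint sets of bits, so the first one can serve as the weight in
    -- the moment bound for the second.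
    refine step.trans ?_
    have hc0 : ∀ e, (0 : ℝ) ≤ if D.idx e = j ∧ D.col e = v then 1 else 0 := fun e => by
      split_ifs <;> norm_num
    refine (exp_mul_linear_pow_le h0 h1 A' _ hc0 (fun e => by split_ifs <;> norm_num)
      (fun b => D.rowCount A b u j ^ (r + 1)) (fun b e he x => ?_)
      (fun b => pow_nonneg (D.rowCount_nonneg A b u j) _) (r + 1)).trans ?_
    · have := D.rowCount_ignoresBits hd u j b e he x
      simp only at this
      simp only [this]
    · have g1 := D.moment_rowCount_le h0 h1 A hβ u j (r + 1)
      have g2 := hβ' j v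
      have g3 : (0 : ℝ) ≤ p * ∑ e, (if D.idx e = j ∧ D.col e = v then 1 else 0) :=
        mul_nonneg h0 (Finset.sum_nonneg fun e _ => hc0 e)
      push_cast at g1 ⊢
      calc _ ≤ (β + (r + 1)) ^ (r + 1) * (β + (r + 1)) ^ (r + 1) := by gcongr
        _ ≤ (2 * ((r + 1) * d)) ^ (r + 1) * (2 * ((r + 1) * d)) ^ (r + 1) := by
          have : β + (r + 1) ≤ 2 * ((r + 1) * d) := by nlinarith
          gcongr
        _ = 1 * (4 * (r + 1) ^ 2 * d ^ 2) ^ (r + 1) := by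
          rw [← mul_pow, one_mul]; congr 1; ring
        _ ≤ G := by rw [hG]; gcongr; linarith
  have h := D.moment_gram_le h0 h1 hA' hd u r
  have s1 := Finset.sum_le_sum fun u' (_ : u' ∈ Finset.univ) => b1 u'
  have s2 := Finset.sum_le_sum fun j (_ : j ∈ Finset.univ) =>
    Finset.sum_le_sum fun v (_ : v ∈ Finset.univ) => b2 j v
  simp only [Finset.sum_const, Finset.card_univ, nsmul_eq_mul] at s1 s2
  have hpow : (2 * (2 * r + 1) : ℝ) ^ (r + 1) ≤ (4 * (r + 1)) ^ (r + 1) :=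
    pow_le_pow_left₀ (by positivity) (by linarith [(Nat.cast_nonneg r : (0 : ℝ) ≤ r)]) _
  have h2 := h.trans (mul_le_mul hpow (add_le_add s1 s2) (by
    refine add_nonneg (Finset.sum_nonneg fun u' _ => ?_)
      (Finset.sum_nonneg fun j _ => Finset.sum_nonneg fun v _ => ?_) <;>
    · refine bernoulliExp_nonneg h0 h1 fun b => pow_nonneg (Finset.sum_nonneg fun f _ =>
        mul_nonneg (sq_nonneg _) ?_) _
      split_ifs; exacts [D.rowMass_nonneg A b u _, le_rfl]) (by positivity))
  have h3 : (0 : ℝ) ≤ (4 * (r + 1)) ^ (r + 1) * ((Fintype.card R + Fintype.card J * Fintype.card C) * G) := by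
    positivity
  have h4 : (4 * (r + 1) : ℝ) ^ (r + 1) * (Fintype.card R * G + Fintype.card J * (Fintype.card C * G)) =
    (4 * (r + 1)) ^ (r + 1) * ((Fintype.card R + Fintype.card J * Fintype.card C) * G) := by ring
  rw [h4] at h2
  linarith

/-- The coupled quadratic form without its diagonal. -/
noncomputable def offDiagonal (b : E → Bool) : Matrix (R × R) (C × C) ℝ :=
  Matrix.of fun x y => if (x.2, y.2) = (x.1, y.1) then 0 else
    ∑ j, D.mat Finset.univ b j x.2 y.2 * D.mat Finset.univ b j x.1 y.1

/-- The entries whose position has the given color. -/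
def colorClass (χ : R × C → Bool) (x : Bool) : Finset E :=
  Finset.univ.filter fun e => χ (D.row e, D.col e) = x

theorem mat_colorClass (χ : R × C → Bool) (x : Bool) (b : E → Bool) (j : J) (u : R) (v : C) :
    D.mat (D.colorClass χ x) b j u v = if χ (u, v) = x then D.mat Finset.univ b j u v else 0 := by
  rw [mat_apply, mat_apply, colorClass, Finset.sum_filter]
  split_ifs with h
  · refine Finset.sum_congr rfl fun e _ => ?_
    by_cases h1 : D.idx e = j ∧ D.row e = u ∧ D.col e = v
    · rw [if_pos (by rw [h1.2.1, h1.2.2]; exact h)]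
    · rw [if_neg h1, mul_zero, ite_self]
  · refine Finset.sum_eq_zero fun e _ => ?_
    by_cases h1 : D.idx e = j ∧ D.row e = u ∧ D.col e = v
    · rw [if_neg (by rw [h1.2.1, h1.2.2]; exact h)]
    · rw [if_neg h1, mul_zero, ite_self]

/-- Two distinct positions receive a prescribed pair of different colors with probability `1/4`; a
position never differs in color from itself. -/
theorem exp_two_colors (x y : R × C) :
    bernoulliExp (1 / 2) (fun χ : R × C → Bool =>
      (if χ x = false then 1 else 0) * (if χ y = true then 1 else 0)) =
      if x = y then (0 : ℝ) else 1 / 4 := by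
  rw [bernoulliExp_update _ x, bernoulliExp_update _ y]
  by_cases h : x = y
  · subst h
    simp [bernoulliExp_const]
  · have e1 : ∀ (b : R × C → Bool) (c1 c2 : Bool),
        Function.update (Function.update b y c1) x c2 y = c1 := by
      intro b c1 c2
      rw [Function.update_of_ne (Ne.symm h), Function.update_self]
    simp only [Function.update_self, e1, if_neg h]
    norm_num [bernoulliExp_const]

/-- In the average over colorings a product of entries at distinct positions survives with
probability `1/4`, and a product at equal positions never does. This is why the diagonal has to be
removed and estimated separately. -/
theorem offDiagonal_eq_sum (b : E → Bool) :
    D.offDiagonal b = ∑ χ : R × C → Bool, bernoulliWeight (1 / 2) χ •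
      ((4 : ℝ) • D.decoupled (D.colorClass χ false) (D.colorClass χ true) b) := by
  ext x y
  rw [Matrix.sum_apply]
  have h : ∀ χ : R × C → Bool, (bernoulliWeight (1 / 2) χ •
      ((4 : ℝ) • D.decoupled (D.colorClass χ false) (D.colorClass χ true) b)) x y =
      (4 * ∑ j, D.mat Finset.univ b j x.2 y.2 * D.mat Finset.univ b j x.1 y.1) *
        (bernoulliWeight (1 / 2) χ * ((if χ (x.2, y.2) = false then 1 else 0) *
          (if χ (x.1, y.1) = true then 1 else 0))) := by
    intro χ
    simp only [Matrix.smul_apply, decoupled, mat_colorClass, smul_eq_mul]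
    split_ifs <;> simp
    ring
  simp only [h]
  rw [← Finset.mul_sum]
  have h2 := exp_two_colors (x.2, y.2) (x.1, y.1)
  unfold bernoulliExp at h2
  rw [h2, offDiagonal, of_apply]
  split_ifs <;> ring

/-- Moment bound for the coupled quadratic form without its diagonal. -/
theorem exp_trace_offDiagonal_le {p : ℝ} (h0 : 0 ≤ p) (h1 : p ≤ 1) {β d : ℝ}
    (hβ0 : 0 ≤ β)
    (hβ : ∀ j u, p * ∑ e, (if D.idx e = j ∧ D.row e = u then 1 else 0) ≤ β)
    (hβ' : ∀ j v, p * ∑ e, (if D.idx e = j ∧ D.col e = v then 1 else 0) ≤ β)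
    (hd1 : 1 ≤ d) (hβd : β ≤ d) (hJd : Fintype.card J * β ^ 2 ≤ d ^ 2) (r : ℕ) :
    bernoulliExp p (fun b => trace ((D.offDiagonal b * (D.offDiagonal b)ᵀ) ^ (r + 1))) ≤
      ((Fintype.card R + Fintype.card C) ^ 2 * (1 + Fintype.card J) ^ 2) *
        (1024 * (r + 1) ^ 4 * d ^ 2) ^ (r + 1) := by
  have hflip : ∀ (χ : R × C → Bool) (x : Bool), ∀ e ∈ D.colorClass χ x, D.flip e ∈ D.colorClass χ x := by
    intro χ x e he
    simp only [colorClass, Finset.mem_filter, Finset.mem_univ, true_and] at he ⊢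
    rw [D.row_flip, D.col_flip, he]
  have hdisj : ∀ χ : R × C → Bool, Disjoint (D.colorClass χ false) (D.colorClass χ true) := by
    intro χ
    rw [Finset.disjoint_left]
    intro e he he'
    simp only [colorClass, Finset.mem_filter, Finset.mem_univ, true_and] at he he'
    rw [he] at he'
    exact Bool.noConfusion he'
  have hcJ : (0 : ℝ) ≤ Fintype.card J := Nat.cast_nonneg _
  have hcR : (0 : ℝ) ≤ Fintype.card R := Nat.cast_nonneg _
  have hcC : (0 : ℝ) ≤ Fintype.card C := Nat.cast_nonneg _
  set G : ℝ := (4 * (r + 1)) ^ (r + 1) * ((1 + Fintype.card J) * (4 * (r + 1) ^ 2 * d ^ 2) ^ (r + 1))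
    with hG
  have hG0 : 0 ≤ G := by positivity
  have hχ : ∀ χ : R × C → Bool, bernoulliExp p (fun b =>
      trace ((D.decoupled (D.colorClass χ false) (D.colorClass χ true) b *
        (D.decoupled (D.colorClass χ false) (D.colorClass χ true) b)ᵀ) ^ (r + 1))) ≤
      (4 * (r + 1)) ^ (r + 1) *
        (((Fintype.card R + Fintype.card C) ^ 2 * (1 + Fintype.card J)) * G) := by
    intro χ
    have h := D.moment_decoupled_le h0 h1 (hflip χ false) (hdisj χ) r
    have s1 := Finset.sum_le_sum fun u (_ : u ∈ Finset.univ) =>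
      D.exp_trace_gram_le h0 h1 (hflip χ false) (hflip χ true) (hdisj χ) hβ0 hβ hβ' hd1 hβd hJd u r
    -- The column half is the row half of the transposed data, with the two density hypotheses
    -- exchanged.
    have s2 := Finset.sum_le_sum fun v (_ : v ∈ Finset.univ) =>
      D.transpose.exp_trace_gram_le h0 h1 (hflip χ false) (hflip χ true) (hdisj χ) hβ0 hβ' hβ
        hd1 hβd hJd v r
    simp only [Finset.sum_const, Finset.card_univ, nsmul_eq_mul] at s1 s2
    have hpow : (2 * (2 * r + 1) : ℝ) ^ (r + 1) ≤ (4 * (r + 1)) ^ (r + 1) :=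
      pow_le_pow_left₀ (by positivity) (by linarith [(Nat.cast_nonneg r : (0 : ℝ) ≤ r)]) _
    have s3 := h.trans (mul_le_mul_of_nonneg_left (add_le_add s1 s2) (by positivity))
    refine le_trans ?_ (mul_le_mul_of_nonneg_right hpow (by positivity))
    have s4 : (Fintype.card R : ℝ) * ((4 * (r + 1)) ^ (r + 1) *
          ((Fintype.card R + Fintype.card J * Fintype.card C) *
            ((1 + Fintype.card J) * (4 * (r + 1) ^ 2 * d ^ 2) ^ (r + 1)))) +
        Fintype.card C * ((4 * (r + 1)) ^ (r + 1) *
          ((Fintype.card C + Fintype.card J * Fintype.card R) *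
            ((1 + Fintype.card J) * (4 * (r + 1) ^ 2 * d ^ 2) ^ (r + 1)))) ≤
        2 * (((Fintype.card R + Fintype.card C) ^ 2 * (1 + Fintype.card J)) * G) := by
      have : (Fintype.card R : ℝ) * (Fintype.card R + Fintype.card J * Fintype.card C) +
          Fintype.card C * (Fintype.card C + Fintype.card J * Fintype.card R) ≤
          2 * ((Fintype.card R + Fintype.card C) ^ 2 * (1 + Fintype.card J)) := by
        nlinarith [mul_nonneg hcR hcC, mul_nonneg hcR hcR, mul_nonneg hcC hcC,
          mul_nonneg (mul_nonneg hcR hcC) hcJ, mul_nonneg (mul_nonneg hcR hcR) hcJ,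
          mul_nonneg (mul_nonneg hcC hcC) hcJ]
      have := mul_le_mul_of_nonneg_right this hG0
      rw [hG] at this ⊢
      linarith
    have s5 := s3.trans (mul_le_mul_of_nonneg_left s4 (by positivity))
    linarith
  -- Convexity reduces the average to a single coloring; the factor `4` enters to the power
  -- `2(r+1)`.
  have hconv : ∀ b, trace ((D.offDiagonal b * (D.offDiagonal b)ᵀ) ^ (r + 1)) ≤
      ∑ χ : R × C → Bool, bernoulliWeight (1 / 2) χ * (16 ^ (r + 1) *
        trace ((D.decoupled (D.colorClass χ false) (D.colorClass χ true) b *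
        (D.decoupled (D.colorClass χ false) (D.colorClass χ true) b)ᵀ) ^ (r + 1))) := by
    intro b
    rw [offDiagonal_eq_sum]
    refine (trace_gram_pow_sum_smul_le Finset.univ (bernoulliWeight (1 / 2))
      (fun χ _ => bernoulliWeight_nonneg (by norm_num) (by norm_num) χ) (sum_bernoulliWeight _)
      _ r).trans (le_of_eq (Finset.sum_congr rfl fun χ _ => ?_))
    rw [transpose_smul, Matrix.smul_mul, Matrix.mul_smul, smul_smul, smul_pow, trace_smul,
      smul_eq_mul]
    norm_num
  refine (bernoulliExp_mono h0 h1 hconv).trans ?_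
  rw [bernoulliExp_sum]
  simp only [bernoulliExp_const_mul]
  calc _ ≤ ∑ χ : R × C → Bool, bernoulliWeight (1 / 2) χ * (16 ^ (r + 1) * ((4 * (r + 1)) ^ (r + 1) *
        (((Fintype.card R + Fintype.card C) ^ 2 * (1 + Fintype.card J)) * G))) := by
        refine Finset.sum_le_sum fun χ _ => mul_le_mul_of_nonneg_left
          (mul_le_mul_of_nonneg_left (hχ χ) (by positivity))
          (bernoulliWeight_nonneg (by norm_num) (by norm_num) χ)
    _ = _ := by
        rw [← Finset.sum_mul, sum_bernoulliWeight, hG,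
          show (1024 : ℝ) * (r + 1) ^ 4 * d ^ 2 =
            16 * (4 * (r + 1)) * (4 * (r + 1)) * (4 * (r + 1) ^ 2 * d ^ 2) by ring]
        simp only [mul_pow _ _ (r + 1)]
        ring

end SignedEntries

/-! ### The certificate: Cauchy-Schwarz and a trace bound -/

/-- Cauchy-Schwarz in `j` bounds the square by `|J| ∑ g_j²`, where `g_j` is the bilinear form with
index `j`. Expanding the squares gives the products at equal positions, which do not depend on `Y`
and `Z`, and the bilinear form of `M` at `Y ⊗ Y` and `Z ⊗ Z`. The factors `2` in `h1` and `h2` grant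
half of `θ` to each part. -/
theorem sq_sum_le_of_offDiagonal {J R C : Type*} [Fintype J] [Fintype R] [DecidableEq R] [Fintype C]
    [DecidableEq C] (w : J → R → C → ℝ) (X : J → ℝ) (Y : R → ℝ) (Z : C → ℝ)
    (hX : ∀ j, X j ^ 2 = 1) (hY : ∀ u, Y u ^ 2 = 1) (hZ : ∀ v, Z v ^ 2 = 1)
    (M : Matrix (R × R) (C × C) ℝ)
    (hM : ∀ x y, M x y = if (x.2, y.2) = (x.1, y.1) then 0 else ∑ j, w j x.2 y.2 * w j x.1 y.1)
    {θ : ℝ} (hθ : 0 ≤ θ) (r : ℕ)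
    (h1 : 2 * Fintype.card J * (∑ j, ∑ u, ∑ v, w j u v ^ 2) ≤ θ)
    (h2 : Matrix.trace ((M * M.transpose) ^ (r + 1)) *
      (2 * Fintype.card J * (Fintype.card R * Fintype.card C)) ^ (2 * r + 2) ≤ θ ^ (2 * r + 2)) :
    (∑ j, ∑ u, ∑ v, w j u v * (X j * Y u * Z v)) ^ 2 ≤ θ := by
  set g : J → ℝ := fun j => ∑ u, ∑ v, w j u v * (Y u * Z v) with hg
  set Q : ℝ := dotProduct (fun x : R × R => Y x.2 * Y x.1)
    (M.mulVec fun y : C × C => Z y.2 * Z y.1) with hQ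
  have e1 : ∑ j, ∑ u, ∑ v, w j u v * (X j * Y u * Z v) = ∑ j, X j * g j := by
    refine Finset.sum_congr rfl fun j _ => ?_
    rw [hg, Finset.mul_sum]
    refine Finset.sum_congr rfl fun u _ => ?_
    rw [Finset.mul_sum]
    exact Finset.sum_congr rfl fun v _ => by ring
  have e2 : (∑ j, X j * g j) ^ 2 ≤ Fintype.card J * ∑ j, g j ^ 2 := by
    refine (Finset.sum_mul_sq_le_sq_mul_sq _ _ _).trans (le_of_eq ?_)
    simp [hX]
  -- At equal positions the signs are squared and disappear, leaving the sum of squared entries.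
  have e3 : ∑ j, g j ^ 2 = ∑ j, ∑ u, ∑ v, w j u v ^ 2 + Q := by
    have hg2 : ∀ j, g j ^ 2 = ∑ x : R × R, ∑ y : C × C,
        (w j x.2 y.2 * w j x.1 y.1) * ((Y x.2 * Y x.1) * (Z y.2 * Z y.1)) := by
      intro j
      rw [sq, hg]
      simp only [Fintype.sum_prod_type, Finset.sum_mul, Finset.mul_sum]
      refine Finset.sum_congr rfl fun a _ => ?_
      rw [Finset.sum_comm]
      exact Finset.sum_congr rfl fun b _ => Finset.sum_congr rfl fun c _ =>
        Finset.sum_congr rfl fun d _ => by ring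
    have hsplit : ∑ j, g j ^ 2 = ∑ x : R × R, ∑ y : C × C,
        (∑ j, w j x.2 y.2 * w j x.1 y.1) * ((Y x.2 * Y x.1) * (Z y.2 * Z y.1)) := by
      simp only [hg2]
      rw [Finset.sum_comm]
      refine Finset.sum_congr rfl fun x _ => ?_
      rw [Finset.sum_comm]
      exact Finset.sum_congr rfl fun y _ => by rw [Finset.sum_mul]
    have hQ2 : Q = ∑ x : R × R, ∑ y : C × C, M x y * ((Y x.2 * Y x.1) * (Z y.2 * Z y.1)) := by
      rw [hQ]
      simp only [dotProduct, Matrix.mulVec, Finset.mul_sum]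
      exact Finset.sum_congr rfl fun x _ => Finset.sum_congr rfl fun y _ => by ring
    have hd : ∑ j, ∑ u, ∑ v, w j u v ^ 2 = ∑ x : R × R, ∑ y : C × C,
        if (x.2, y.2) = (x.1, y.1) then
          (∑ j, w j x.2 y.2 * w j x.1 y.1) * ((Y x.2 * Y x.1) * (Z y.2 * Z y.1)) else 0 := by
      simp only [Fintype.sum_prod_type, Prod.mk.injEq, ite_and, Finset.sum_ite_eq',
        Finset.mem_univ, if_true, Finset.sum_ite_irrel, Finset.sum_const_zero]
      rw [Finset.sum_comm]
      refine Finset.sum_congr rfl fun u _ => ?_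
      rw [Finset.sum_comm]
      refine Finset.sum_congr rfl fun v _ => ?_
      rw [← sq, ← sq, hY, hZ, one_mul, mul_one]
      exact Finset.sum_congr rfl fun j _ => by rw [sq]
    rw [hsplit, hQ2, hd, ← Finset.sum_add_distrib]
    refine Finset.sum_congr rfl fun x _ => ?_
    rw [← Finset.sum_add_distrib]
    refine Finset.sum_congr rfl fun y _ => ?_
    rw [hM]
    split_ifs <;> ring
  have e4 : 2 * Fintype.card J * Q ≤ θ := by
    have k1 := Matrix.dotProduct_mulVec_pow_le M (fun x : R × R => Y x.2 * Y x.1)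
      (fun y : C × C => Z y.2 * Z y.1) r
    rw [← hQ] at k1
    have k2 : dotProduct (fun x : R × R => Y x.2 * Y x.1) (fun x : R × R => Y x.2 * Y x.1) =
        (Fintype.card R : ℝ) ^ 2 := by
      simp only [dotProduct]
      calc _ = ∑ _x : R × R, (1 : ℝ) := Finset.sum_congr rfl fun x _ => by
            rw [show Y x.2 * Y x.1 * (Y x.2 * Y x.1) = Y x.2 ^ 2 * Y x.1 ^ 2 by ring, hY, hY, one_mul]
        _ = _ := by simp [sq]
    have k3 : dotProduct (fun x : C × C => Z x.2 * Z x.1) (fun x : C × C => Z x.2 * Z x.1) =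
        (Fintype.card C : ℝ) ^ 2 := by
      simp only [dotProduct]
      calc _ = ∑ _x : C × C, (1 : ℝ) := Finset.sum_congr rfl fun x _ => by
            rw [show Z x.2 * Z x.1 * (Z x.2 * Z x.1) = Z x.2 ^ 2 * Z x.1 ^ 2 by ring, hZ, hZ, one_mul]
        _ = _ := by simp [sq]
    rw [k2, k3, ← mul_pow, ← pow_mul, show 2 * (r + 1) = 2 * r + 2 by ring] at k1
    have k4 : (2 * Fintype.card J * Q) ^ (2 * r + 2) ≤ θ ^ (2 * r + 2) := by
      calc (2 * Fintype.card J * Q) ^ (2 * r + 2)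
          = (2 * Fintype.card J) ^ (2 * r + 2) * Q ^ (2 * r + 2) := mul_pow _ _ _
        _ ≤ (2 * Fintype.card J) ^ (2 * r + 2) * _ := mul_le_mul_of_nonneg_left k1 (by positivity)
        _ = _ := by rw [mul_pow (2 * (Fintype.card J : ℝ))]; ring
        _ ≤ _ := h2
    exact le_of_pow_le_pow_left₀ (by omega) hθ k4
  rw [e1]
  refine e2.trans ?_
  rw [e3]
  linarith

/-! ### Fourier analysis: nearly `t`-wise uniform distributions -/

section Fourier

variable {k : ℕ}

/-- The parity function of a set of coordinates. -/
def parity (S : Finset (Fin k)) (z : Fin k → ℤˣ) : ℝ := ∏ i ∈ S, ((z i : ℤ) : ℝ)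

theorem units_sq (u : ℤˣ) : ((u : ℤ) : ℝ) ^ 2 = 1 := by
  rcases Int.units_eq_one_or u with rfl | rfl <;> norm_num

theorem abs_parity (S : Finset (Fin k)) (z : Fin k → ℤˣ) : |parity S z| = 1 := by
  rw [parity, Finset.abs_prod]
  refine Finset.prod_eq_one fun i _ => ?_
  rcases Int.units_eq_one_or (z i) with h | h <;> rw [h] <;> norm_num

theorem sum_prod_units (f : Fin k → ℤˣ → ℝ) :
    ∑ z : Fin k → ℤˣ, ∏ i, f i (z i) = ∏ i, (f i 1 + f i (-1)) := by
  have h := Finset.prod_univ_sum (fun _ : Fin k => (Finset.univ : Finset ℤˣ)) f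
  rw [Fintype.piFinset_univ] at h
  rw [← h]
  refine Finset.prod_congr rfl fun i _ => ?_
  rw [show (Finset.univ : Finset ℤˣ) = {1, -1} from rfl, Finset.sum_pair (by decide)]

theorem sum_parity_mul_parity (S T : Finset (Fin k)) :
    ∑ z, parity S z * parity T z = if S = T then (2 : ℝ) ^ k else 0 := by
  have h1 : ∀ (S : Finset (Fin k)) z, parity S z = ∏ i, if i ∈ S then ((z i : ℤ) : ℝ) else 1 := by
    intro S z
    rw [parity, Finset.prod_ite_mem, Finset.univ_inter]
  simp only [h1, ← Finset.prod_mul_distrib]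
  rw [sum_prod_units (fun i u => (if i ∈ S then ((u : ℤ) : ℝ) else 1) * if i ∈ T then ((u : ℤ) : ℝ) else 1)]
  split_ifs with h
  · subst h
    rw [show (2 : ℝ) ^ k = ∏ _i : Fin k, 2 by simp]
    refine Finset.prod_congr rfl fun i _ => ?_
    split_ifs <;> norm_num
  · obtain ⟨i, hi⟩ : ∃ i, ¬ (i ∈ S ↔ i ∈ T) := by
      by_contra hcon
      push Not at hcon
      exact h (Finset.ext hcon)
    refine Finset.prod_eq_zero (Finset.mem_univ i) ?_
    by_cases h1 : i ∈ S <;> by_cases h2 : i ∈ T <;> simp_all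

/-- The indicator is the product of `(1 + y_i z_i)/2` over `i ∈ T`. Marginals on `t` coordinates
thus involve only Fourier coefficients at subsets of those coordinates. -/
theorem indicator_restrict_eq (T : Finset (Fin k)) (y : T → ℤˣ) (z : Fin k → ℤˣ) :
    (if T.restrict z = y then (1 : ℝ) else 0) = (1 / 2) ^ T.card *
      ∑ S ∈ T.powerset, (∏ i ∈ S, if h : i ∈ T then ((y ⟨i, h⟩ : ℤ) : ℝ) else 1) * parity S z := by
  have h1 : ∑ S ∈ T.powerset, (∏ i ∈ S, if h : i ∈ T then ((y ⟨i, h⟩ : ℤ) : ℝ) else 1) * parity S z =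
      ∏ i ∈ T, (1 + (if h : i ∈ T then ((y ⟨i, h⟩ : ℤ) : ℝ) else 1) * ((z i : ℤ) : ℝ)) := by
    rw [Finset.prod_one_add]
    refine Finset.sum_congr rfl fun S _ => ?_
    rw [parity, Finset.prod_mul_distrib]
  rw [h1]
  split_ifs with h
  · rw [← Finset.prod_const, ← Finset.prod_mul_distrib]
    refine (Finset.prod_eq_one fun i hi => ?_).symm
    rw [dif_pos hi, ← h, Finset.restrict]
    have := units_sq (z i)
    nlinarith
  · obtain ⟨i, hi⟩ : ∃ i, T.restrict z i ≠ y i := by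
      by_contra hcon
      push Not at hcon
      exact h (funext hcon)
    rw [Finset.prod_eq_zero i.2, mul_zero]
    rw [dif_pos i.2]
    simp only [Finset.restrict] at hi
    rcases Int.units_eq_one_or (z i) with h1 | h1 <;> rcases Int.units_eq_one_or (y i) with h2 | h2
    · exact absurd (h1.trans h2.symm) hi
    · rw [h1, h2]; norm_num
    · rw [h1, h2]; norm_num
    · exact absurd (h1.trans h2.symm) hi

/-- A distribution with small low-degree Fourier coefficients is close to a `t`-wise uniform one, so
it puts almost as much mass on the points that falsify `P`. -/
theorem CSP.IsFarFromTWiseSupporting.mass_ge {P : (Fin k → ℤˣ) → Bool} {t : ℕ} {δ : ℝ}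
    (hP : CSP.IsFarFromTWiseSupporting P t δ) (D : (Fin k → ℤˣ) → ℝ)
    (hD : D ∈ stdSimplex ℝ (Fin k → ℤˣ)) {ε : ℝ} (hε : 0 ≤ ε)
    (hF : ∀ S : Finset (Fin k), S.Nonempty → S.card ≤ t → |∑ z, D z * parity S z| ≤ ε) :
    δ ≤ ∑ z with P z = false, D z + 2 * ε * 2 ^ k := by
  classical
  set 𝒮 : Finset (Finset (Fin k)) := Finset.univ.filter fun S => S.Nonempty ∧ S.card ≤ t with h𝒮
  set c : Finset (Fin k) → ℝ := fun S => ∑ z, D z * parity S z with hc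
  -- The part of `D` of degree between `1` and `t`. There are at most `2^k` coefficients, and the
  -- prefactor `2^(-k)` gives `|E| ≤ ε` pointwise.
  set E : (Fin k → ℤˣ) → ℝ := fun z => (1 / 2) ^ k * ∑ S ∈ 𝒮, c S * parity S z with hE
  set Λ : ℝ := 1 + ε * 2 ^ k with hΛ
  have hΛ1 : 1 ≤ Λ := by rw [hΛ]; have : 0 ≤ ε * 2 ^ k := by positivity
                         linarith
  have hΛ0 : 0 < Λ := by linarith
  have hEabs : ∀ z, |E z| ≤ ε := by
    intro z
    rw [hE, abs_mul, abs_of_nonneg (by positivity : (0 : ℝ) ≤ (1 / 2) ^ k)]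
    have h1 : |∑ S ∈ 𝒮, c S * parity S z| ≤ 2 ^ k * ε := by
      calc |∑ S ∈ 𝒮, c S * parity S z| ≤ ∑ S ∈ 𝒮, |c S * parity S z| := Finset.abs_sum_le_sum_abs _ _
        _ ≤ ∑ _S ∈ 𝒮, ε := Finset.sum_le_sum fun S hS => by
            rw [abs_mul, abs_parity, mul_one]
            simp only [h𝒮, Finset.mem_filter] at hS
            exact hF S hS.2.1 hS.2.2
        _ = 𝒮.card * ε := by rw [Finset.sum_const, nsmul_eq_mul]
        _ ≤ 2 ^ k * ε := by
            gcongr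
            have : 𝒮.card ≤ 2 ^ k := by
              refine (Finset.card_le_univ _).trans (le_of_eq ?_)
              simp
            exact_mod_cast this
    calc (1 / 2 : ℝ) ^ k * |∑ S ∈ 𝒮, c S * parity S z| ≤ (1 / 2) ^ k * (2 ^ k * ε) := by gcongr
      _ = ε := by rw [← mul_assoc, ← mul_pow]; norm_num
  -- Removing `E` could make values as small as `-ε`; adding `ε` everywhere repairs this and changes
  -- only the coefficient at the empty set, which `Λ` then normalizes.
  set D' : (Fin k → ℤˣ) → ℝ := fun z => (D z - E z + ε) / Λ with hD'
  have hcE : ∀ T : Finset (Fin k), ∑ z, E z * parity T z = if T ∈ 𝒮 then c T else 0 := by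
    intro T
    have : ∀ z, E z * parity T z = ∑ S ∈ 𝒮, (1 / 2) ^ k * c S * (parity S z * parity T z) := by
      intro z
      rw [hE, mul_assoc, Finset.sum_mul, Finset.mul_sum]
      exact Finset.sum_congr rfl fun S _ => by ring
    simp only [this]
    rw [Finset.sum_comm]
    simp only [← Finset.mul_sum, sum_parity_mul_parity, mul_ite, mul_zero]
    rw [Finset.sum_ite_eq']
    split_ifs
    · rw [mul_right_comm, ← mul_pow]; norm_num
    · rfl
  have hpar0 : ∀ z : Fin k → ℤˣ, parity ∅ z = 1 := fun z => by simp [parity]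
  have hconst : ∀ T : Finset (Fin k), ∑ z, parity T z = if T = ∅ then (2 : ℝ) ^ k else 0 := by
    intro T
    have := sum_parity_mul_parity T ∅
    simpa only [hpar0, mul_one] using this
  have hcD' : ∀ T : Finset (Fin k), ∑ z, D' z * parity T z =
      (c T - (if T ∈ 𝒮 then c T else 0) + ε * if T = ∅ then (2 : ℝ) ^ k else 0) / Λ := by
    intro T
    rw [← hcE, ← hconst, hc, Finset.mul_sum, ← Finset.sum_sub_distrib, ← Finset.sum_add_distrib,
      Finset.sum_div]
    exact Finset.sum_congr rfl fun z _ => by rw [hD']; ring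
  have hc0 : c ∅ = 1 := by
    simp only [hc, hpar0, mul_one]
    exact hD.2
  have hempty : ∅ ∉ 𝒮 := by simp [h𝒮]
  have hcD'0 : ∑ z, D' z * parity ∅ z = 1 := by
    rw [hcD', if_neg hempty, if_pos rfl, hc0, hΛ]
    field_simp
    ring
  have hD'nonneg : ∀ z, 0 ≤ D' z := by
    intro z
    refine div_nonneg ?_ hΛ0.le
    have := abs_le.1 (hEabs z)
    have := hD.1 z
    linarith
  have hsimplex : D' ∈ stdSimplex ℝ (Fin k → ℤˣ) := by
    refine ⟨hD'nonneg, ?_⟩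
    simpa only [hpar0, mul_one] using hcD'0
  have htwise : CSP.IsTWiseUniform t D' := by
    intro T hT y
    have h1 : ∑ z with T.restrict z = y, D' z = ∑ z, D' z * if T.restrict z = y then 1 else 0 := by
      rw [Finset.sum_filter]
      exact Finset.sum_congr rfl fun z _ => by split_ifs <;> simp
    rw [h1]
    simp only [indicator_restrict_eq]
    have h2 : ∀ z, D' z * ((1 / 2) ^ T.card *
        ∑ S ∈ T.powerset, (∏ i ∈ S, if h : i ∈ T then ((y ⟨i, h⟩ : ℤ) : ℝ) else 1) * parity S z) =
        ∑ S ∈ T.powerset, ((1 / 2) ^ T.card *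
          (∏ i ∈ S, if h : i ∈ T then ((y ⟨i, h⟩ : ℤ) : ℝ) else 1)) * (D' z * parity S z) := by
      intro z
      rw [← mul_assoc, Finset.mul_sum]
      exact Finset.sum_congr rfl fun S _ => by ring
    simp only [h2]
    rw [Finset.sum_comm]
    simp only [← Finset.mul_sum]
    -- All nonempty subsets of `T` have at most `t` elements, so their coefficients have been
    -- removed and only the constant term remains.
    rw [Finset.sum_eq_single ∅]
    · rw [hcD'0, Finset.prod_empty, hT]
      simp
    · intro S hS hS0
      have hmem : S ∈ 𝒮 := by
        simp only [h𝒮, Finset.mem_filter, Finset.mem_univ, true_and]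
        exact ⟨Finset.nonempty_iff_ne_empty.2 hS0,
          (Finset.card_le_card (Finset.mem_powerset.1 hS)).trans hT.le⟩
      rw [hcD', if_pos hmem, if_neg hS0]
      simp
    · simp
  have hfar := hP D' hsimplex htwise
  have hle : ∑ z with P z = false, D' z ≤ (∑ z with P z = false, D z + 2 * ε * 2 ^ k) / Λ := by
    rw [hD', ← Finset.sum_div]
    refine div_le_div_of_nonneg_right ?_ hΛ0.le
    calc ∑ z with P z = false, (D z - E z + ε) ≤ ∑ z with P z = false, (D z + 2 * ε) :=
          Finset.sum_le_sum fun z _ => by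
            have := abs_le.1 (hEabs z)
            linarith
      _ = ∑ z with P z = false, D z + (Finset.univ.filter fun z => P z = false).card * (2 * ε) := by
          rw [Finset.sum_add_distrib, Finset.sum_const, nsmul_eq_mul]
      _ ≤ _ := by
          have h1 : ((Finset.univ.filter fun z : Fin k → ℤˣ => P z = false).card : ℝ) ≤ 2 ^ k := by
            have : (Finset.univ.filter fun z : Fin k → ℤˣ => P z = false).card ≤ 2 ^ k := by
              refine (Finset.card_le_univ _).trans (le_of_eq ?_)
              simp [Fintype.card_units_int]
            exact_mod_cast this
          have := mul_le_mul_of_nonneg_right h1 (by positivity : 0 ≤ 2 * ε)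
          linarith
  have hnn : 0 ≤ ∑ z with P z = false, D z + 2 * ε * 2 ^ k :=
    add_nonneg (Finset.sum_nonneg fun z _ => hD.1 z) (by positivity)
  -- Dropping the denominator `Λ ≥ 1` only increases the bound.
  exact hfar.trans (hle.trans (div_le_self hnn hΛ1))

/-- The uniform distribution has no nonconstant Fourier coefficients, so `mass_ge` applies to it
with `ε = 0`. This makes the claimed bound on the optimum nonnegative, and at least `1` when `γ ≥
1`. -/
theorem CSP.IsFarFromTWiseSupporting.le_one {P : (Fin k → ℤˣ) → Bool} {t : ℕ} {δ : ℝ}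
    (hP : CSP.IsFarFromTWiseSupporting P t δ) : δ ≤ 1 := by
  have hsum : ∑ _z : Fin k → ℤˣ, ((1 : ℝ) / 2) ^ k = 1 := by
    simp [Fintype.card_units_int]
  have h := hP.mass_ge (fun _ => (1 / 2) ^ k) ⟨fun _ => by positivity, hsum⟩ le_rfl (fun S hS _ => by
    have h2 := sum_parity_mul_parity S ∅
    rw [if_neg (Finset.nonempty_iff_ne_empty.1 hS)] at h2
    simp only [show ∀ z : Fin k → ℤˣ, parity ∅ z = 1 from fun z => by simp [parity], mul_one] at h2
    rw [← Finset.mul_sum, h2]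
    simp)
  have h3 : ∑ z : Fin k → ℤˣ with P z = false, ((1 : ℝ) / 2) ^ k ≤ ∑ _z : Fin k → ℤˣ, ((1 : ℝ) / 2) ^ k :=
    Finset.sum_le_sum_of_subset_of_nonneg (Finset.subset_univ _) fun _ _ _ => by positivity
  rw [hsum] at h3
  linarith

end Fourier

/-! ### Shapes, the tests, and soundness of the algorithm -/

namespace CSP

/-- An arrangement of the positions in a set of coordinates of a constraint: `a` positions for the
index of a matrix, `h` for its rows and `h` for its columns. -/
structure Shape (k : ℕ) where
  a : ℕ
  h : ℕ
  pos : Fin a ⊕ (Fin h ⊕ Fin h) → Fin k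
  pos_injective : Function.Injective pos

namespace Shape

variable {k n : ℕ} (σ : Shape k)

/-- The product of the signs at the positions of the shape. -/
def sign (C : Constraint k n) : ℤ := ∏ x, (C.1 (σ.pos x) : ℤ)

/-- The variables at the positions for the index. -/
def idx (C : Constraint k n) : Fin σ.a → Fin n := fun i => C.2 (σ.pos (.inl i))

/-- The variables at the positions for the rows. -/
def row (C : Constraint k n) : Fin σ.h → Fin n := fun i => C.2 (σ.pos (.inr (.inl i)))

/-- The variables at the positions for the columns. -/
def col (C : Constraint k n) : Fin σ.h → Fin n := fun i => C.2 (σ.pos (.inr (.inr i)))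

/-- The signed number of constraints with given variables at the positions of the shape. -/
def entry (I : Instance k n) (j : Fin σ.a → Fin n) (u v : Fin σ.h → Fin n) : ℤ :=
  (I.map fun C => if σ.idx C = j ∧ σ.row C = u ∧ σ.col C = v then σ.sign C else 0).sum

/-- The sum of the squares of all entries. -/
def diag (I : Instance k n) : ℤ := ∑ j, ∑ u, ∑ v, σ.entry I j u v ^ 2

/-- The matrix of the quadratic form obtained by the Cauchy-Schwarz inequality, without the terms
counted by `diag`. -/
def offMat (I : Instance k n) :
    Matrix ((Fin σ.h → Fin n) × (Fin σ.h → Fin n)) ((Fin σ.h → Fin n) × (Fin σ.h → Fin n)) ℤ :=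
  Matrix.of fun x y => if (x.2, y.2) = (x.1, y.1) then 0 else
    ∑ j, σ.entry I j x.2 y.2 * σ.entry I j x.1 y.1

/-- The exponent of the trace. -/
def exponent (k n : ℕ) : ℕ := (2 * k + 3) * Nat.size n

/-- The trace of a power of the Gram matrix. -/
def traceMoment (I : Instance k n) : ℤ :=
  ((σ.offMat I * (σ.offMat I).transpose) ^ (exponent k n + 1)).trace

/-- The two inequalities that certify that the correlation with the parity function of the shape is
small. -/
def Test (I : Instance k n) (γ : ℚ≥0) : Prop :=
  2 * (n : ℤ) ^ σ.a * σ.diag I * (4 ^ (k + 1) * (γ.den : ℤ) ^ 2) ≤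
      (γ.num : ℤ) ^ 2 * (Multiset.card I : ℤ) ^ 2 ∧
    σ.traceMoment I * (2 * (n : ℤ) ^ σ.a * ((n : ℤ) ^ σ.h * (n : ℤ) ^ σ.h) *
      (4 ^ (k + 1) * (γ.den : ℤ) ^ 2)) ^ (2 * exponent k n + 2) ≤
      ((γ.num : ℤ) ^ 2 * (Multiset.card I : ℤ) ^ 2) ^ (2 * exponent k n + 2)

/-- The set of positions of a shape. -/
def support : Finset (Fin k) := Finset.univ.image σ.pos

theorem parity_support (z : Fin k → ℤˣ) : parity σ.support z = ∏ x, ((z (σ.pos x) : ℤ) : ℝ) := by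
  rw [parity, support, Finset.prod_image fun x _ y _ h => σ.pos_injective h]

/-- A set of coordinates has a shape. -/
theorem exists_support_eq (S : Finset (Fin k)) :
    ∃ σ : Shape k, σ.support = S ∧ σ.a + 2 * σ.h = S.card ∧ σ.a ≤ 1 := by
  -- Two equal halves serve for rows and columns; if the size is odd, the leftover coordinate is the
  -- index.
  have hs : S.card % 2 + (S.card / 2 + S.card / 2) = S.card := by omega
  let e : Fin (S.card % 2) ⊕ (Fin (S.card / 2) ⊕ Fin (S.card / 2)) ≃ S :=
    ((Equiv.sumCongr (Equiv.refl _) finSumFinEquiv).trans finSumFinEquiv).trans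
      ((finCongr hs).trans S.equivFin.symm)
  refine ⟨⟨S.card % 2, S.card / 2, fun x => (e x : Fin k),
    Subtype.val_injective.comp e.injective⟩, ?_, by simp only; omega, by simp only; omega⟩
  ext i
  simp only [support, Finset.mem_image, Finset.mem_univ, true_and]
  constructor
  · rintro ⟨x, rfl⟩
    exact (e x).2
  · intro hi
    exact ⟨e.symm ⟨i, hi⟩, by simp⟩

/-- The parity of a constraint's point is its sign times a product of variables that depends only on
its index, row and column. Grouping the constraints accordingly gives the trilinear form in tensor
powers of `x`. -/
theorem sum_parity_eq (I : Instance k n) (x : Fin n → ℤˣ) :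
    (I.map fun C => parity σ.support (C.point x)).sum =
      ∑ j, ∑ u, ∑ v, (σ.entry I j u v : ℝ) * ((∏ i, ((x (j i) : ℤ) : ℝ)) * (∏ i, ((x (u i) : ℤ) : ℝ)) *
        ∏ i, ((x (v i) : ℤ) : ℝ)) := by
  induction I using Multiset.induction_on with
  | empty => simp [entry]
  | cons C I ih =>
    rw [Multiset.map_cons, Multiset.sum_cons, ih]
    have h1 : ∀ j u v, (σ.entry (C ::ₘ I) j u v : ℝ) =
        (if σ.idx C = j ∧ σ.row C = u ∧ σ.col C = v then (σ.sign C : ℝ) else 0) +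
          (σ.entry I j u v : ℝ) := by
      intro j u v
      rw [entry, Multiset.map_cons, Multiset.sum_cons, ← entry]
      push_cast
      rfl
    simp only [h1, add_mul, Finset.sum_add_distrib]
    congr 1
    rw [Finset.sum_eq_single (σ.idx C), Finset.sum_eq_single (σ.row C),
      Finset.sum_eq_single (σ.col C)]
    · rw [if_pos ⟨rfl, rfl, rfl⟩, parity_support, sign]
      simp only [Constraint.point, Units.val_mul, Int.cast_mul, Finset.prod_mul_distrib, Int.cast_prod]
      congr 1
      rw [Fintype.prod_sum_type, Fintype.prod_sum_type, mul_assoc]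
      rfl
    · intro v _ hv
      rw [if_neg (fun h => hv h.2.2.symm), zero_mul]
    · simp
    · intro u _ hu
      exact Finset.sum_eq_zero fun v _ => by rw [if_neg (fun h => hu h.2.1.symm), zero_mul]
    · simp
    · intro j _ hj
      exact Finset.sum_eq_zero fun u _ => Finset.sum_eq_zero fun v _ => by
        rw [if_neg (fun h => hj h.1.symm), zero_mul]
    · simp

/-- The tests are stated over the integers so that a machine can decide them exactly; their analysis
takes place over the reals. -/
theorem trace_cast (I : Instance k n) (r : ℕ) :
    ((((σ.offMat I * (σ.offMat I).transpose) ^ r).trace : ℤ) : ℝ) =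
      ((((σ.offMat I).map (Int.cast : ℤ → ℝ)) * ((σ.offMat I).map (Int.cast : ℤ → ℝ)).transpose) ^ r).trace := by
  have h1 : ((σ.offMat I).map (Int.cast : ℤ → ℝ)) = (Int.castRingHom ℝ).mapMatrix (σ.offMat I) := rfl
  have h2 : ((σ.offMat I).map (Int.cast : ℤ → ℝ)).transpose =
      (Int.castRingHom ℝ).mapMatrix (σ.offMat I).transpose := rfl
  rw [h2, h1, ← map_mul, ← map_pow, RingHom.mapMatrix_apply]
  simp [Matrix.trace]

theorem offMat_cast (I : Instance k n) (x y) : (σ.offMat I).map (Int.cast : ℤ → ℝ) x y =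
    if (x.2, y.2) = (x.1, y.1) then 0 else
      ∑ j, (σ.entry I j x.2 y.2 : ℝ) * (σ.entry I j x.1 y.1 : ℝ) := by
  rw [Matrix.map_apply, offMat, Matrix.of_apply]
  split_ifs
  · simp
  · push_cast
    rfl

/-- The test certifies a bound on the correlation with the parity function. -/
theorem Test.sum_parity_le {σ : Shape k} {I : Instance k n} {γ : ℚ≥0} (hT : σ.Test I γ)
    (x : Fin n → ℤˣ) :
    |(I.map fun C => parity σ.support (C.point x)).sum| ≤
      (γ : ℝ) / 2 ^ (k + 1) * Multiset.card I := by
  have hden : (0 : ℝ) < γ.den := by exact_mod_cast γ.den_pos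
  have hγ : (γ : ℝ) = (γ.num : ℝ) / γ.den := by
    conv_lhs => rw [← NNRat.num_div_den γ]
    push_cast
    rfl
  have hsq : ∀ {m : ℕ} (j : Fin m → Fin n), (∏ i, ((x (j i) : ℤ) : ℝ)) ^ 2 = 1 := fun j => by
    rw [← Finset.prod_pow]
    exact Finset.prod_eq_one fun i _ => units_sq _
  set m : ℝ := (Multiset.card I : ℝ) with hm
  set κ : ℝ := 4 ^ (k + 1) * (γ.den : ℝ) ^ 2 with hκ
  have hκ0 : 0 < κ := by positivity
  have hcard : ∀ a : ℕ, (Fintype.card (Fin a → Fin n) : ℝ) = (n : ℝ) ^ a := fun a => by simp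
  obtain ⟨t1, t2⟩ := hT
  have t1' : 2 * (n : ℝ) ^ σ.a * (σ.diag I : ℝ) * κ ≤ (γ.num : ℝ) ^ 2 * m ^ 2 := by
    rw [hκ, hm]; exact_mod_cast t1
  have t2' : (σ.traceMoment I : ℝ) * (2 * (n : ℝ) ^ σ.a * ((n : ℝ) ^ σ.h * (n : ℝ) ^ σ.h) *
      κ) ^ (2 * exponent k n + 2) ≤ ((γ.num : ℝ) ^ 2 * m ^ 2) ^ (2 * exponent k n + 2) := by
    rw [hκ, hm]; exact_mod_cast t2
  have key := sq_sum_le_of_offDiagonal (fun j u v => (σ.entry I j u v : ℝ))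
    (fun j => ∏ i, ((x (j i) : ℤ) : ℝ)) (fun u => ∏ i, ((x (u i) : ℤ) : ℝ))
    (fun v => ∏ i, ((x (v i) : ℤ) : ℝ)) hsq hsq hsq ((σ.offMat I).map (Int.cast : ℤ → ℝ))
    -- This `θ` is the square of the target `γ m / 2^(k+1)`, written with numerator and denominator
    -- of `γ`.
    (σ.offMat_cast I) (θ := (γ.num : ℝ) ^ 2 * m ^ 2 / κ) (by positivity) (exponent k n)
    (by
      rw [hcard, le_div_iff₀ hκ0]
      refine le_trans (le_of_eq ?_) t1'
      rw [diag]
      push_cast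
      rfl)
    (by
      rw [hcard, hcard, ← trace_cast, ← traceMoment, div_pow, le_div_iff₀ (by positivity)]
      refine le_trans (le_of_eq ?_) t2'
      rw [mul_pow _ κ]
      ring)
  rw [← sum_parity_eq] at key
  refine abs_le_of_sq_le_sq (key.trans (le_of_eq ?_)) (by positivity)
  rw [hκ, hγ, show (4 : ℝ) = 2 ^ 2 by norm_num, ← pow_mul, mul_comm 2, pow_mul]
  field_simp

end Shape

/-- The shapes of the nonempty sets of at most `t` coordinates. -/
noncomputable def shapes (k t : ℕ) : List (Shape k) :=
  ((Finset.univ : Finset (Finset (Fin k))).filter fun S => S.Nonempty ∧ S.card ≤ t).toList.map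
    fun S => (Shape.exists_support_eq S).choose

theorem mem_shapes {k t : ℕ} {σ : Shape k} (h : σ ∈ shapes k t) :
    0 < σ.a + 2 * σ.h ∧ σ.a + 2 * σ.h ≤ t ∧ σ.a ≤ 1 := by
  simp only [shapes, List.mem_map, Finset.mem_toList, Finset.mem_filter] at h
  obtain ⟨S, ⟨-, hS, hSt⟩, rfl⟩ := h
  have h2 := (Shape.exists_support_eq S).choose_spec
  rw [h2.2.1]
  exact ⟨hS.card_pos, hSt, h2.2.2⟩

open Classical in
/-- The certification algorithm. -/
noncomputable def certify {k : ℕ} (t : ℕ) (n : ℕ) (I : Instance k n) (γ : ℚ≥0) : Bool :=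
  decide (γ.den ≤ γ.num ∨ ∀ σ ∈ shapes k t, σ.Test I γ)

theorem card_point_div {k n : ℕ} (I : Instance k n) (x : Fin n → ℤˣ) (f : (Fin k → ℤˣ) → ℝ) :
    ∑ z, (I.countP (fun C => C.point x = z) : ℝ) * f z = (I.map fun C => f (C.point x)).sum := by
  induction I using Multiset.induction_on with
  | empty => simp
  | cons C I ih =>
    rw [Multiset.map_cons, Multiset.sum_cons, ← ih]
    simp only [Multiset.countP_cons, Nat.cast_add, add_mul, Finset.sum_add_distrib]
    rw [add_comm]
    congr 1
    simp

theorem countP_eq_sum_map {α : Type*} (I : Multiset α) (p : α → Prop) [DecidablePred p] :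
    (I.countP p : ℝ) = (I.map fun C => if p C then (1 : ℝ) else 0).sum := by
  induction I using Multiset.induction_on with
  | empty => simp
  | cons C I ih =>
    rw [Multiset.map_cons, Multiset.sum_cons, Multiset.countP_cons, ← ih]
    push_cast
    ring

/-- The certification algorithm makes no errors. -/
theorem certify_sound {k t : ℕ} {P : (Fin k → ℤˣ) → Bool} {δ : ℝ}
    (hP : IsFarFromTWiseSupporting P t δ) (n : ℕ) (I : Instance k n) (γ : ℚ≥0)
    (h : certify t n I γ = true) : opt P I ≤ 1 - δ + (γ : ℝ) := by
  have hδ := hP.le_one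
  have hγ0 : (0 : ℝ) ≤ γ := by positivity
  simp only [certify, decide_eq_true_eq] at h
  refine Real.iSup_le (fun x => ?_) (by linarith)
  rcases eq_or_ne I 0 with rfl | hI
  · simp [val]; linarith
  have hm : (0 : ℝ) < Multiset.card I := by
    exact_mod_cast Multiset.card_pos.2 hI
  have hval : val P I x = (I.map fun C => if P (C.point x) = true then (1 : ℝ) else 0).sum /
      Multiset.card I := by
    rw [val]
    rw [countP_eq_sum_map]
  -- If `γ ≥ 1`, the assertion is trivial because `δ ≤ 1`.
  rcases h with h | h
  · have h1 : val P I x ≤ 1 := by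
      rw [val, div_le_one hm]
      exact_mod_cast Multiset.countP_le_card _ _
    have h2 : (1 : ℝ) ≤ γ := by
      have h3 : (γ : ℝ) = (γ.num : ℝ) / γ.den := by
        conv_lhs => rw [← NNRat.num_div_den γ]
        push_cast
        rfl
      rw [h3, one_le_div (by exact_mod_cast γ.den_pos)]
      exact_mod_cast h
    linarith
  · set D : (Fin k → ℤˣ) → ℝ := fun z => (I.countP (fun C => C.point x = z) : ℝ) / Multiset.card I
      with hD
    have hDf : ∀ f : (Fin k → ℤˣ) → ℝ, ∑ z, D z * f z =
        (I.map fun C => f (C.point x)).sum / Multiset.card I := by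
      intro f
      rw [← card_point_div, Finset.sum_div]
      exact Finset.sum_congr rfl fun z _ => by rw [hD]; ring
    have hsimplex : D ∈ stdSimplex ℝ (Fin k → ℤˣ) := by
      refine ⟨fun z => by positivity, ?_⟩
      have := hDf fun _ => 1
      simp only [mul_one] at this
      rw [this]
      simp [hm.ne']
    -- Here `D` is the empirical distribution of the points of the constraints. The value of `ε`
    -- makes the loss `2ε2^k` equal to `γ`.
    have hmass := hP.mass_ge D hsimplex (ε := (γ : ℝ) / 2 ^ (k + 1)) (by positivity) (by
      intro S hS hSt
      rw [hDf, abs_div, abs_of_pos hm, div_le_iff₀ hm]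
      have hmem : (Shape.exists_support_eq S).choose ∈ shapes k t := by
        simp only [shapes, List.mem_map, Finset.mem_toList, Finset.mem_filter]
        exact ⟨S, ⟨Finset.mem_univ _, hS, hSt⟩, rfl⟩
      have hT := (h _ hmem).sum_parity_le x
      rwa [(Shape.exists_support_eq S).choose_spec.1] at hT)
    have e1 : 2 * ((γ : ℝ) / 2 ^ (k + 1)) * 2 ^ k = γ := by
      rw [pow_succ]; field_simp
    rw [e1] at hmass
    have e2 : val P I x = ∑ z, D z * if P z = true then 1 else 0 := by
      rw [hval, hDf]
    have e3 : ∑ z, D z * (if P z = true then 1 else 0) + ∑ z with P z = false, D z = 1 := by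
      rw [Finset.sum_filter, ← Finset.sum_add_distrib]
      refine (Finset.sum_congr rfl fun z _ => ?_).trans hsimplex.2
      cases P z <;> simp
    rw [e2]
    linarith

end CSP

/-! ### Random instances as independent bits, and the expected certificate -/

namespace CSP

variable {k n : ℕ}

/-- The instance with the constraints selected by a bit string. -/
noncomputable def Instance.ofBits (b : Constraint k n → Bool) : Instance k n :=
  Instance.ofSet {C | b C = true}

theorem Instance.sum_map_ofBits (b : Constraint k n → Bool) (f : Constraint k n → ℝ) :
    ((Instance.ofBits b).map f).sum = ∑ C, bitVal (b C) * f C := by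
  have h : ((Instance.ofBits b).map f).sum = ∑ C ∈ {C | b C = true}, f C := by
    rw [Instance.ofBits, Instance.ofSet, ← Finset.sum_eq_multiset_sum]
    refine Finset.sum_congr ?_ fun _ _ => rfl
    ext C
    simp
  rw [h, Finset.sum_filter]
  refine Finset.sum_congr rfl fun C _ => ?_
  cases b C <;> simp [bitVal]

theorem Instance.card_ofBits (b : Constraint k n → Bool) :
    (Multiset.card (Instance.ofBits b) : ℝ) = ∑ C, bitVal (b C) := by
  have := Instance.sum_map_ofBits b fun _ => 1
  simpa using this

theorem prob_eq (p : unitInterval) (E : Instance k n → Prop) [DecidablePred E] :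
    prob k n p E = bernoulliExp p fun b => if E (Instance.ofBits b) then 1 else 0 := by
  classical
  have h1 : {s : Set (Constraint k n) | E (Instance.ofSet s)} =
      ((Finset.univ.filter fun s : Set (Constraint k n) => E (Instance.ofSet s) :
        Finset (Set (Constraint k n))) : Set (Set (Constraint k n))) := by
    ext s
    simp
  rw [prob, h1, ← sum_measureReal_singleton, Finset.sum_filter, bernoulliExp]
  let e : (Constraint k n → Bool) ≃ Set (Constraint k n) :=
    { toFun := fun b => {C | b C = true}
      invFun := fun s C => decide (C ∈ s)
      left_inv := fun b => by ext; simp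
      right_inv := fun s => by ext; simp }
  rw [← e.sum_comp]
  refine Finset.sum_congr rfl fun b _ => ?_
  have h2 : (setBernoulli (Set.univ : Set (Constraint k n)) p).real {e b} = bernoulliWeight p b := by
    rw [setBernoulli_real_singleton p (Set.subset_univ _) Set.finite_univ, bernoulliWeight,
      Finset.prod_ite, Finset.prod_const, Finset.prod_const]
    have e1 : e b = ((Finset.univ.filter fun C => b C = true : Finset (Constraint k n)) :
        Set (Constraint k n)) := by
      ext; simp [e]
    have e2 : Set.univ \ e b = ((Finset.univ.filter fun C => ¬ b C = true : Finset (Constraint k n)) :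
        Set (Constraint k n)) := by
      ext; simp [e]
    rw [e2, Set.ncard_coe_finset, e1, Set.ncard_coe_finset]
  rw [h2, mul_ite, mul_one, mul_zero]
  rfl

/-- Markov's inequality. -/
theorem prob_le (p : unitInterval) (E : Instance k n → Prop) (F : (Constraint k n → Bool) → ℝ)
    (h0 : ∀ b, 0 ≤ F b) (h1 : ∀ b, E (Instance.ofBits b) → 1 ≤ F b) :
    prob k n p E ≤ bernoulliExp p F := by
  classical
  rw [prob_eq]
  refine bernoulliExp_mono p.2.1 p.2.2 fun b => ?_
  split_ifs with h
  · exact h1 b h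
  · exact h0 b

/-- Overwriting the values on the range of `τ` by arbitrary ones injects the pairs of a constrained
function and a new assignment into all functions. -/
theorem card_comp_eq_mul_le {ι : Type*} [Fintype ι] (τ : ι → Fin k)
    (hτ : Function.Injective τ) (y : ι → Fin n) :
    (Finset.univ.filter fun f : Fin k → Fin n => ∀ i, f (τ i) = y i).card * n ^ Fintype.card ι ≤ n ^ k := by
  classical
  have h : Function.Injective fun q : {f : Fin k → Fin n // ∀ i, f (τ i) = y i} × (ι → Fin n) =>
      Function.extend τ q.2 q.1.1 := by
    rintro ⟨⟨f, hf⟩, z⟩ ⟨⟨f', hf'⟩, z'⟩ h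
    simp only at h
    have hz : z = z' := by
      ext1 i
      have := congrFun h (τ i)
      rwa [hτ.extend_apply, hτ.extend_apply] at this
    have hff : f = f' := by
      ext1 i
      by_cases hi : ∃ j, τ j = i
      · obtain ⟨j, rfl⟩ := hi
        rw [hf, hf']
      · have := congrFun h i
        rwa [Function.extend_apply' _ _ _ hi, Function.extend_apply' _ _ _ hi] at this
    subst hz hff
    rfl
  have := Fintype.card_le_of_injective _ h
  rw [Fintype.card_prod, Fintype.card_subtype] at this
  simpa using this

namespace Shape

variable (σ : Shape k)

/-- Negation of a constraint at one position. -/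
def flipAt (i : Fin k) (C : Constraint k n) : Constraint k n :=
  (Function.update C.1 i (-C.1 i), C.2)

theorem sign_flipAt (x : Fin σ.a ⊕ (Fin σ.h ⊕ Fin σ.h)) (C : Constraint k n) :
    σ.sign (flipAt (σ.pos x) C) = -σ.sign C := by
  rw [sign, sign, ← Finset.mul_prod_erase _ _ (Finset.mem_univ x),
    ← Finset.mul_prod_erase _ _ (Finset.mem_univ x), ← neg_mul]
  congr 1
  · simp [flipAt]
  · refine Finset.prod_congr rfl fun y hy => ?_
    rw [flipAt]
    simp only
    rw [Function.update_of_ne fun h => Finset.ne_of_mem_erase hy (σ.pos_injective h)]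

/-- The signed entries of a shape. -/
noncomputable def entries (n : ℕ) (x : Fin σ.a ⊕ (Fin σ.h ⊕ Fin σ.h)) :
    SignedEntries (Constraint k n) (Fin σ.a → Fin n) (Fin σ.h → Fin n) (Fin σ.h → Fin n) where
  idx := σ.idx
  row := σ.row
  col := σ.col
  sgn C := σ.sign C
  flip := flipAt (σ.pos x)
  flip_flip C := by simp [flipAt]
  idx_flip _ := rfl
  row_flip _ := rfl
  col_flip _ := rfl
  sgn_flip C := by rw [sign_flipAt]; push_cast; rfl
  sgn_sq C := by
    rw [sign, Int.cast_prod, ← Finset.prod_pow]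
    exact Finset.prod_eq_one fun i _ => units_sq _

theorem entry_ofBits (b : Constraint k n → Bool) (j u v) : (σ.entry (Instance.ofBits b) j u v : ℝ) =
    ∑ C, ((σ.sign C : ℝ) * if σ.idx C = j ∧ σ.row C = u ∧ σ.col C = v then 1 else 0) *
      bitVal (b C) := by
  rw [entry, Int.cast_multiset_sum, Multiset.map_map, Instance.sum_map_ofBits]
  refine Finset.sum_congr rfl fun C _ => ?_
  simp only [Function.comp]
  split_ifs <;> simp [mul_comm]

/-- Raw signed counts and antisymmetrized coefficients give the same matrices, because the flip
preserves positions and reverses signs. -/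
theorem entry_eq_mat (x) (b : Constraint k n → Bool) (j u v) :
    (σ.entry (Instance.ofBits b) j u v : ℝ) = (σ.entries n x).mat Finset.univ b j u v := by
  rw [entry_ofBits, SignedEntries.mat_apply, ← SignedEntries.sum_sgn_mul_eq]
  · refine Finset.sum_congr rfl fun C _ => ?_
    exact mul_right_comm _ _ _
  · simp
  · intro C
    rfl

theorem offMat_eq_offDiagonal (x) (b : Constraint k n → Bool) :
    (σ.offMat (Instance.ofBits b)).map (Int.cast : ℤ → ℝ) = (σ.entries n x).offDiagonal b := by
  ext y z
  rw [offMat_cast, SignedEntries.offDiagonal, Matrix.of_apply]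
  simp only [σ.entry_eq_mat x]

/-- Constraints at a given place cancel in pairs under the flip, so each entry is unchanged when the
bits are centered and its mean square is a variance. Each constraint belongs to exactly one place
and contributes at most `p`. -/
theorem exp_diag_le {p : ℝ} (h0 : 0 ≤ p) (x : Fin σ.a ⊕ (Fin σ.h ⊕ Fin σ.h)) :
    bernoulliExp p (fun b : Constraint k n → Bool => (σ.diag (Instance.ofBits b) : ℝ)) ≤
      p * Fintype.card (Constraint k n) := by
  set t : (Fin σ.a → Fin n) → (Fin σ.h → Fin n) → (Fin σ.h → Fin n) → Constraint k n → ℝ :=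
    fun j u v C => (σ.sign C : ℝ) * if σ.idx C = j ∧ σ.row C = u ∧ σ.col C = v then 1 else 0 with ht
  have hsum : ∀ j u v, ∑ C, t j u v C = 0 := by
    intro j u v
    have h := (σ.entries n x).sum_flip Finset.univ (by simp) (t j u v)
    have h2 : ∀ C, t j u v ((σ.entries n x).flip C) = - t j u v C := by
      intro C
      rw [ht]
      simp only [entries, sign_flipAt]
      push_cast
      rw [neg_mul]
      rfl
    simp only [h2, Finset.sum_neg_distrib] at h
    linarith
  have hsq : ∀ C : Constraint k n, ∑ j, ∑ u, ∑ v, t j u v C ^ 2 = 1 := by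
    intro C
    have h1 : ((σ.sign C : ℤ) : ℝ) ^ 2 = 1 := (σ.entries n x).sgn_sq C
    simp only [ht, mul_pow, h1, one_mul, ite_pow, one_pow]
    rw [Finset.sum_eq_single (σ.idx C), Finset.sum_eq_single (σ.row C),
      Finset.sum_eq_single (σ.col C)]
    · simp
    · intro v _ hv
      simp [hv.symm]
    · simp
    · intro v _ hv
      simp [hv.symm]
    · simp
    · intro v _ hv
      simp [hv.symm]
    · simp
  have h2 : ∀ b : Constraint k n → Bool, (σ.diag (Instance.ofBits b) : ℝ) =
      ∑ j, ∑ u, ∑ v, (∑ C, t j u v C * (bitVal (b C) - p)) ^ 2 := by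
    intro b
    rw [diag]
    push_cast
    refine Finset.sum_congr rfl fun j _ => Finset.sum_congr rfl fun u _ =>
      Finset.sum_congr rfl fun v _ => ?_
    rw [entry_ofBits]
    simp only [mul_sub, Finset.sum_sub_distrib, ← Finset.sum_mul, hsum, zero_mul, sub_zero]
    rfl
  simp only [h2, bernoulliExp_sum, bernoulliExp_linear_sub_mean_sq, ← Finset.mul_sum]
  have h3 : ∑ j, ∑ u, ∑ v, ∑ C, t j u v C ^ 2 = Fintype.card (Constraint k n) := by
    refine Eq.trans ?_ ((Finset.sum_congr rfl fun C (_ : C ∈ Finset.univ) => hsq C).trans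
      (by rw [Finset.sum_const, nsmul_eq_mul, mul_one]; rfl))
    symm
    rw [Finset.sum_comm]
    refine Finset.sum_congr rfl fun j _ => ?_
    rw [Finset.sum_comm]
    refine Finset.sum_congr rfl fun u _ => ?_
    rw [Finset.sum_comm]
  rw [h3]
  have : (0 : ℝ) ≤ Fintype.card (Constraint k n) := by positivity
  nlinarith [mul_nonneg (mul_nonneg h0 h0) this]

theorem card_constraint : (Fintype.card (Constraint k n) : ℝ) = 2 ^ k * (n : ℝ) ^ k := by
  simp [Fintype.card_prod]

theorem sum_indicator_le {ι : Type*} [Fintype ι] (τ : ι → Fin k)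
    (hτ : Function.Injective τ) (y : ι → Fin n) :
    (∑ C : Constraint k n, if ∀ i, C.2 (τ i) = y i then (1 : ℝ) else 0) * (n : ℝ) ^ Fintype.card ι ≤
      2 ^ k * (n : ℝ) ^ k := by
  have h := card_comp_eq_mul_le τ hτ y
  rw [Fintype.sum_prod_type]
  simp only [Finset.sum_boole, Finset.sum_const, nsmul_eq_mul]
  rw [mul_assoc]
  have h2 : ((Finset.univ : Finset (Fin k → ℤˣ)).card : ℝ) = 2 ^ k := by simp
  rw [h2]
  gcongr
  exact_mod_cast h

/-- With `M` the expected number of constraints, fixing index and row (or index and column) leaves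
on average at most `β = M / n^(a+h)` of them. Taking `d² = n^a β² = M² / n^(a+2h)` gives equality in
the condition on `|J| β²`, and `hd` is exactly `1 ≤ d²`. -/
theorem exp_traceMoment_le {p : ℝ} (h0 : 0 ≤ p) (h1 : p ≤ 1) (hσ : 0 < σ.a + 2 * σ.h) (hn : 0 < n)
    (hd : (n : ℝ) ^ (σ.a + 2 * σ.h) ≤ (2 ^ k * (n : ℝ) ^ k * p) ^ 2) :
    bernoulliExp p (fun b : Constraint k n → Bool => (σ.traceMoment (Instance.ofBits b) : ℝ)) ≤
      4 * ((n : ℝ) ^ σ.h) ^ 2 * (1 + (n : ℝ) ^ σ.a) ^ 2 *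
        (1024 * ((exponent k n : ℝ) + 1) ^ 4 *
          ((2 ^ k * (n : ℝ) ^ k * p) ^ 2 / (n : ℝ) ^ (σ.a + 2 * σ.h))) ^ (exponent k n + 1) := by
  have hx : Nonempty (Fin σ.a ⊕ (Fin σ.h ⊕ Fin σ.h)) := by
    rw [← Fintype.card_pos_iff]
    simp
    omega
  obtain ⟨x⟩ := hx
  set M : ℝ := 2 ^ k * (n : ℝ) ^ k * p with hM
  have hM0 : 0 ≤ M := by positivity
  have hn1 : (1 : ℝ) ≤ n := by exact_mod_cast hn
  have hn0 : (0 : ℝ) < n := by positivity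
  set d : ℝ := √(M ^ 2 / (n : ℝ) ^ (σ.a + 2 * σ.h)) with hdd
  have hd2 : d ^ 2 = M ^ 2 / (n : ℝ) ^ (σ.a + 2 * σ.h) := Real.sq_sqrt (by positivity)
  set β : ℝ := M / (n : ℝ) ^ (σ.a + σ.h) with hβ
  have hβ0 : 0 ≤ β := by positivity
  have hβ2 : (n : ℝ) ^ σ.a * β ^ 2 = d ^ 2 := by
    rw [hd2, hβ, div_pow]
    field_simp
    ring
  have hcard : ∀ a : ℕ, (Fintype.card (Fin a → Fin n) : ℝ) = (n : ℝ) ^ a := fun a => by simp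
  have hfib : ∀ {q : Constraint k n → Prop} [DecidablePred q] (τ : Fin σ.a ⊕ Fin σ.h → Fin k)
      (hτ : Function.Injective τ) (y : Fin σ.a ⊕ Fin σ.h → Fin n)
      (hq : ∀ C, q C → ∀ i, C.2 (τ i) = y i), p * ∑ C, (if q C then 1 else 0) ≤ β := by
    intro q _ τ hτ y hq
    have h := sum_indicator_le τ hτ y
    rw [Fintype.card_sum, Fintype.card_fin, Fintype.card_fin] at h
    rw [hβ, le_div_iff₀ (by positivity), hM, mul_assoc, mul_comm _ p]
    refine mul_le_mul_of_nonneg_left (le_trans ?_ h) h0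
    gcongr with C
    split_ifs with h3 h4 h4
    · exact le_rfl
    · exact absurd (hq C h3) h4
    · norm_num
    · exact le_rfl
  have key := (σ.entries n x).exp_trace_offDiagonal_le h0 h1 (β := β) (d := d) hβ0
    (fun j u => hfib (fun i => σ.pos (Sum.elim .inl (fun i => .inr (.inl i)) i))
      (σ.pos_injective.comp (by
        rintro (i | i) (i' | i') h <;> simp at h <;> simp [h])) (Sum.elim j u)
      (by
        rintro C ⟨rfl, rfl⟩ (i | i) <;> rfl))
    (fun j u => hfib (fun i => σ.pos (Sum.elim .inl (fun i => .inr (.inr i)) i))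
      (σ.pos_injective.comp (by
        rintro (i | i) (i' | i') h <;> simp at h <;> simp [h])) (Sum.elim j u)
      (by
        rintro C ⟨rfl, rfl⟩ (i | i) <;> rfl))
    (by
      rw [hdd, Real.one_le_sqrt, one_le_div (by positivity)]
      exact hd)
    (by
      refine abs_le_of_sq_le_sq' ?_ (Real.sqrt_nonneg _) |>.2
      rw [← hβ2]
      exact le_mul_of_one_le_left (by positivity) (one_le_pow₀ hn1))
    (by
      rw [hcard]
      exact hβ2.le) (exponent k n)
  simp only [hcard, hd2] at key
  refine le_trans (le_of_eq ?_) (key.trans (le_of_eq ?_))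
  · congr 1
    ext b
    rw [traceMoment, trace_cast, offMat_eq_offDiagonal]
  · ring

end Shape

end CSP

/-! ### The probability of failure -/

namespace CSP

open Shape (exponent)

variable {k n : ℕ}

theorem NNRat.cast_eq_num_div_den (γ : ℚ≥0) : (γ : ℝ) = (γ.num : ℝ) / γ.den := by
  conv_lhs => rw [← NNRat.num_div_den γ]
  push_cast
  rfl

theorem bernoulliExp_list_sum {E ι : Type*} [Fintype E] [DecidableEq E] (p : ℝ) (l : List ι)
    (f : ι → (E → Bool) → ℝ) :
    bernoulliExp p (fun b => (l.map fun i => f i b).sum) = (l.map fun i => bernoulliExp p (f i)).sum := by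
  induction l with
  | nil => simp [bernoulliExp]
  | cons i l ih => simp only [List.map_cons, List.sum_cons, bernoulliExp_add, ih]

theorem Shape.diag_nonneg (σ : Shape k) (I : Instance k n) : 0 ≤ σ.diag I :=
  Finset.sum_nonneg fun _ _ => Finset.sum_nonneg fun _ _ => Finset.sum_nonneg fun _ _ => sq_nonneg _

theorem Shape.traceMoment_nonneg (σ : Shape k) (I : Instance k n) :
    (0 : ℝ) ≤ σ.traceMoment I := by
  rw [Shape.traceMoment, Shape.trace_cast]
  have h : ((σ.offMat I).map (Int.cast : ℤ → ℝ) *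
      ((σ.offMat I).map (Int.cast : ℤ → ℝ)).transpose).PosSemidef := by
    simpa using Matrix.posSemidef_self_mul_conjTranspose ((σ.offMat I).map (Int.cast : ℤ → ℝ))
  exact (h.pow _).trace_nonneg

/-- If a test fails, then one of two quantities with small expectation is large. -/
theorem Shape.one_le_of_not_test {σ : Shape k} {I : Instance k n} {γ : ℚ≥0} (hγ : 0 < γ) {M : ℝ}
    (hM : 0 < M) (hI : M / 2 ≤ Multiset.card I) (h : ¬ σ.Test I γ) :
    1 ≤ (n : ℝ) ^ σ.a * (8 * 4 ^ (k + 1) / ((γ : ℝ) ^ 2 * M ^ 2)) * σ.diag I +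
      ((n : ℝ) ^ σ.a * ((n : ℝ) ^ σ.h * (n : ℝ) ^ σ.h) * (8 * 4 ^ (k + 1) / ((γ : ℝ) ^ 2 * M ^ 2))) ^
        (2 * exponent k n + 2) * σ.traceMoment I := by
  have hγ' : (0 : ℝ) < γ := by exact_mod_cast hγ
  have hd0 : (0 : ℝ) ≤ σ.diag I := by exact_mod_cast σ.diag_nonneg I
  have ht0 := σ.traceMoment_nonneg I
  have hden : (0 : ℝ) < γ.den := by exact_mod_cast γ.den_pos
  set m : ℝ := (Multiset.card I : ℝ) with hm
  have hnum : (γ.num : ℝ) = γ * γ.den := by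
    rw [NNRat.cast_eq_num_div_den]
    field_simp
  set q : ℝ := 8 * 4 ^ (k + 1) / ((γ : ℝ) ^ 2 * M ^ 2) with hq
  have hq0 : 0 < q := by positivity
  -- The hypothesis `M / 2 ≤ m` replaces the random `m²` by `M²/4`. Together with the `2` in the
  -- tests this explains the `8` in `q`.
  have hbase : ∀ y : ℝ, 0 ≤ y → 2 * y * (4 ^ (k + 1) * (γ.den : ℝ) ^ 2) ≤
      (y * q) * ((γ.num : ℝ) ^ 2 * m ^ 2) := by
    intro y hy
    rw [hq, hnum]
    have h4 : M ^ 2 ≤ 4 * m ^ 2 := by nlinarith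
    rw [mul_div_assoc', div_mul_eq_mul_div, le_div_iff₀ (by positivity)]
    have := mul_le_mul_of_nonneg_left h4
      (by positivity : 0 ≤ 2 * y * (4 ^ (k + 1) * (γ.den : ℝ) ^ 2) * γ ^ 2)
    linarith
  rw [Shape.Test, not_and_or, not_le, not_le] at h
  rcases h with h | h
  · have h1 : (γ.num : ℝ) ^ 2 * m ^ 2 <
        2 * ((n : ℝ) ^ σ.a * σ.diag I) * (4 ^ (k + 1) * (γ.den : ℝ) ^ 2) := by
      have h0 : (γ.num : ℝ) ^ 2 * (Multiset.card I : ℝ) ^ 2 <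
          2 * (n : ℝ) ^ σ.a * σ.diag I * (4 ^ (k + 1) * (γ.den : ℝ) ^ 2) := by exact_mod_cast h
      rw [hm]
      linarith
    have h2 := h1.trans_le (hbase _ (by positivity))
    have h3 : 1 ≤ (n : ℝ) ^ σ.a * σ.diag I * q := by
      by_contra hlt
      rw [not_le] at hlt
      have := mul_le_mul_of_nonneg_right hlt.le (by positivity : 0 ≤ (γ.num : ℝ) ^ 2 * m ^ 2)
      linarith
    have h5 : 0 ≤ ((n : ℝ) ^ σ.a * ((n : ℝ) ^ σ.h * (n : ℝ) ^ σ.h) * q) ^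
        (2 * exponent k n + 2) * σ.traceMoment I := by positivity
    linarith
  · have h1 : ((γ.num : ℝ) ^ 2 * m ^ 2) ^ (2 * exponent k n + 2) < σ.traceMoment I *
        (2 * ((n : ℝ) ^ σ.a * ((n : ℝ) ^ σ.h * (n : ℝ) ^ σ.h)) * (4 ^ (k + 1) * (γ.den : ℝ) ^ 2)) ^
          (2 * exponent k n + 2) := by
      rw [hm, ← mul_assoc (2 : ℝ)]; exact_mod_cast h
    have h2 := h1.trans_le (mul_le_mul_of_nonneg_left
      (pow_le_pow_left₀ (by positivity) (hbase _ (by positivity)) _) ht0)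
    have h3 : 1 ≤ ((n : ℝ) ^ σ.a * ((n : ℝ) ^ σ.h * (n : ℝ) ^ σ.h) * q) ^
        (2 * exponent k n + 2) * σ.traceMoment I := by
      by_contra hlt
      rw [not_le] at hlt
      have := mul_le_mul_of_nonneg_right hlt.le
        (by positivity : 0 ≤ ((γ.num : ℝ) ^ 2 * m ^ 2) ^ (2 * exponent k n + 2))
      rw [mul_pow _ ((γ.num : ℝ) ^ 2 * m ^ 2)] at h2
      linarith
    have h5 : 0 ≤ (n : ℝ) ^ σ.a * q * σ.diag I := by positivity
    linarith

/-- Since `n < 2^(size n)`, an exponent of order `log n` makes `2^(r+1)` exceed `n^(2k+2)`. This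
pays for the dimension prefactor `n^(2k)` and leaves a factor tending to zero. -/
theorem pow_le_two_pow_exponent (k n : ℕ) :
    (n : ℝ) ^ (2 * k) * n ≤ 2 ^ (exponent k n + 1) / n := by
  rcases Nat.eq_zero_or_pos n with rfl | hn
  · simp
  have hn0 : (0 : ℝ) < n := by exact_mod_cast hn
  have e1 : n ^ (2 * k + 1 + 1) ≤ 2 ^ (exponent k n + 1) := by
    calc n ^ (2 * k + 1 + 1) ≤ (2 ^ Nat.size n) ^ (2 * k + 1 + 1) :=
          Nat.pow_le_pow_left (Nat.lt_size_self n).le _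
      _ = 2 ^ (Nat.size n * (2 * k + 1 + 1)) := by rw [pow_mul]
      _ ≤ 2 ^ (exponent k n + 1) := by
        refine Nat.pow_le_pow_right (by norm_num) ?_
        rw [exponent, mul_comm]
        exact (Nat.mul_le_mul_right _ (by omega)).trans (Nat.le_succ _)
  rw [le_div_iff₀ hn0, ← pow_succ, ← pow_succ]
  exact_mod_cast e1

/-- The product `y² B` compares the typical size of the matrix with the threshold. Once it is at
most `1/2`, its power `r + 1` beats the polynomial prefactor. -/
theorem pow_mul_le_of_half {ν y T A B z : ℝ} {r : ℕ} (hν : 0 < ν) (hy : 0 ≤ y) (hB0 : 0 ≤ B)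
    (hT : T ≤ A * B ^ (r + 1)) (hA : A ≤ 16 * z) (hB : y ^ 2 * B ≤ 1 / 2)
    (hz : z * ν ≤ 2 ^ (r + 1) / ν) (hν1 : 1 ≤ ν := by assumption) (hz0 : 0 ≤ z := by positivity) :
    y ^ (2 * r + 2) * T ≤ 16 / ν := by
  have h2 : z ≤ 2 ^ (r + 1) / ν := (le_mul_of_one_le_right hz0 hν1).trans hz
  calc y ^ (2 * r + 2) * T ≤ y ^ (2 * r + 2) * (16 * z * B ^ (r + 1)) := by
        refine mul_le_mul_of_nonneg_left (hT.trans ?_) (by positivity)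
        exact mul_le_mul_of_nonneg_right hA (by positivity)
    _ = 16 * z * (y ^ 2 * B) ^ (r + 1) := by
        rw [mul_pow, ← pow_mul, show 2 * (r + 1) = 2 * r + 2 by ring]
        ring
    _ ≤ 16 * z * (1 / 2) ^ (r + 1) := by
        refine mul_le_mul_of_nonneg_left (pow_le_pow_left₀ (by positivity) hB _) (by positivity)
    _ ≤ 16 * (2 ^ (r + 1) / ν) * (1 / 2) ^ (r + 1) := by
        refine mul_le_mul_of_nonneg_right (by linarith) (by positivity)
    _ = 16 / ν := by
        rw [one_div, inv_pow]
        field_simp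

/-- The probability of failure for a fixed number of variables. -/
theorem prob_certify_false_le (t : ℕ) (ht : 2 ≤ t) (htk : t ≤ k) (hn : 0 < n) (p : unitInterval)
    {γ : ℚ≥0} (hγ : 0 < γ) (hγ1 : γ < 1) {L : ℝ} (hL : 1 ≤ L)
    (hM : (n : ℝ) ^ t * L ^ 2 ≤ ((γ : ℝ) ^ 2 * (2 ^ k * (n : ℝ) ^ k * p)) ^ 2)
    (hr : 65536 * (4 ^ (k + 1)) ^ 2 * ((exponent k n : ℝ) + 1) ^ 4 / L ^ 2 ≤ 1 / 2) :
    prob k n p (fun I => certify t n I γ = false) ≤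
      4 / L + (shapes k t).length * (8 * 4 ^ (k + 1) / L + 16 / n) := by
  set M : ℝ := 2 ^ k * (n : ℝ) ^ k * p with hMdef
  have hp0 : (0 : ℝ) ≤ p := p.2.1
  have hp1 : (p : ℝ) ≤ 1 := p.2.2
  have hM0 : 0 ≤ M := by positivity
  have hγ0 : (0 : ℝ) < γ := by exact_mod_cast hγ
  have hγ1' : (γ : ℝ) < 1 := by exact_mod_cast hγ1
  have hn1 : (1 : ℝ) ≤ n := by exact_mod_cast hn
  have hn0 : (0 : ℝ) < n := by positivity
  set X : ℝ := (γ : ℝ) ^ 2 * M with hX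
  have hX0 : 0 ≤ X := by positivity
  have hXM : X ≤ M := mul_le_of_le_one_left hM0 (pow_le_one₀ hγ0.le hγ1'.le)
  -- This is where `t ≥ 2` enters: the diagonal term carries a factor `n^a ≤ n` and requires at
  -- least order `n` constraints, also for sets of small size.
  have hnt : ((n : ℝ) * L) ^ 2 ≤ X ^ 2 := by
    refine le_trans ?_ hM
    rw [mul_pow]
    gcongr
  have hnX : (n : ℝ) * L ≤ X := abs_le_of_sq_le_sq' hnt hX0 |>.2
  have hLX : L ≤ X := (le_mul_of_one_le_left (by linarith) hn1).trans hnX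
  have hMpos : 0 < M := by linarith
  have hXpos : 0 < X := by linarith
  have hcard : (Fintype.card (Constraint k n) : ℝ) * p = M := by rw [Shape.card_constraint]
  set q : ℝ := 8 * 4 ^ (k + 1) / ((γ : ℝ) ^ 2 * M ^ 2) with hq
  have hq0 : 0 < q := by positivity
  have hqX : q = 8 * 4 ^ (k + 1) / (X * M) := by rw [hq, hX]; ring_nf
  set F : Shape k → (Constraint k n → Bool) → ℝ := fun σ b =>
    (n : ℝ) ^ σ.a * q * σ.diag (Instance.ofBits b) +
      ((n : ℝ) ^ σ.a * ((n : ℝ) ^ σ.h * (n : ℝ) ^ σ.h) * q) ^ (2 * exponent k n + 2) *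
        σ.traceMoment (Instance.ofBits b) with hF
  have hF0 : ∀ σ b, 0 ≤ F σ b := by
    intro σ b
    have h1 : (0 : ℝ) ≤ σ.diag (Instance.ofBits b) := by exact_mod_cast σ.diag_nonneg _
    have h2 := σ.traceMoment_nonneg (Instance.ofBits b)
    rw [hF]
    positivity
  -- Union bound through one application of Markov's inequality: a Chebyshev term for too few
  -- constraints, plus the two failure quantities of each shape.
  have hle := prob_le p (fun I => certify t n I γ = false)
    (fun b => 4 / M ^ 2 * (∑ C, 1 * (bitVal (b C) - p)) ^ 2 + ((shapes k t).map fun σ => F σ b).sum)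
    (fun b => add_nonneg (by positivity) (List.sum_nonneg (by
      simp only [List.mem_map]
      rintro _ ⟨σ, -, rfl⟩
      exact hF0 σ b)))
    (by
      intro b hb
      have hs0 : 0 ≤ ((shapes k t).map fun σ => F σ b).sum := List.sum_nonneg (by
        simp only [List.mem_map]
        rintro _ ⟨σ, -, rfl⟩
        exact hF0 σ b)
      rcases le_or_gt (M / 2) (Multiset.card (Instance.ofBits b)) with hm | hm
      · simp only [certify, decide_eq_false_iff_not, not_or, not_forall] at hb
        obtain ⟨σ, hσ, hT⟩ := hb.2
        have h1 : 1 ≤ F σ b := Shape.one_le_of_not_test hγ hMpos hm hT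
        have h2 : F σ b ≤ ((shapes k t).map fun σ => F σ b).sum :=
          List.single_le_sum (by
            simp only [List.mem_map]
            rintro _ ⟨σ, -, rfl⟩
            exact hF0 σ b) _ (List.mem_map_of_mem hσ)
        have h3 : 0 ≤ 4 / M ^ 2 * (∑ C, 1 * (bitVal (b C) - p)) ^ 2 := by positivity
        linarith
      · rw [Instance.card_ofBits] at hm
        have h1 : ∑ C, 1 * (bitVal (b C) - p) = ∑ C, bitVal (b C) - M := by
          simp only [one_mul, Finset.sum_sub_distrib, Finset.sum_const, nsmul_eq_mul]
          rw [← hcard]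
          rfl
        have h2 : M ^ 2 / 4 ≤ (∑ C, bitVal (b C) - M) ^ 2 := by nlinarith
        have h3 : 1 ≤ 4 / M ^ 2 * (∑ C, bitVal (b C) - M) ^ 2 := by
          rw [div_mul_eq_mul_div, one_le_div (by positivity)]
          linarith
        rw [h1]
        linarith)
  refine hle.trans ?_
  rw [bernoulliExp_add, bernoulliExp_const_mul, bernoulliExp_linear_sub_mean_sq, bernoulliExp_list_sum]
  refine add_le_add ?_ ?_
  · have h1 : (p : ℝ) * (1 - p) * ∑ C : Constraint k n, (1 : ℝ) ^ 2 ≤ M := by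
      simp only [one_pow, Finset.sum_const, nsmul_eq_mul, mul_one]
      rw [← hcard]
      have : (0 : ℝ) ≤ (Finset.univ : Finset (Constraint k n)).card := by positivity
      have h2 : ((Finset.univ : Finset (Constraint k n)).card : ℝ) = Fintype.card (Constraint k n) := rfl
      rw [← h2]
      nlinarith [mul_nonneg (mul_nonneg hp0 hp0) this]
    calc 4 / M ^ 2 * (p * (1 - p) * ∑ C : Constraint k n, (1 : ℝ) ^ 2) ≤ 4 / M ^ 2 * M := by gcongr
      _ = 4 / M := by field_simp
      _ ≤ 4 / L := by gcongr; linarith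
  · rw [← nsmul_eq_mul, ← List.length_map (as := shapes k t) (fun σ => bernoulliExp p (F σ))]
    refine List.sum_le_card_nsmul _ _ ?_
    simp only [List.mem_map]
    rintro _ ⟨σ, hσ, rfl⟩
    obtain ⟨hs0, hst, ha⟩ := mem_shapes hσ
    have hx : Nonempty (Fin σ.a ⊕ (Fin σ.h ⊕ Fin σ.h)) := by
      rw [← Fintype.card_pos_iff]
      simp
      omega
    obtain ⟨x⟩ := hx
    rw [hF]
    simp only
    rw [bernoulliExp_add, bernoulliExp_const_mul, bernoulliExp_const_mul]
    refine add_le_add ?_ ?_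
    · have h1 := σ.exp_diag_le (n := n) hp0 x
      rw [mul_comm, hcard] at h1
      have h2 : (n : ℝ) ^ σ.a ≤ n := by
        calc (n : ℝ) ^ σ.a ≤ (n : ℝ) ^ 1 := pow_le_pow_right₀ hn1 ha
          _ = n := pow_one _
      have h3 : 0 ≤ bernoulliExp p
          (fun b : Constraint k n → Bool => (σ.diag (Instance.ofBits b) : ℝ)) :=
        bernoulliExp_nonneg hp0 hp1 fun b => by exact_mod_cast σ.diag_nonneg _
      calc _ ≤ (n : ℝ) * q * M := by gcongr
        _ = (8 * 4 ^ (k + 1)) * (n / X) := by rw [hqX]; field_simp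
        _ ≤ (8 * 4 ^ (k + 1)) * (1 / L) := by
          gcongr (8 * 4 ^ (k + 1)) * ?_
          rw [div_le_div_iff₀ hXpos (by linarith)]
          linarith
        _ = _ := by ring
    · set r := exponent k n with hrdef
      set s := σ.a + 2 * σ.h with hs
      have hsX : (n : ℝ) ^ s * L ^ 2 ≤ X ^ 2 := by
        refine le_trans ?_ hM
        gcongr
      have hsM : (n : ℝ) ^ s ≤ M ^ 2 := by
        calc (n : ℝ) ^ s ≤ (n : ℝ) ^ s * L ^ 2 := le_mul_of_one_le_right (by positivity) (one_le_pow₀ hL)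
          _ ≤ X ^ 2 := hsX
          _ ≤ M ^ 2 := by gcongr
      have h1 := σ.exp_traceMoment_le hp0 hp1 hs0 hn hsM
      have hpow : (n : ℝ) ^ σ.a * ((n : ℝ) ^ σ.h * (n : ℝ) ^ σ.h) = (n : ℝ) ^ s := by
        rw [hs, two_mul, pow_add, pow_add]
      rw [hpow]
      have hA : 4 * ((n : ℝ) ^ σ.h) ^ 2 * (1 + (n : ℝ) ^ σ.a) ^ 2 ≤ 16 * (n : ℝ) ^ (2 * k) := by
        have e1 : 1 + (n : ℝ) ^ σ.a ≤ 2 * (n : ℝ) ^ σ.a := by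
          have := one_le_pow₀ hn1 (n := σ.a)
          linarith
        calc 4 * ((n : ℝ) ^ σ.h) ^ 2 * (1 + (n : ℝ) ^ σ.a) ^ 2
            ≤ 4 * ((n : ℝ) ^ σ.h) ^ 2 * (2 * (n : ℝ) ^ σ.a) ^ 2 := by gcongr
          _ = 16 * (n : ℝ) ^ (2 * σ.h + 2 * σ.a) := by rw [pow_add, pow_mul', pow_mul']; ring
          _ ≤ _ := by
            gcongr
            omega
      -- The factors `M²` cancel and what remains is a multiple of `n^s / X²`, at most `1/L²` by the
      -- density hypothesis since `s ≤ t`.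
      have hB : ((n : ℝ) ^ s * q) ^ 2 * (1024 * ((r : ℝ) + 1) ^ 4 * (M ^ 2 / (n : ℝ) ^ s)) ≤ 1 / 2 := by
        refine le_trans ?_ hr
        calc _ = 65536 * (4 ^ (k + 1)) ^ 2 * ((r : ℝ) + 1) ^ 4 * ((n : ℝ) ^ s / X ^ 2) := by
              rw [hqX]; field_simp; ring
          _ ≤ 65536 * (4 ^ (k + 1)) ^ 2 * ((r : ℝ) + 1) ^ 4 * (1 / L ^ 2) := by
              refine mul_le_mul_of_nonneg_left ?_ (by positivity)
              rw [div_le_div_iff₀ (by positivity) (by positivity)]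
              linarith
          _ = _ := by ring
      exact pow_mul_le_of_half hn0 (by positivity) (by positivity) h1 hA hB (pow_le_two_pow_exponent k n)

/-- The certification algorithm succeeds with high probability. -/
theorem tendsto_prob_certify_false {t : ℕ} (ht : 2 ≤ t) (htk : t ≤ k) (p : ℕ → unitInterval)
    (γ : ℕ → ℚ≥0) (hγ : ∀ n, 0 < γ n)
    (h : ∀ᶠ n : ℕ in atTop, (n : ℝ) ^ ((t : ℝ) / 2) * Real.log n ^ 5 / (γ n : ℝ) ^ 2
      ≤ 2 ^ k * (n : ℝ) ^ k * (p n : ℝ)) :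
    Tendsto (fun n => prob k n (p n) (fun I => certify t n I (γ n) = false)) atTop (𝓝 0) := by
  have hlog : Tendsto (fun n : ℕ => Real.log n) atTop atTop :=
    Real.tendsto_log_atTop.comp tendsto_natCast_atTop_atTop
  have hlog5 : Tendsto (fun n : ℕ => Real.log n ^ 5) atTop atTop :=
    (tendsto_pow_atTop (by norm_num)).comp hlog
  have hlim : Tendsto (fun n : ℕ => 4 / Real.log n ^ 5 + ((shapes k t).length : ℝ) *
      (8 * 4 ^ (k + 1) / Real.log n ^ 5 + 16 / n)) atTop (𝓝 0) := by
    have h1 := hlog5.const_div_atTop (4 : ℝ)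
    have h2 := hlog5.const_div_atTop (8 * 4 ^ (k + 1) : ℝ)
    have h3 := tendsto_natCast_atTop_atTop (R := ℝ) |>.const_div_atTop (16 : ℝ)
    simpa using h1.add ((h2.add h3).const_mul ((shapes k t).length : ℝ))
  -- The exponent is of order `log n`, so its fourth power is negligible against `(log n)^10`;
  -- constants depending on `k` are absorbed here.
  have hbase : ∀ᶠ n : ℕ in atTop, 65536 * (4 ^ (k + 1)) ^ 2 * ((exponent k n : ℝ) + 1) ^ 4 /
      (Real.log n ^ 5) ^ 2 ≤ 1 / 2 := by
    set c : ℝ := 65536 * (4 ^ (k + 1)) ^ 2 * (4 * (2 * k + 3)) ^ 4 with hc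
    have h1 := hlog5.const_div_atTop c
    filter_upwards [h1.eventually_le_const (show (0 : ℝ) < 1 / 2 by norm_num), hlog.eventually_ge_atTop 1,
      eventually_gt_atTop 0] with n hn1 hn2 hn0
    refine le_trans ?_ hn1
    have h2 : (exponent k n : ℝ) + 1 ≤ 4 * (2 * k + 3) * Real.log n := by
      have e1 : ((Nat.size n : ℝ) - 1) * Real.log 2 ≤ Real.log n := by
        have f1 : 0 < Nat.size n := Nat.size_pos.2 hn0
        have f2 : 2 ^ (Nat.size n - 1) ≤ n := Nat.lt_size.1 (by omega)
        have f3 : Real.log (2 ^ (Nat.size n - 1)) ≤ Real.log n :=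
          Real.log_le_log (by positivity) (by exact_mod_cast f2)
        rwa [Real.log_pow, Nat.cast_sub f1, Nat.cast_one] at f3
      have e2 : (0.69 : ℝ) < Real.log 2 := by linarith [Real.log_two_gt_d9]
      have e3 : (Nat.size n : ℝ) ≤ 3 * Real.log n := by nlinarith
      rw [exponent]
      push_cast
      have e4 : (0 : ℝ) ≤ k := by positivity
      nlinarith [mul_le_mul_of_nonneg_left e3 (by positivity : (0 : ℝ) ≤ 2 * k + 3)]
    have h3 : 0 < Real.log n := by linarith
    calc _ ≤ 65536 * (4 ^ (k + 1)) ^ 2 * (4 * (2 * k + 3) * Real.log n) ^ 4 / (Real.log n ^ 5) ^ 2 := by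
          gcongr
      _ = c / Real.log n ^ 6 := by
          rw [hc]
          field_simp
      _ ≤ c / Real.log n ^ 5 := by
          gcongr
          norm_num
  refine squeeze_zero' (Eventually.of_forall fun n => ENNReal.toReal_nonneg) ?_ hlim
  filter_upwards [h, hbase, hlog5.eventually_ge_atTop 1, eventually_gt_atTop 0] with n hn1 hn2 hn3 hn0
  -- For `γ ≥ 1` the algorithm never fails; the density estimate needs `γ < 1` to compare `γ² M`
  -- with `M`.
  rcases lt_or_ge (γ n) 1 with hγ1 | hγ1
  · refine prob_certify_false_le t ht htk hn0 (p n) (hγ n) hγ1 hn3 ?_ hn2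
    have hγ0 : (0 : ℝ) < γ n := by exact_mod_cast hγ n
    rw [div_le_iff₀' (by positivity)] at hn1
    have := pow_le_pow_left₀ (by positivity) hn1 2
    refine le_trans (le_of_eq ?_) this
    rw [mul_pow, ← Real.rpow_natCast ((n : ℝ) ^ ((t : ℝ) / 2)), ← Real.rpow_mul (by positivity)]
    norm_num
  · have h1 : ∀ I : Instance k n, certify t n I (γ n) = true := by
      intro I
      simp only [certify, decide_eq_true_eq]
      left
      rw [← NNRat.num_div_den (γ n), one_le_div (by exact_mod_cast (γ n).den_pos)] at hγ1
      exact_mod_cast hγ1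
    have h2 : prob k n (p n) (fun I => certify t n I (γ n) = false) = 0 := by
      simp [prob, h1]
    rw [h2]
    positivity

end CSP

/-! ### A loop language and its translation to machine programs -/

namespace RAM

/-- Terms over data arrays and loop variables. -/
inductive Tm : Type
  | const (v : ℕ)
  | var (i : ℕ)
  | read (a : ℕ) (t : Tm)
  | op (o : Op) (t u : Tm)

namespace Tm

/-- Value of a term. -/
def eval (d : State) (env : ℕ → ℕ) : Tm → ℕ
  | const v => v
  | var i => env i
  | read a t => d a (t.eval d env)
  | op o t u => o.eval (t.eval d env) (u.eval d env)

/-- Translation of a term: data arrays have even names, loop variables odd names. -/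
def compile : Tm → Expr
  | const v => .const v
  | var i => .read (2 * i + 3) (.const 0)
  | read a t => .read (2 * a) t.compile
  | op o t u => .op o t.compile u.compile

/-- The term does not read the array `a`. -/
def Avoids (a : ℕ) : Tm → Prop
  | const _ => True
  | var _ => True
  | read b t => b ≠ a ∧ t.Avoids a
  | op _ t u => t.Avoids a ∧ u.Avoids a

theorem eval_congr {a : ℕ} {d d' : State} (h : ∀ b, b ≠ a → d b = d' b) (env : ℕ → ℕ) (t : Tm)
    (ht : t.Avoids a) : t.eval d env = t.eval d' env := by
  induction t with
  | const v => rfl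
  | var i => rfl
  | read b t ih => rw [eval, eval, ih ht.2, h b ht.1]
  | op o t u iht ihu => rw [eval, eval, iht ht.1, ihu ht.2]

end Tm

/-- The memory that holds data arrays and the values of loop variables. -/
def layout (d : State) (env : ℕ → ℕ) : State := fun a i =>
  if a % 2 = 0 then d (a / 2) i else if a = 1 then 0 else if i = 0 then env ((a - 3) / 2) else 0

theorem layout_data (d : State) (env : ℕ → ℕ) (a i : ℕ) : layout d env (2 * a) i = d a i := by
  simp [layout]

theorem layout_var (d : State) (env : ℕ → ℕ) (j : ℕ) : layout d env (2 * j + 3) 0 = env j := by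
  have h1 : (2 * j + 3) % 2 ≠ 0 := by omega
  have h2 : (2 * j + 3 - 3) / 2 = j := by omega
  rw [layout, if_neg h1, if_neg (by omega), if_pos rfl, h2]

theorem layout_set_var (d : State) (env : ℕ → ℕ) (j v : ℕ) :
    (layout d env).set (2 * j + 3) 0 v = layout d (Function.update env j v) := by
  funext a i
  rw [State.set, layout, layout]
  by_cases h1 : a % 2 = 0
  · rw [if_neg (by omega), if_pos h1, if_pos h1]
  · by_cases h2 : a = 1
    · rw [if_neg (by omega), if_neg h1, if_neg h1]
      simp [h2]
    · rw [if_neg h1, if_neg h1, if_neg h2, if_neg h2]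
      by_cases h3 : i = 0
      · rw [if_pos h3, if_pos h3, Function.update_apply]
        by_cases h4 : a = 2 * j + 3
        · rw [if_pos ⟨h4, h3⟩, if_pos (by omega)]
        · rw [if_neg (fun h => h4 h.1), if_neg (by omega)]
      · rw [if_neg (fun h => h3 h.2), if_neg h3, if_neg h3]

theorem layout_set_data (d : State) (env : ℕ → ℕ) (a i v : ℕ) :
    (layout d env).set (2 * a) i v = layout (d.set a i v) env := by
  funext b j
  simp only [State.set, layout]
  by_cases h1 : b % 2 = 0
  · rw [if_pos h1, if_pos h1]
    refine if_congr (and_congr_left fun _ => ?_) rfl rfl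
    omega
  · rw [if_neg h1, if_neg h1, if_neg]
    omega

theorem Tm.eval_compile (d : State) (env : ℕ → ℕ) (t : Tm) :
    t.compile.eval (layout d env) = t.eval d env := by
  induction t with
  | const v => rfl
  | var i => exact layout_var d env i
  | read a t ih => rw [compile, Expr.eval, ih, layout_data, eval]
  | op o t u iht ihu => rw [compile, Expr.eval, iht, ihu, eval]

/-- All cells have size at most `N`. -/
def SizeLE (d : State) (N : ℕ) : Prop := ∀ a i, Nat.size (d a i) ≤ N

theorem size_op_le (o : Op) (x y : ℕ) : Nat.size (o.eval x y) ≤ Nat.size x + Nat.size y + 1 := by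
  have hx := Nat.lt_size_self x
  have hy := Nat.lt_size_self y
  cases o with
  | add =>
    rw [Nat.size_le, Op.eval]
    have h1 : 2 ^ Nat.size x ≤ 2 ^ (Nat.size x + Nat.size y) := Nat.pow_le_pow_right (by norm_num) (by omega)
    have h2 : 2 ^ Nat.size y ≤ 2 ^ (Nat.size x + Nat.size y) := Nat.pow_le_pow_right (by norm_num) (by omega)
    rw [pow_succ]
    omega
  | sub => exact (Nat.size_le_size (Nat.sub_le x y)).trans (by omega)
  | mul =>
    rw [Nat.size_le, Op.eval]
    calc x * y < 2 ^ Nat.size x * 2 ^ Nat.size y := Nat.mul_lt_mul'' hx hy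
      _ = 2 ^ (Nat.size x + Nat.size y) := by rw [pow_add]
      _ ≤ _ := Nat.pow_le_pow_right (by norm_num) (by omega)
  | div => exact (Nat.size_le_size (Nat.div_le_self x y)).trans (by omega)
  | mod => exact (Nat.size_le_size (Nat.mod_le x y)).trans (by omega)

theorem size_le_self (x : ℕ) : Nat.size x ≤ x := by
  rw [Nat.size_le]
  exact Nat.lt_two_pow_self

/-- A term is fixed, and each operation at most adds the bit lengths of its operands plus one, so
the length of the value is linear in that of the data. -/
theorem Tm.exists_size_le (t : Tm) : ∃ A : ℕ, ∀ (d : State) (env : ℕ → ℕ) (N : ℕ), SizeLE d N →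
    (∀ i, env i ≤ N) → Nat.size (t.eval d env) ≤ A * (N + 1) := by
  induction t with
  | const v => exact ⟨Nat.size v, fun d env N _ _ => Nat.le_mul_of_pos_right _ (by omega)⟩
  | var i => exact ⟨1, fun d env N _ h => (size_le_self _).trans ((h i).trans (by omega))⟩
  | read a t _ => exact ⟨1, fun d env N h _ => (h _ _).trans (by omega)⟩
  | op o t u iht ihu =>
    obtain ⟨A, hA⟩ := iht
    obtain ⟨B, hB⟩ := ihu
    refine ⟨A + B + 1, fun d env N h h' => (size_op_le _ _ _).trans ?_⟩
    have h1 := hA d env N h h'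
    have h2 := hB d env N h h'
    rw [add_mul, add_mul]
    omega

theorem Tm.exists_cost_le (t : Tm) : ∃ A : ℕ, ∀ (d : State) (env : ℕ → ℕ) (N : ℕ), SizeLE d N →
    (∀ i, env i ≤ N) → t.compile.cost (layout d env) ≤ A * (N + 1) ^ 2 := by
  induction t with
  | const v => exact ⟨Nat.size v + 1, fun d env N _ _ => Nat.le_mul_of_pos_right _ (by positivity)⟩
  | var i =>
    refine ⟨2, fun d env N _ h => ?_⟩
    rw [compile, Expr.cost, Expr.cost, Expr.eval, layout_var, Nat.size_zero]
    have h1 := (size_le_self _).trans (h i)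
    nlinarith
  | read a t ih =>
    obtain ⟨A, hA⟩ := t.exists_size_le
    obtain ⟨B, hB⟩ := ih
    refine ⟨A + B + 1, fun d env N h h' => ?_⟩
    rw [compile, Expr.cost, Tm.eval_compile, layout_data]
    have h1 := hA d env N h h'
    have h2 := hB d env N h h'
    have h3 := h a (t.eval d env)
    have h4 : A * (N + 1) ≤ A * (N + 1) ^ 2 := Nat.mul_le_mul_left _ (by nlinarith)
    nlinarith
  | op o t u iht ihu =>
    obtain ⟨A, hA⟩ := t.exists_size_le
    obtain ⟨B, hB⟩ := u.exists_size_le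
    obtain ⟨A', hA'⟩ := iht
    obtain ⟨B', hB'⟩ := ihu
    refine ⟨A' + B' + (A + 1) * (B + 1), fun d env N h h' => ?_⟩
    rw [compile, Expr.cost, Tm.eval_compile, Tm.eval_compile]
    have h1 := hA d env N h h'
    have h2 := hB d env N h h'
    have h3 := hA' d env N h h'
    have h4 := hB' d env N h h'
    have h5 : (Nat.size (t.eval d env) + 1) * (Nat.size (u.eval d env) + 1) ≤
        ((A + 1) * (N + 1)) * ((B + 1) * (N + 1)) :=
      Nat.mul_le_mul (by rw [add_mul]; omega) (by rw [add_mul]; omega)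
    calc _ ≤ A' * (N + 1) ^ 2 + B' * (N + 1) ^ 2 + ((A + 1) * (N + 1)) * ((B + 1) * (N + 1)) := by omega
      _ = _ := by ring

/-- Commands: addition to a cell, composition, and repetition, where the number of repetitions is
the entry with index `0` of the array `a`. -/
inductive Cmd : Type
  | add (a : ℕ) (i e : Tm)
  | seq (c c' : Cmd)
  | loop (a : ℕ) (c : Cmd)

/-- Iteration with decreasing counter. -/
def countDown {α : Type} (f : ℕ → α → α) : ℕ → α → α
  | 0, d => d
  | n + 1, d => countDown f n (f n d)

namespace Cmd

/-- The effect of a command on data; the loop variable of the outermost loop is `k`. -/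
def run : Cmd → ℕ → (ℕ → ℕ) → State → State
  | add a i e, _, env, d => d.set a (i.eval d env) (d a (i.eval d env) + e.eval d env)
  | seq c c', k, env, d => c'.run k env (c.run k env d)
  | loop a c, k, env, d =>
      countDown (fun x d => c.run (k + 1) (Function.update env k x) d) (d a 0) d

/-- Translation of a command. -/
def compile : Cmd → ℕ → Prog
  | add a i e, _ => .write (2 * a) i.compile (.op .add (.read (2 * a) i.compile) e.compile)
  | seq c c', k => .seq (c.compile k) (c'.compile k)
  | loop a c, k =>
      .seq (.write (2 * k + 3) (.const 0) (.read (2 * a) (.const 0)))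
        (.loop (.read (2 * k + 3) (.const 0))
          (.seq (.write (2 * k + 3) (.const 0)
            (.op .sub (.read (2 * k + 3) (.const 0)) (.const 1))) (c.compile (k + 1))))

/-- The arrays with the numbers of repetitions. -/
def bounds : Cmd → List ℕ
  | add _ _ _ => []
  | seq c c' => c.bounds ++ c'.bounds
  | loop a c => a :: c.bounds

/-- The arrays that are modified. -/
def writes : Cmd → List ℕ
  | add a _ _ => [a]
  | seq c c' => c.writes ++ c'.writes
  | loop _ c => c.writes

end Cmd

theorem le_countDown {f : ℕ → State → State} (hf : ∀ x d, d ≤ f x d) (n : ℕ) (d : State) :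
    d ≤ countDown f n d := by
  induction n generalizing d with
  | zero => exact le_rfl
  | succ n ih => exact (hf n d).trans (ih _)

/-- Commands only add to cells, so memory never decreases. For this reason bounds on the final state
alone control sizes and repetition counts throughout a run. -/
theorem Cmd.le_run (c : Cmd) (k : ℕ) (env : ℕ → ℕ) (d : State) : d ≤ c.run k env d := by
  induction c generalizing k env d with
  | add a i e =>
    intro b j
    rw [run, State.set]
    split_ifs with h
    · rw [h.1, h.2]
      exact Nat.le_add_right _ _
    · exact le_rfl
  | seq c c' ih ih' => exact (ih k env d).trans (ih' k env _)
  | loop a c ih => exact le_countDown (fun x d => ih _ _ d) _ _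

theorem Cmd.run_of_notMem (c : Cmd) (k : ℕ) (env : ℕ → ℕ) (d : State) {b : ℕ} (hb : b ∉ c.writes) :
    c.run k env d b = d b := by
  induction c generalizing k env d with
  | add a i e =>
    simp only [writes, List.mem_singleton] at hb
    ext j
    rw [run, State.set, if_neg (fun h => hb h.1)]
  | seq c c' ih ih' =>
    simp only [writes, List.mem_append, not_or] at hb
    rw [run, ih' _ _ _ hb.2, ih _ _ _ hb.1]
  | loop a c ih =>
    rw [run]
    generalize d a 0 = n
    induction n generalizing d with
    | zero => rfl
    | succ n ihn => rw [countDown, ihn, ih _ _ _ hb]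

theorem SizeLE.mono {d d' : State} {N : ℕ} (h : SizeLE d' N) (hd : d ≤ d') : SizeLE d N :=
  fun a i => (Nat.size_le_size (hd a i)).trans (h a i)

/-- A translated command has the effect of the command, in polynomial time. -/
theorem Cmd.exists_exec_compile (c : Cmd) : ∃ Q : Polynomial ℕ, ∀ (k : ℕ) (env : ℕ → ℕ) (d : State)
    (N : ℕ), (∀ j, k ≤ j → env j = 0) → (∀ j, env j ≤ N) → SizeLE (c.run k env d) N →
    (∀ b ∈ c.bounds, c.run k env d b 0 ≤ N) →
    ∃ T ≤ Q.eval N, Exec (c.compile k) (layout d env) (layout (c.run k env d) env) T := by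
  induction c with
  | add a i e =>
    obtain ⟨A, hA⟩ := i.exists_size_le
    obtain ⟨A', hA'⟩ := i.exists_cost_le
    obtain ⟨B', hB'⟩ := (Tm.op .add (.read a i) e).exists_cost_le
    refine ⟨(Polynomial.C A') * (Polynomial.X + 1) ^ 2 + Polynomial.C B' * (Polynomial.X + 1) ^ 2 +
      Polynomial.C A * (Polynomial.X + 1) + Polynomial.X + 1, fun k env d N _ he hN _ => ?_⟩
    have hd : SizeLE d N := hN.mono (le_run _ _ _ _)
    have h := Exec.write (layout d env) (2 * a) i.compile (.op .add (.read (2 * a) i.compile) e.compile)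
    have e2 : (Expr.op .add (.read (2 * a) i.compile) e.compile).eval (layout d env) =
        d a (i.eval d env) + e.eval d env := (Tm.op .add (.read a i) e).eval_compile d env
    rw [e2, i.eval_compile, layout_set_data] at h
    refine ⟨_, ?_, h⟩
    have h1 := hA d env N hd he
    have h2 := hA' d env N hd he
    have h3 := hB' d env N hd he
    have h4 := hN a (i.eval d env)
    rw [run, State.set, if_pos ⟨rfl, rfl⟩] at h4
    simp only [Polynomial.eval_add, Polynomial.eval_mul, Polynomial.eval_C, Polynomial.eval_pow,
      Polynomial.eval_X, Polynomial.eval_one]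
    exact Nat.add_le_add_right (Nat.add_le_add (Nat.add_le_add (Nat.add_le_add h2 h3) h1) h4) 1
  | seq c c' ih ih' =>
    obtain ⟨Q, hQ⟩ := ih
    obtain ⟨Q', hQ'⟩ := ih'
    refine ⟨Q + Q' + 1, fun k env d N h0 he hN hb => ?_⟩
    rw [run] at hN hb ⊢
    simp only [bounds, List.mem_append] at hb
    have hle := le_run c' k env (c.run k env d)
    obtain ⟨T, hT, hexec⟩ := hQ k env d N h0 he (hN.mono hle)
      (fun b hb' => (hle b 0).trans (hb b (.inl hb')))
    obtain ⟨T', hT', hexec'⟩ := hQ' k env _ N h0 he hN (fun b hb' => hb b (.inr hb'))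
    refine ⟨_, ?_, Exec.seq _ _ _ _ _ _ _ hexec hexec'⟩
    simp only [Polynomial.eval_add, Polynomial.eval_one]
    omega
  | loop a c ih =>
    obtain ⟨Q, hQ⟩ := ih
    refine ⟨Polynomial.X * (Q + 10 * Polynomial.X + 20) + 10 * Polynomial.X + 20,
      fun k env d N h0 he hN hb => ?_⟩
    rw [run] at hN hb ⊢
    simp only [bounds, List.mem_cons] at hb
    set f : ℕ → State → State := fun x d => c.run (k + 1) (Function.update env k x) d with hf
    have hfle : ∀ x d, d ≤ f x d := fun x d => le_run _ _ _ _
    have hupd : ∀ x, Function.update (Function.update env k x) k 0 = env := by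
      intro x
      rw [Function.update_idem, ← h0 k le_rfl, Function.update_eq_self]
    have hread : ∀ (d : State) x, (Expr.read (2 * k + 3) (.const 0)).eval
        (layout d (Function.update env k x)) = x := fun d x => by
      rw [Expr.eval, Expr.eval, layout_var, Function.update_self]
    have hcost : ∀ (d : State) x, (Expr.read (2 * k + 3) (.const 0)).cost
        (layout d (Function.update env k x)) = Nat.size x + 2 := fun d x => by
      rw [Expr.cost, Expr.cost, Expr.eval, layout_var, Function.update_self, Nat.size_zero]
      omega
    have main : ∀ n ≤ N, ∀ d, SizeLE (countDown f n d) N →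
        (∀ b ∈ c.bounds, countDown f n d b 0 ≤ N) →
        ∃ T ≤ n * (Q.eval N + 10 * N + 20) + 3,
          Exec (.loop (.read (2 * k + 3) (.const 0)) (.seq (.write (2 * k + 3) (.const 0)
            (.op .sub (.read (2 * k + 3) (.const 0)) (.const 1))) (c.compile (k + 1))))
            (layout d (Function.update env k n)) (layout (countDown f n d) env) T := by
      intro n
      induction n with
      | zero =>
        intro _ d _ _
        have h := Exec.loop_stop (.read (2 * k + 3) (.const 0)) (.seq (.write (2 * k + 3) (.const 0)
            (.op .sub (.read (2 * k + 3) (.const 0)) (.const 1))) (c.compile (k + 1)))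
            (layout d (Function.update env k 0)) (hread d 0)
        rw [hcost, Nat.size_zero] at h
        -- The counter ends at `0`, the value prescribed for inactive loop variables, so the layout
        -- returns to `env`.
        have e1 : Function.update env k 0 = env := by
          rw [← h0 k le_rfl, Function.update_eq_self]
        rw [e1] at h ⊢
        exact ⟨_, by omega, h⟩
      | succ n ihn =>
        intro hn d hsz hbd
        rw [countDown] at hsz hbd ⊢
        have hle := le_countDown hfle n (f n d)
        obtain ⟨T, hT, hexec⟩ := hQ (k + 1) (Function.update env k n) d N
          (fun j hj => by rw [Function.update_of_ne (by omega), h0 j (by omega)])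
          (fun j => by
            rw [Function.update_apply]
            split_ifs
            · omega
            · exact he j)
          (hsz.mono hle) (fun b hb' => (hle b 0).trans (hbd b hb'))
        obtain ⟨T', hT', hexec'⟩ := ihn (by omega) (f n d) hsz hbd
        have hw := Exec.write (layout d (Function.update env k (n + 1))) (2 * k + 3) (.const 0)
          (.op .sub (.read (2 * k + 3) (.const 0)) (.const 1))
        have e2 : (Expr.op .sub (.read (2 * k + 3) (.const 0)) (.const 1)).eval
            (layout d (Function.update env k (n + 1))) = n := by
          rw [Expr.eval, hread]
          rfl
        have e3 : (Expr.op .sub (.read (2 * k + 3) (.const 0)) (.const 1)).cost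
            (layout d (Function.update env k (n + 1))) ≤ 3 * N + 8 := by
          have e4 := (size_le_self (n + 1)).trans hn
          rw [Expr.cost, hcost, hread]
          have e5 : Nat.size 1 = 1 := Nat.size_one
          rw [Expr.cost, Expr.eval, e5]
          omega
        rw [e2, Expr.eval, layout_set_var, Function.update_idem] at hw
        refine ⟨_, ?_, Exec.loop_step _ _ _ _ _ _ _ (by rw [hread]; omega)
          (Exec.seq _ _ _ _ _ _ _ hw hexec) hexec'⟩
        have e6 := (size_le_self (n + 1)).trans hn
        have e7 := (size_le_self n).trans (Nat.le_of_succ_le hn)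
        rw [hcost, Expr.cost, Nat.size_zero, add_mul, one_mul]
        omega
    -- The number of repetitions is read before the loop, but by monotonicity the final content of
    -- the cell bounds it.
    have hda : d a 0 ≤ N := (le_countDown hfle _ d a 0).trans (hb a (.inl rfl))
    obtain ⟨T, hT, hexec⟩ := main (d a 0) hda d hN (fun b hb' => hb b (.inr hb'))
    have hw := Exec.write (layout d env) (2 * k + 3) (.const 0) (.read (2 * a) (.const 0))
    rw [Expr.eval, Expr.eval, Expr.eval, layout_data, layout_set_var] at hw
    refine ⟨_, ?_, Exec.seq _ _ _ _ _ _ _ hw hexec⟩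
    have e1 := (size_le_self _).trans hda
    have e2 : d a 0 * (Q.eval N + 10 * N + 20) ≤ N * (Q.eval N + 10 * N + 20) :=
      Nat.mul_le_mul_right _ hda
    have e10 : (10 : Polynomial ℕ).eval N = 10 := by simp
    have e20 : (20 : Polynomial ℕ).eval N = 20 := by simp
    simp only [Polynomial.eval_add, Polynomial.eval_mul, Polynomial.eval_X, e10, e20]
    simp only [Expr.cost, Expr.eval, layout_data, Nat.size_zero]
    omega

end RAM

/-! ### Nested loops and polynomial growth -/

namespace RAM

namespace Tm

instance : Add Tm := ⟨op .add⟩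
instance : Sub Tm := ⟨op .sub⟩
instance : Mul Tm := ⟨op .mul⟩
instance : Mod Tm := ⟨op .mod⟩

variable (d : State) (env : ℕ → ℕ) (t u : Tm)

@[simp] theorem eval_add : (t + u).eval d env = t.eval d env + u.eval d env := rfl
@[simp] theorem eval_sub : (t - u).eval d env = t.eval d env - u.eval d env := rfl
@[simp] theorem eval_mul : (t * u).eval d env = t.eval d env * u.eval d env := rfl
@[simp] theorem eval_mod : (t % u).eval d env = t.eval d env % u.eval d env := rfl
@[simp] theorem eval_const (v : ℕ) : (const v).eval d env = v := rfl
@[simp] theorem eval_var (i : ℕ) : (var i).eval d env = env i := rfl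
@[simp] theorem eval_read (a : ℕ) : (read a t).eval d env = d a (t.eval d env) := rfl

@[simp] theorem avoids_add (a : ℕ) : (t + u).Avoids a ↔ t.Avoids a ∧ u.Avoids a := Iff.rfl
@[simp] theorem avoids_sub (a : ℕ) : (t - u).Avoids a ↔ t.Avoids a ∧ u.Avoids a := Iff.rfl
@[simp] theorem avoids_mul (a : ℕ) : (t * u).Avoids a ↔ t.Avoids a ∧ u.Avoids a := Iff.rfl
@[simp] theorem avoids_mod (a : ℕ) : (t % u).Avoids a ↔ t.Avoids a ∧ u.Avoids a := Iff.rfl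
@[simp] theorem avoids_const (a v : ℕ) : (const v).Avoids a := trivial
@[simp] theorem avoids_var (a i : ℕ) : (var i).Avoids a := trivial
@[simp] theorem avoids_read (a b : ℕ) : (read b t).Avoids a ↔ b ≠ a ∧ t.Avoids a := Iff.rfl

end Tm

/-- An injective polynomial code for pairs. -/
def pairCode (x y : ℕ) : ℕ := (x + y) * (x + y) + x

-- The code lies in the interval from `(x+y)²` to `(x+y)² + x + y`, and these intervals are disjoint
-- for different values of `x + y`.
@[simp] theorem pairCode_inj {x y x' y' : ℕ} : pairCode x y = pairCode x' y' ↔ x = x' ∧ y = y' := by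
  constructor
  · intro h
    unfold pairCode at h
    have h1 : x + y = x' + y' := by
      rcases lt_trichotomy (x + y) (x' + y') with h2 | h2 | h2
      · nlinarith
      · exact h2
      · nlinarith
    rw [h1] at h
    omega
  · rintro ⟨rfl, rfl⟩
    rfl

/-- The code of a pair as a term. -/
def Tm.pair (t u : Tm) : Tm := (t + u) * (t + u) + t

@[simp] theorem Tm.eval_pair (d : State) (env : ℕ → ℕ) (t u : Tm) :
    (Tm.pair t u).eval d env = pairCode (t.eval d env) (u.eval d env) := rfl

@[simp] theorem Tm.avoids_pair (a : ℕ) (t u : Tm) :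
    (Tm.pair t u).Avoids a ↔ t.Avoids a ∧ u.Avoids a := by
  simp only [pair, avoids_add, avoids_mul]
  tauto

/-- Nested loops around an addition to a cell. -/
def Cmd.nest : List ℕ → ℕ → Tm → Tm → Cmd
  | [], a, i, e => .add a i e
  | b :: bs, a, i, e => .loop b (nest bs a i e)

/-- The sum of the numbers that nested loops add to the cell `c`. -/
def nestSum (d : State) (i e : Tm) (c : ℕ) : List ℕ → ℕ → (ℕ → ℕ) → ℕ
  | [], _, env => if i.eval d env = c then e.eval d env else 0
  | b :: bs, k, env =>
      ∑ x ∈ Finset.range (d b 0), nestSum d i e c bs (k + 1) (Function.update env k x)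

theorem Cmd.bounds_nest (bs : List ℕ) (a : ℕ) (i e : Tm) : (nest bs a i e).bounds = bs := by
  induction bs with
  | nil => rfl
  | cons b bs ih => rw [nest, bounds, ih]

theorem Cmd.writes_nest (bs : List ℕ) (a : ℕ) (i e : Tm) : (nest bs a i e).writes = [a] := by
  induction bs with
  | nil => rfl
  | cons b bs ih => rw [nest, writes, ih]

theorem nestSum_congr {a : ℕ} {d d' : State} (h : ∀ b, b ≠ a → d b = d' b) {i e : Tm}
    (hi : i.Avoids a) (he : e.Avoids a) (c : ℕ) {bs : List ℕ} (hbs : a ∉ bs) (k : ℕ) (env : ℕ → ℕ) :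
    nestSum d i e c bs k env = nestSum d' i e c bs k env := by
  induction bs generalizing k env with
  | nil => rw [nestSum, nestSum, i.eval_congr h env hi, e.eval_congr h env he]
  | cons b bs ih =>
    simp only [List.mem_cons, not_or] at hbs
    rw [nestSum, nestSum, h b (Ne.symm hbs.1)]
    exact Finset.sum_congr rfl fun x _ => ih hbs.2 _ _

/-- The effect of nested loops around an addition. -/
theorem Cmd.run_nest_apply {a : ℕ} {i e : Tm} (hi : i.Avoids a) (he : e.Avoids a) {bs : List ℕ}
    (hbs : a ∉ bs) (k : ℕ) (env : ℕ → ℕ) (d : State) (c : ℕ) :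
    (nest bs a i e).run k env d a c = d a c + nestSum d i e c bs k env := by
  induction bs generalizing k env d with
  | nil =>
    rw [nest, run, State.set, nestSum]
    by_cases h : i.eval d env = c
    · rw [if_pos ⟨rfl, h.symm⟩, if_pos h, h]
    · rw [if_neg (fun h' => h h'.2.symm), if_neg h, add_zero]
  | cons b bs ih =>
    simp only [List.mem_cons, not_or] at hbs
    rw [nest, run, nestSum]
    -- The loops change only the array `a`, which neither terms nor bounds read. Every summand can
    -- hence be evaluated in the initial state, whatever the order of the iterations.
    have key : ∀ n d', (∀ b, b ≠ a → d' b = d b) →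
        countDown (fun x d => (nest bs a i e).run (k + 1) (Function.update env k x) d) n d' a c =
          d' a c + ∑ x ∈ Finset.range n, nestSum d i e c bs (k + 1) (Function.update env k x) := by
      intro n
      induction n with
      | zero => intro d' _; simp [countDown]
      | succ n ihn =>
        intro d' hd'
        rw [countDown, ihn, ih hbs.2, Finset.sum_range_succ, nestSum_congr hd' hi he c hbs.2]
        · ring
        · intro b' hb'
          rw [run_of_notMem, hd' b' hb']
          rw [writes_nest]
          simpa using hb'
    exact key _ d fun _ _ => rfl

theorem nestSum_le {d : State} {i e : Tm} (c : ℕ) {bs : List ℕ} {k N V : ℕ} {env : ℕ → ℕ}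
    (henv : ∀ j, env j ≤ N) (hbs : ∀ b ∈ bs, d b 0 ≤ N)
    (hV : ∀ env : ℕ → ℕ, (∀ j, env j ≤ N) → e.eval d env ≤ V) :
    nestSum d i e c bs k env ≤ N ^ bs.length * V := by
  induction bs generalizing k env with
  | nil =>
    rw [nestSum]
    split_ifs
    · simpa using hV env henv
    · exact Nat.zero_le _
  | cons b bs ih =>
    rw [nestSum]
    have h1 : ∀ x ∈ Finset.range (d b 0), nestSum d i e c bs (k + 1) (Function.update env k x) ≤
        N ^ bs.length * V := by
      intro x hx
      refine ih (fun j => ?_) (fun b' hb' => hbs b' (List.mem_cons_of_mem _ hb'))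
      rw [Function.update_apply]
      split_ifs
      · exact (Finset.mem_range.1 hx).le.trans (hbs b List.mem_cons_self)
      · exact henv j
    refine (Finset.sum_le_card_nsmul _ _ _ h1).trans ?_
    rw [Finset.card_range, smul_eq_mul, List.length_cons, pow_succ', mul_assoc]
    exact Nat.mul_le_mul_right _ (hbs b List.mem_cons_self)

/-- The command increases the sizes at most linearly. -/
def Cmd.Grows (c : Cmd) : Prop := ∃ A : ℕ, ∀ (k : ℕ) (env : ℕ → ℕ) (d : State) (N : ℕ), SizeLE d N →
  (∀ j, env j ≤ N) → (∀ b ∈ c.bounds, d b 0 ≤ N) → SizeLE (c.run k env d) (A * (N + 1))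

/-- At most `N^(length)` numbers of linear bit length are added to a cell; the number of summands
adds only `O(N)` bits. -/
theorem Cmd.grows_nest {a : ℕ} {i e : Tm} (hi : i.Avoids a) (he : e.Avoids a) {bs : List ℕ}
    (hbs : a ∉ bs) : (nest bs a i e).Grows := by
  obtain ⟨A, hA⟩ := e.exists_size_le
  refine ⟨A + bs.length + 2, fun k env d N hd henv hb => ?_⟩
  rw [bounds_nest] at hb
  intro b c
  by_cases hba : b = a
  · subst hba
    rw [run_nest_apply hi he hbs, Nat.size_le]
    have h1 := nestSum_le (d := d) (i := i) (e := e) c (k := k) henv hb (V := 2 ^ (A * (N + 1)))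
      (fun env' h => (Nat.size_le.1 (hA d env' N hd h)).le)
    have h2 : d b c < 2 ^ N := Nat.size_le.1 (hd b c)
    have h3 : N ^ bs.length * 2 ^ (A * (N + 1)) ≤ 2 ^ ((A + bs.length) * (N + 1)) := by
      calc N ^ bs.length * 2 ^ (A * (N + 1)) ≤ (2 ^ N) ^ bs.length * 2 ^ (A * (N + 1)) :=
            Nat.mul_le_mul_right _ (Nat.pow_le_pow_left Nat.lt_two_pow_self.le _)
        _ = 2 ^ (N * bs.length + A * (N + 1)) := by rw [← pow_mul, ← pow_add]
        _ ≤ _ := Nat.pow_le_pow_right (by norm_num) (by nlinarith)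
    have h4 : 2 ^ N ≤ 2 ^ ((A + bs.length + 1) * (N + 1)) :=
      Nat.pow_le_pow_right (by norm_num) (by nlinarith [Nat.zero_le (A + bs.length), Nat.zero_le N])
    have h5 : 2 ^ ((A + bs.length) * (N + 1)) ≤ 2 ^ ((A + bs.length + 1) * (N + 1)) :=
      Nat.pow_le_pow_right (by norm_num) (by nlinarith)
    have h6 : 2 ^ ((A + bs.length + 1) * (N + 1) + 1) ≤ 2 ^ ((A + bs.length + 2) * (N + 1)) :=
      Nat.pow_le_pow_right (by norm_num) (by nlinarith)
    rw [pow_succ] at h6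
    omega
  · rw [run_of_notMem _ _ _ _ (by rw [writes_nest]; simpa using hba)]
    exact (hd b c).trans (by nlinarith [Nat.zero_le (A + bs.length), Nat.zero_le N])

/-- `hd` keeps the repetition counts of the second command at their initial values: growth is
measured in bit length, which would not bound a count. -/
theorem Cmd.Grows.seq {c c' : Cmd} (h : c.Grows) (h' : c'.Grows)
    (hd : ∀ b ∈ c'.bounds, b ∉ c.writes) : (Cmd.seq c c').Grows := by
  obtain ⟨A, hA⟩ := h
  obtain ⟨B, hB⟩ := h'
  refine ⟨B * (A + 2), fun k env d N hN henv hb => ?_⟩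
  simp only [bounds, List.mem_append] at hb
  rw [run]
  have h1 := hA k env d N hN henv fun b hb' => hb b (.inl hb')
  have h2 := hB k env (c.run k env d) ((A + 1) * (N + 1))
    (fun a i => (h1 a i).trans (Nat.mul_le_mul_right _ (by omega)))
    (fun j => (henv j).trans (by nlinarith))
    (fun b hb' => by
      rw [run_of_notMem _ _ _ _ (hd b hb')]
      exact (hb b (.inr hb')).trans (by nlinarith))
  refine fun a i => (h2 a i).trans ?_
  rw [mul_assoc]
  exact Nat.mul_le_mul_left _ (by nlinarith)

/-- Iterating a linear bound multiplies it by a constant each time, so the loop costs a factor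
exponential in the number of repetitions. -/
theorem Cmd.Grows.exists_sizeLE_loop {c : Cmd} (h : c.Grows) (hd : ∀ b ∈ c.bounds, b ∉ c.writes) :
    ∃ A : ℕ, ∀ (a k : ℕ) (env : ℕ → ℕ) (d : State) (N : ℕ), SizeLE d N → (∀ j, env j ≤ N) →
      d a 0 ≤ N → (∀ b ∈ c.bounds, d b 0 ≤ N) →
      SizeLE ((Cmd.loop a c).run k env d) (A ^ d a 0 * (N + 1)) := by
  obtain ⟨A, hA⟩ := h
  refine ⟨A + 2, fun a k env d N hN henv ha hb => ?_⟩
  rw [run]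
  -- The size bound `N'` grows with the iterations, while the repetition counts stay below the fixed
  -- `N`.
  have key : ∀ n ≤ N, ∀ (d : State) (N' : ℕ), N ≤ N' → SizeLE d N' → (∀ b ∈ c.bounds, d b 0 ≤ N) →
      SizeLE (countDown (fun x d => c.run (k + 1) (Function.update env k x) d) n d)
        ((A + 2) ^ n * (N' + 1)) := by
    intro n
    induction n with
    | zero => intro _ d N' _ h _ a i; simpa [countDown] using (h a i).trans (Nat.le_succ _)
    | succ n ih =>
      intro hn d N' hN' h hb
      rw [countDown]
      have h1 := hA (k + 1) (Function.update env k n) d N' h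
        (fun j => by
          rw [Function.update_apply]
          split_ifs
          · omega
          · exact (henv j).trans hN')
        (fun b hb' => (hb b hb').trans hN')
      have h2 := ih (by omega) _ ((A + 1) * (N' + 1)) (by nlinarith)
        (fun a i => (h1 a i).trans (Nat.mul_le_mul_right _ (by omega)))
        (fun b hb' => by rw [run_of_notMem _ _ _ _ (hd b hb')]; exact hb b hb')
      refine fun a i => (h2 a i).trans ?_
      rw [pow_succ, mul_assoc]
      exact Nat.mul_le_mul_left _ (by nlinarith)
  exact key _ ha d N le_rfl hN hb

/-! ### Polynomial bounds for families -/

section Families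

variable {ι : Type} (sz : ι → ℕ)

/-- The function is bounded by a polynomial in the size. -/
def PolyBdd (f : ι → ℕ) : Prop := ∃ q : Polynomial ℕ, ∀ x, f x ≤ q.eval (sz x)

variable {sz}

theorem PolyBdd.mono {f g : ι → ℕ} (hg : PolyBdd sz g) (h : ∀ x, f x ≤ g x) : PolyBdd sz f := by
  obtain ⟨q, hq⟩ := hg
  exact ⟨q, fun x => (h x).trans (hq x)⟩

theorem PolyBdd.const (c : ℕ) : PolyBdd sz fun _ => c := ⟨Polynomial.C c, fun x => by simp⟩

theorem PolyBdd.size : PolyBdd sz sz := ⟨Polynomial.X, fun x => by simp⟩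

theorem PolyBdd.add {f g : ι → ℕ} (hf : PolyBdd sz f) (hg : PolyBdd sz g) :
    PolyBdd sz fun x => f x + g x := by
  obtain ⟨p, hp⟩ := hf
  obtain ⟨q, hq⟩ := hg
  exact ⟨p + q, fun x => by rw [Polynomial.eval_add]; exact add_le_add (hp x) (hq x)⟩

theorem PolyBdd.mul {f g : ι → ℕ} (hf : PolyBdd sz f) (hg : PolyBdd sz g) :
    PolyBdd sz fun x => f x * g x := by
  obtain ⟨p, hp⟩ := hf
  obtain ⟨q, hq⟩ := hg
  exact ⟨p * q, fun x => by rw [Polynomial.eval_mul]; exact Nat.mul_le_mul (hp x) (hq x)⟩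

theorem PolyBdd.pow {f : ι → ℕ} (hf : PolyBdd sz f) (r : ℕ) : PolyBdd sz fun x => f x ^ r := by
  obtain ⟨p, hp⟩ := hf
  exact ⟨p ^ r, fun x => by rw [Polynomial.eval_pow]; exact Nat.pow_le_pow_left (hp x) r⟩

theorem PolyBdd.sum {α : Type*} {s : List α} {f : α → ι → ℕ} (hf : ∀ a ∈ s, PolyBdd sz (f a)) :
    PolyBdd sz fun x => (s.map fun a => f a x).sum := by
  induction s with
  | nil => exact PolyBdd.const 0
  | cons a s ih =>
    simp only [List.map_cons, List.sum_cons]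
    exact (hf a List.mem_cons_self).add (ih fun b hb => hf b (List.mem_cons_of_mem _ hb))

/-- The power `2^(size f)` is at most `2f + 1`, so an exponential of a binary length is polynomial.
-/
theorem PolyBdd.pow_size {f : ι → ℕ} (hf : PolyBdd sz f) (A r : ℕ) :
    PolyBdd sz fun x => A ^ (r * Nat.size (f x) + 1) := by
  refine PolyBdd.mono (((((PolyBdd.const 2).mul hf).add (PolyBdd.const 1)).pow (A * r)).mul
    (PolyBdd.const A)) fun x => ?_
  rw [pow_succ]
  refine Nat.mul_le_mul_right _ ?_
  have h1 : 2 ^ Nat.size (f x) ≤ 2 * f x + 1 := by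
    rcases Nat.eq_zero_or_pos (f x) with h | h
    · simp [h]
    · have h2 : 2 ^ (Nat.size (f x) - 1) ≤ f x := Nat.lt_size.1 (by have := Nat.size_pos.2 h; omega)
      have h3 : Nat.size (f x) = Nat.size (f x) - 1 + 1 := by have := Nat.size_pos.2 h; omega
      rw [h3, pow_succ]
      omega
  calc A ^ (r * Nat.size (f x)) ≤ (2 ^ A) ^ (r * Nat.size (f x)) :=
        Nat.pow_le_pow_left Nat.lt_two_pow_self.le _
    _ = (2 ^ Nat.size (f x)) ^ (A * r) := by rw [← pow_mul, ← pow_mul]; congr 1; ring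
    _ ≤ _ := Nat.pow_le_pow_left h1 _

/-- The sizes of all cells are polynomially bounded. -/
def Small (sz : ι → ℕ) (D : ι → State) : Prop := ∃ f, PolyBdd sz f ∧ ∀ x, SizeLE (D x) (f x)

/-- The command runs in polynomial time on a family of data. -/
def Cmd.PolyRun (sz : ι → ℕ) (c : Cmd) (D : ι → State) : Prop :=
  Small sz (fun x => c.run 0 0 (D x)) ∧ ∀ b ∈ c.bounds, PolyBdd sz fun x => c.run 0 0 (D x) b 0

theorem PolyBdd.of_list {s : List ℕ} {f : ℕ → ι → ℕ} (hf : ∀ a ∈ s, PolyBdd sz (f a)) :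
    ∃ g, PolyBdd sz g ∧ ∀ a ∈ s, ∀ x, f a x ≤ g x :=
  ⟨_, PolyBdd.sum hf, fun _ ha x =>
    List.single_le_sum (fun _ _ => Nat.zero_le _) _ (List.mem_map_of_mem (f := fun a => f a x) ha)⟩

theorem Cmd.Grows.polyRun {c : Cmd} (h : c.Grows) {D : ι → State} (hD : Small sz D)
    (hb : ∀ b ∈ c.bounds, PolyBdd sz fun x => D x b 0) (hd : ∀ b ∈ c.bounds, b ∉ c.writes) :
    c.PolyRun sz D := by
  obtain ⟨A, hA⟩ := h
  obtain ⟨f, hf, hDf⟩ := hD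
  obtain ⟨g, hg, hbg⟩ := PolyBdd.of_list hb
  refine ⟨⟨_, (PolyBdd.const A).mul ((hf.add hg).add (PolyBdd.const 1)), fun x =>
    hA 0 0 (D x) (f x + g x) (fun a i => (hDf x a i).trans (by omega)) (fun _ => Nat.zero_le _)
      fun b hb' => (hbg b hb' x).trans (by omega)⟩, fun b hb' => ?_⟩
  refine (hb b hb').mono fun x => ?_
  rw [run_of_notMem _ _ _ _ (hd b hb')]

/-- Repetition counts are measured in the final state, so the second command must not alter those of
the first. -/
theorem Cmd.PolyRun.seq {c c' : Cmd} {D : ι → State} (h : c.PolyRun sz D)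
    (h' : c'.PolyRun sz fun x => c.run 0 0 (D x)) (hd : ∀ b ∈ c.bounds, b ∉ c'.writes) :
    (Cmd.seq c c').PolyRun sz D := by
  refine ⟨h'.1, fun b hb => ?_⟩
  simp only [bounds, List.mem_append] at hb
  rcases hb with hb | hb
  · refine (h.2 b hb).mono fun x => ?_
    rw [run, run_of_notMem _ _ _ _ (hd b hb)]
  · exact h'.2 b hb

theorem Cmd.polyRun_nest {a : ℕ} {i e : Tm} {bs : List ℕ} {D : ι → State} (hD : Small sz D)
    (hb : ∀ b ∈ bs, PolyBdd sz fun x => D x b 0) (hi : i.Avoids a) (he : e.Avoids a)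
    (hbs : a ∉ bs) : (nest bs a i e).PolyRun sz D := by
  refine (grows_nest hi he hbs).polyRun hD (by rwa [bounds_nest]) ?_
  rw [bounds_nest, writes_nest]
  intro b hb'
  simp only [List.mem_singleton]
  rintro rfl
  exact hbs hb'

/-- `hpow` expresses that the number of repetitions is logarithmic, which tames the exponential
factor of the preceding growth bound. -/
theorem Cmd.Grows.polyRun_loop {c : Cmd} (h : c.Grows) {a : ℕ} {D : ι → State} (hD : Small sz D)
    (ha : PolyBdd sz fun x => D x a 0) (hpow : ∀ A : ℕ, PolyBdd sz fun x => A ^ D x a 0)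
    (hb : ∀ b ∈ c.bounds, PolyBdd sz fun x => D x b 0)
    (hd : ∀ b ∈ c.bounds, b ∉ c.writes) (hac : a ∉ c.writes) : (Cmd.loop a c).PolyRun sz D := by
  obtain ⟨A, hA⟩ := h.exists_sizeLE_loop hd
  obtain ⟨f, hf, hDf⟩ := hD
  obtain ⟨g, hg, hbg⟩ := PolyBdd.of_list hb
  refine ⟨⟨_, (hpow A).mul (((hf.add hg).add ha).add (PolyBdd.const 1)), fun x =>
    hA a 0 0 (D x) (f x + g x + D x a 0) (fun a i => (hDf x a i).trans (by omega))
      (fun _ => Nat.zero_le _) (by omega)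
      fun b hb' => (hbg b hb' x).trans (by omega)⟩, fun b hb' => ?_⟩
  simp only [bounds, List.mem_cons] at hb'
  have hbw : b ∉ (Cmd.loop a c).writes := by
    rw [writes]
    rcases hb' with rfl | hb'
    · exact hac
    · exact hd b hb'
  have hbD : PolyBdd sz fun x => D x b 0 := by
    rcases hb' with rfl | hb'
    · exact ha
    · exact hb b hb'
  refine hbD.mono fun x => ?_
  rw [run_of_notMem _ _ _ _ hbw]

/-- A command that runs in polynomial time gives a program that runs in polynomial time. -/
theorem Cmd.PolyRun.exists_outputsInTime {c : Cmd} {D : ι → State} (h : c.PolyRun sz D) (e : Tm)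
    (input : ι → List ℕ) (hD : ∀ x, D x = init (input x)) :
    ∃ (p : Prog) (q : Polynomial ℕ), ∀ x,
      OutputsInTime p (input x) (e.eval (c.run 0 0 (D x)) 0) (q.eval (sz x)) := by
  obtain ⟨Q, hQ⟩ := c.exists_exec_compile
  obtain ⟨A, hA⟩ := e.exists_cost_le
  obtain ⟨B, hB⟩ := e.exists_size_le
  obtain ⟨⟨f, ⟨p, hp⟩, hDf⟩, hb⟩ := h
  obtain ⟨g, ⟨q, hq⟩, hbg⟩ := PolyBdd.of_list hb
  refine ⟨.seq (c.compile 0) (.write 1 (.const 0) e.compile),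
    Q.comp (p + q) + Polynomial.C A * (p + q + 1) ^ 2 + Polynomial.C B * (p + q + 1) + 4, fun x => ?_⟩
  set N := p.eval (sz x) + q.eval (sz x) with hN
  have hsize : SizeLE (c.run 0 0 (D x)) N := fun a i => (hDf x a i).trans ((hp x).trans (by omega))
  obtain ⟨T, hT, hexec⟩ := hQ 0 0 (D x) N (fun _ _ => rfl) (fun _ => Nat.zero_le _) hsize
    (fun b hb' => (hbg b hb' x).trans ((hq x).trans (by omega)))
  -- Data array `0` and machine array `0` coincide, and everything else is zero in both memories.
  have hinit : layout (D x) 0 = init (input x) := by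
    funext a i
    rw [hD, layout, init, init]
    by_cases h1 : a % 2 = 0
    · rw [if_pos h1]
      refine if_congr ?_ rfl rfl
      omega
    · rw [if_neg h1, if_neg (show a ≠ 0 by rintro rfl; exact h1 rfl)]
      split_ifs <;> rfl
  rw [hinit] at hexec
  -- Machine array `1` is used neither by data (even names) nor by loop variables (odd names from
  -- `3` on), so it is free for the output.
  have hw := Exec.write (layout (c.run 0 0 (D x)) 0) 1 (.const 0) e.compile
  refine ⟨_, _, Exec.seq _ _ _ _ _ _ _ hexec hw, ?_, ?_⟩
  · have h1 := hA (c.run 0 0 (D x)) 0 N hsize (fun _ => Nat.zero_le _)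
    have h2 := hB (c.run 0 0 (D x)) 0 N hsize (fun _ => Nat.zero_le _)
    have e4 : (4 : Polynomial ℕ).eval (sz x) = 4 := by simp
    simp only [Polynomial.eval_add, Polynomial.eval_mul, Polynomial.eval_pow, Polynomial.eval_C,
      Polynomial.eval_one, Polynomial.eval_comp, e4, ← hN]
    rw [Tm.eval_compile]
    simp only [Expr.cost, Expr.eval, Nat.size_zero]
    omega
  · rw [State.set, Expr.eval, if_pos ⟨rfl, rfl⟩, Tm.eval_compile]

end Families

end RAM

/-! ### Signed matrices and matrix powers -/

namespace RAM

/-- The entry of a table of signed numbers: a difference of two natural numbers. -/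
def signedEntry (f : ℕ → ℕ) (i j : ℕ) : ℤ :=
  (f (pairCode 0 (pairCode i j)) : ℤ) - f (pairCode 1 (pairCode i j))

/-- The matrix of a table of signed numbers. -/
def signedMatrix (f : ℕ → ℕ) (D : ℕ) : Matrix (Fin D) (Fin D) ℤ :=
  Matrix.of fun i j => signedEntry f i j

theorem sum_product_at {D i j : ℕ} (hi : i < D) (hj : j < D) (p : ℕ → ℕ → ℕ → ℕ → ℕ → ℕ) (s : ℕ) :
    ∑ i' ∈ Finset.range D, ∑ j' ∈ Finset.range D, ∑ l ∈ Finset.range D,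
      ∑ s₁ ∈ Finset.range 2, ∑ s₂ ∈ Finset.range 2,
        (if (s₁ + s₂) % 2 = s ∧ i' = i ∧ j' = j then p s₁ s₂ i' j' l else 0) =
      ∑ l ∈ Finset.range D, ∑ s₁ ∈ Finset.range 2, ∑ s₂ ∈ Finset.range 2,
        if (s₁ + s₂) % 2 = s then p s₁ s₂ i j l else 0 := by
  rw [Finset.sum_eq_single i, Finset.sum_eq_single j]
  · simp
  · intro j' _ hj'
    simp [hj']
  · intro h
    exact absurd (Finset.mem_range.2 hj) h
  · intro i' _ hi'
    simp [hi']
  · intro h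
    exact absurd (Finset.mem_range.2 hi) h

/-- Expanding `(p₀ - p₁)(q₀ - q₁)`, the products with even index sum form the positive part and
those with odd index sum the negative part. -/
theorem signed_product (D : ℕ) (p q : ℕ → ℕ → ℕ) (Y : ℕ) :
    ((∑ l ∈ Finset.range D, ∑ s₁ ∈ Finset.range 2, ∑ s₂ ∈ Finset.range 2,
        (if (s₁ + s₂) % 2 = 0 then p s₁ l * q s₂ l * Y else 0) : ℕ) : ℤ) -
      ((∑ l ∈ Finset.range D, ∑ s₁ ∈ Finset.range 2, ∑ s₂ ∈ Finset.range 2,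
        if (s₁ + s₂) % 2 = 1 then p s₁ l * q s₂ l * Y else 0 : ℕ) : ℤ) =
      Y * ∑ l : Fin D, ((p 0 l : ℤ) - p 1 l) * ((q 0 l : ℤ) - q 1 l) := by
  rw [Finset.sum_fin_eq_sum_range, Nat.cast_sum, Nat.cast_sum, ← Finset.sum_sub_distrib, Finset.mul_sum]
  refine Finset.sum_congr rfl fun l hl => ?_
  rw [dif_pos (Finset.mem_range.1 hl)]
  simp [Finset.sum_range_succ]
  ring

/-- One step of the computation of a power of a matrix. -/
def Cmd.matPowStep (b M T W : ℕ) : Cmd :=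
  .seq
    (nest [b, b, b, 5, 5] W (.pair (.var 0) (.pair ((.var 4 + .var 5) % .const 2) (.pair (.var 1) (.var 2))))
      (.read T (.pair (.var 0 + .const 1) (.pair (.var 4) (.pair (.var 1) (.var 3)))) *
        .read M (.pair (.var 5) (.pair (.var 3) (.var 2))) * .const 1))
    (nest [5, b, b] T (.pair (.var 0) (.pair (.var 1) (.pair (.var 2) (.var 3))))
      (.read W (.pair (.var 0) (.pair (.var 1) (.pair (.var 2) (.var 3))))))

/-- Computation of a power of a matrix: the dimension is in register `b`, the exponent in register
`3`, the matrix in the table `M`, and the power is stored at index `0` of the table `T`. -/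
def Cmd.matPow (b M T W : ℕ) : Cmd :=
  .seq (nest [b] T (.pair (.read 3 (.const 0)) (.pair (.const 0) (.pair (.var 0) (.var 0)))) (.const 1))
    (.loop 3 (matPowStep b M T W))

/-- Cells can only be increased, so each step writes to a fresh layer: layer `x` receives the
product of layer `x + 1` with the matrix. The detour through `W` is needed because a nest must not
read the array it writes. -/
theorem Cmd.run_matPowStep {b M T W x D : ℕ} {d : State} (hT : 5 < T) (hW : 5 < W) (hTW : T ≠ W)
    (hMT : M ≠ T) (hMW : M ≠ W) (hbT : b ≠ T) (hbW : b ≠ W) (h5 : d 5 0 = 2) (hb : d b 0 = D)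
    (h0 : ∀ y ≤ x, ∀ c, d T (pairCode y c) = 0 ∧ d W (pairCode y c) = 0) :
    signedMatrix (fun c => (matPowStep b M T W).run 1 (Function.update 0 0 x) d T (pairCode x c)) D =
        signedMatrix (fun c => d T (pairCode (x + 1) c)) D * signedMatrix (d M) D ∧
      ∀ y < x, ∀ c, (matPowStep b M T W).run 1 (Function.update 0 0 x) d T (pairCode y c) = 0 ∧
        (matPowStep b M T W).run 1 (Function.update 0 0 x) d W (pairCode y c) = 0 := by
  rw [matPowStep, run]
  set d1 := (nest [b, b, b, 5, 5] W (.pair (.var 0) (.pair ((.var 4 + .var 5) % .const 2)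
    (.pair (.var 1) (.var 2)))) (.read T (.pair (.var 0 + .const 1) (.pair (.var 4) (.pair (.var 1) (.var 3)))) *
        .read M (.pair (.var 5) (.pair (.var 3) (.var 2))) * .const 1)).run 1 (Function.update 0 0 x) d with hd1
  have hd1' : ∀ a, a ≠ W → d1 a = d a := fun a ha => by
    rw [hd1, run_of_notMem]
    rw [writes_nest]
    simpa using ha
  have hd1W : ∀ y ≤ x, ∀ c, d1 W (pairCode y c) = if y = x then
      ∑ i ∈ Finset.range D, ∑ j ∈ Finset.range D, ∑ l ∈ Finset.range D,
        ∑ s₁ ∈ Finset.range 2, ∑ s₂ ∈ Finset.range 2,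
          (if pairCode ((s₁ + s₂) % 2) (pairCode i j) = c then
            d T (pairCode (x + 1) (pairCode s₁ (pairCode i l))) *
              d M (pairCode s₂ (pairCode l j)) * 1 else 0) else 0 := by
    intro y hy c
    rw [hd1, run_nest_apply (by simp) (by simp; omega) (by simp; omega), (h0 y hy c).2, zero_add]
    simp only [nestSum, Tm.eval_pair, Tm.eval_add, Tm.eval_mod, Tm.eval_mul, Tm.eval_read, Tm.eval_var,
      Tm.eval_const, Function.update_apply, hb, h5, pairCode_inj]
    by_cases hyx : y = x
    · simp [hyx]
    · simp [hyx, Ne.symm hyx]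
  have hrun : ∀ y ≤ x, ∀ c, (nest [5, b, b] T (.pair (.var 0) (.pair (.var 1) (.pair (.var 2) (.var 3))))
      (.read W (.pair (.var 0) (.pair (.var 1) (.pair (.var 2) (.var 3)))))).run 1
        (Function.update 0 0 x) d1 T (pairCode y c) = if y = x then
      ∑ s ∈ Finset.range 2, ∑ i ∈ Finset.range D, ∑ j ∈ Finset.range D,
        (if pairCode s (pairCode i j) = c then d1 W (pairCode x c) else 0) else 0 := by
    intro y hy c
    rw [run_nest_apply (by simp) (by simp; omega) (by simp; omega), hd1' T hTW, (h0 y hy c).1, zero_add]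
    simp only [nestSum, Tm.eval_pair, Tm.eval_read, Tm.eval_var, Function.update_apply, hd1' 5 (by omega),
      hd1' b hbW, hb, h5, pairCode_inj]
    by_cases hyx : y = x
    · simp [hyx]
      refine Finset.sum_congr rfl fun s _ => Finset.sum_congr rfl fun i _ =>
        Finset.sum_congr rfl fun j _ => ?_
      split_ifs with h
      · rw [h]
      · rfl
    · simp [hyx, Ne.symm hyx]
  refine ⟨?_, fun y hy c => ⟨?_, ?_⟩⟩
  · ext i j
    have hval : ∀ s < 2, (nest [5, b, b] T (.pair (.var 0) (.pair (.var 1) (.pair (.var 2) (.var 3))))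
      (.read W (.pair (.var 0) (.pair (.var 1) (.pair (.var 2) (.var 3)))))).run 1
        (Function.update 0 0 x) d1 T (pairCode x (pairCode s (pairCode i j))) =
        ∑ l ∈ Finset.range D, ∑ s₁ ∈ Finset.range 2, ∑ s₂ ∈ Finset.range 2,
          if (s₁ + s₂) % 2 = s then d T (pairCode (x + 1) (pairCode s₁ (pairCode i l))) *
              d M (pairCode s₂ (pairCode l j)) * 1 else 0 := by
      intro s hs
      rw [hrun x le_rfl, if_pos rfl, Finset.sum_eq_single s, Finset.sum_eq_single (i : ℕ),
        Finset.sum_eq_single (j : ℕ), if_pos rfl, hd1W x le_rfl, if_pos rfl]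
      · simp only [pairCode_inj]
        exact sum_product_at i.2 j.2 (fun s₁ s₂ i' j' l =>
          d T (pairCode (x + 1) (pairCode s₁ (pairCode i' l))) * d M (pairCode s₂ (pairCode l j')) * 1) s
      · intro j' _ h
        simp [h]
      · simp
      · intro i' _ h
        simp [h]
      · simp
      · intro s' _ h
        simp [h]
      · intro h
        exact absurd (Finset.mem_range.2 hs) h
    rw [signedMatrix, Matrix.of_apply, signedEntry, hval 0 (by norm_num), hval 1 (by norm_num),
      signed_product D (fun s l => d T (pairCode (x + 1) (pairCode s (pairCode i l))))
        (fun s l => d M (pairCode s (pairCode l j)))]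
    rw [Matrix.mul_apply, Nat.cast_one, one_mul]
    rfl
  · rw [hrun y hy.le, if_neg hy.ne]
  · rw [run_of_notMem, hd1W y hy.le, if_neg hy.ne]
    rw [writes_nest]
    simpa using hTW.symm

theorem Cmd.writes_matPow (b M T W : ℕ) : (matPow b M T W).writes = [T, W, T] := by
  simp [matPow, matPowStep, writes, writes_nest]

theorem Cmd.bounds_matPow (b M T W : ℕ) : (matPow b M T W).bounds = [b, 3, b, b, b, 5, 5, 5, b, b] := by
  simp [matPow, matPowStep, bounds, bounds_nest]

/-- The loop counts down from the exponent. The invariant is that layer `y` holds the matrix to the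
power "exponent minus `y`" and all layers below are zero; the identity matrix is placed in the top
layer. -/
theorem Cmd.run_matPow {b M T W D : ℕ} {d : State} (hT : 5 < T) (hW : 5 < W) (hTW : T ≠ W)
    (hMT : M ≠ T) (hMW : M ≠ W) (hbT : b ≠ T) (hbW : b ≠ W) (h5 : d 5 0 = 2) (hb : d b 0 = D)
    (h0 : ∀ c, d T c = 0 ∧ d W c = 0) :
    signedMatrix (fun c => (matPow b M T W).run 0 0 d T (pairCode 0 c)) D =
      signedMatrix (d M) D ^ d 3 0 := by
  rw [matPow, run]
  set d1 := (nest [b] T (.pair (.read 3 (.const 0)) (.pair (.const 0) (.pair (.var 0) (.var 0)))) (.const 1)).run 0 0 d with hd1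
  have hd1' : ∀ a, a ≠ T → d1 a = d a := fun a ha => by
    rw [hd1, run_of_notMem]
    rw [writes_nest]
    simpa using ha
  have hd1T : ∀ y c, d1 T (pairCode y c) = ∑ i ∈ Finset.range D,
      if y = d 3 0 ∧ pairCode 0 (pairCode i i) = c then 1 else 0 := by
    intro y c
    rw [hd1, run_nest_apply (by simp; omega) (by simp) (by simp; omega), (h0 _).1, zero_add]
    simp only [nestSum, Tm.eval_pair, Tm.eval_read, Tm.eval_var, Tm.eval_const, Function.update_apply,
      hb, pairCode_inj, if_true, eq_comm (b := y)]
  rw [run, hd1' 3 (by omega)]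
  have key : ∀ y ≤ d 3 0, ∀ d' : State, (∀ a, a ≠ T → a ≠ W → d' a = d a) →
      signedMatrix (fun c => d' T (pairCode y c)) D = signedMatrix (d M) D ^ (d 3 0 - y) →
      (∀ y' < y, ∀ c, d' T (pairCode y' c) = 0 ∧ d' W (pairCode y' c) = 0) →
      signedMatrix (fun c => countDown (fun x d => (matPowStep b M T W).run (0 + 1)
        (Function.update 0 0 x) d) y d' T (pairCode 0 c)) D = signedMatrix (d M) D ^ d 3 0 := by
    intro y
    induction y with
    | zero =>
      intro _ d' _ h _
      simpa [countDown] using h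
    | succ y ih =>
      intro hy d' hd' h hz
      rw [countDown]
      have hd'' := fun a (h1 : a ≠ T) (h2 : a ≠ W) => (run_of_notMem (matPowStep b M T W) (0 + 1)
          (Function.update 0 0 y) d' (b := a)
          (by simp [matPowStep, writes, writes_nest, h1, h2])).trans (hd' a h1 h2)
      have hstep := run_matPowStep (b := b) (M := M) (x := y) (D := D) (d := d') hT hW hTW hMT hMW hbT hbW
        (by rw [hd' 5 (by omega) (by omega), h5]) (by rw [hd' b hbT hbW, hb])
        (fun y' hy' c => hz y' (by omega) c)
      refine ih (by omega) _ hd'' ?_ hstep.2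
      rw [hstep.1, h, hd' M hMT hMW, ← pow_succ]
      congr 1
      omega
  refine key _ le_rfl d1 (fun a h1 _ => hd1' a h1) ?_ ?_
  · rw [Nat.sub_self, pow_zero]
    ext i j
    rw [signedMatrix, Matrix.of_apply, signedEntry, hd1T, hd1T, Matrix.one_apply]
    simp only [pairCode_inj, true_and, zero_ne_one, false_and, ↓reduceIte, Finset.sum_const_zero, Nat.cast_zero,
      sub_zero]
    by_cases hij : i = j
    · subst hij
      simp
    · rw [if_neg hij, Finset.sum_eq_zero, Nat.cast_zero]
      intro l _
      rw [if_neg]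
      rintro ⟨rfl, h⟩
      exact hij (Fin.ext h)
  · intro y hy c
    rw [hd1T, hd1' W hTW.symm, (h0 _).2]
    refine ⟨Finset.sum_eq_zero fun i _ => ?_, rfl⟩
    rw [if_neg]
    omega

theorem Cmd.polyRun_matPow {ι : Type} {sz : ι → ℕ} {b M T W : ℕ} {D : ι → State} (hT : 5 < T)
    (hW : 5 < W) (hTW : T ≠ W) (hMT : M ≠ T) (hMW : M ≠ W) (hbT : b ≠ T) (hbW : b ≠ W)
    (hD : Small sz D) (hb : PolyBdd sz fun x => D x b 0) (h5 : PolyBdd sz fun x => D x 5 0)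
    (h3 : PolyBdd sz fun x => D x 3 0) (hpow : ∀ A : ℕ, PolyBdd sz fun x => A ^ D x 3 0) :
    (matPow b M T W).PolyRun sz D := by
  have hreg : ∀ a, a ≠ T → ∀ x, (nest [b] T (.pair (.read 3 (.const 0)) (.pair (.const 0) (.pair (.var 0) (.var 0)))) (.const 1)).run
      0 0 (D x) a 0 = D x a 0 := fun a ha x => by
    rw [run_of_notMem]
    rw [writes_nest]
    simpa using ha
  have h1 : (nest [b] T (.pair (.read 3 (.const 0)) (.pair (.const 0) (.pair (.var 0) (.var 0)))) (.const 1)).PolyRun sz D :=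
    polyRun_nest hD (by simpa using hb) (by simp; omega) (by simp) (by simp; omega)
  refine h1.seq (Grows.polyRun_loop ?_ h1.1 ?_ ?_ ?_ ?_ ?_) ?_
  · refine (grows_nest ?_ ?_ ?_).seq (grows_nest ?_ ?_ ?_) ?_
    · simp
    · simp; omega
    · simp; omega
    · simp
    · simp; omega
    · simp; omega
    · simp [bounds_nest, writes_nest]; omega
  · simpa only [hreg 3 (by omega)] using h3
  · simpa only [hreg 3 (by omega)] using hpow
  · intro a ha
    simp only [matPowStep, bounds, bounds_nest, List.cons_append, List.nil_append, List.mem_cons,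
      List.not_mem_nil, or_false] at ha
    have : a = b ∨ a = 5 := by tauto
    rcases this with rfl | rfl
    · simpa only [hreg a hbT] using hb
    · simpa only [hreg 5 (by omega)] using h5
  · intro a ha
    simp only [matPowStep, bounds, bounds_nest, List.cons_append, List.nil_append, List.mem_cons,
      List.not_mem_nil, or_false] at ha
    have : a = b ∨ a = 5 := by tauto
    simp only [matPowStep, writes, writes_nest, List.cons_append, List.nil_append, List.mem_cons,
      List.not_mem_nil, or_false]
    omega
  · simp only [matPowStep, writes, writes_nest, List.cons_append, List.nil_append, List.mem_cons,
      List.not_mem_nil, or_false]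
    omega
  · simp [bounds_nest, matPowStep, writes, writes_nest]
    omega

end RAM

/-! ### Reading the input and computing the binary length -/

theorem List.getD_flatMap {α β : Type*} (f : α → List β) {c : ℕ} (hf : ∀ a, (f a).length = c)
    (L : List α) (b : β) {l j : ℕ} (hl : l < L.length) (hj : j < c) :
    (L.flatMap f).getD (c * l + j) b = (f L[l]).getD j b := by
  induction L generalizing l with
  | nil => simp at hl
  | cons a L ih =>
    rw [List.flatMap_cons]
    cases l with
    | zero =>
      rw [Nat.mul_zero, Nat.zero_add, List.getD_append _ _ _ _ (by rw [hf]; exact hj)]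
      rfl
    | succ l =>
      rw [List.getD_append_right _ _ _ _ (by rw [hf]; nlinarith), hf]
      have e1 : c * (l + 1) + j - c = c * l + j := by
        rw [Nat.mul_succ]
        omega
      rw [e1, ih (by simpa using hl)]
      rfl

-- The binary length counts the exponents `e` with `2^e ≤ n`. It can thus be found by counting,
-- without a data-dependent stopping rule.
open Classical in
theorem Nat.card_powers_of_two (n : ℕ) :
    ((Finset.range n).filter fun x => ∃ e, x + 1 = 2 ^ e).card = Nat.size n := by
  have h : ((Finset.range n).filter fun x => ∃ e, x + 1 = 2 ^ e) =
      (Finset.range (Nat.size n)).image fun e => 2 ^ e - 1 := by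
    ext x
    simp only [Finset.mem_filter, Finset.mem_range, Finset.mem_image, Nat.lt_size]
    constructor
    · rintro ⟨hx, e, he⟩
      exact ⟨e, by omega, by omega⟩
    · rintro ⟨e, he, rfl⟩
      have := Nat.one_le_two_pow (n := e)
      exact ⟨by omega, e, by omega⟩
  rw [h, Finset.card_image_of_injective, Finset.card_range]
  intro e e' hee
  have h1 := Nat.one_le_two_pow (n := e)
  have h2 := Nat.one_le_two_pow (n := e')
  simp only at hee
  exact Nat.pow_right_injective le_rfl (show 2 ^ e = 2 ^ e' by omega)

/-- A positive number is a power of two exactly when it has no odd divisor greater than `1`. All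
candidate factorizations lie within loops of length `n`. -/
theorem Nat.sum_sieve_eq_zero_iff {n x : ℕ} (hx : x < n) :
    (∑ i ∈ Finset.range n, ∑ j ∈ Finset.range n,
      if (2 * i + 3) * (j + 1) = x + 1 then 1 else 0) = 0 ↔ ∃ e, x + 1 = 2 ^ e := by
  constructor
  · intro h
    by_contra hne
    rcases Nat.eq_two_pow_or_exists_odd_prime_and_dvd (x + 1) with ⟨e, he⟩ | ⟨p, hp, ⟨j, hj⟩, hodd⟩
    · exact hne ⟨e, he⟩
    · obtain ⟨i, hi⟩ := hodd
      have hp2 := hp.two_le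
      have hj0 : 0 < j := by
        rcases Nat.eq_zero_or_pos j with h | h
        · simp [h] at hj
        · exact h
      have h1 : i - 1 < n := by
        have : p * 1 ≤ p * j := Nat.mul_le_mul_left _ hj0
        omega
      have h2 : j - 1 < n := by
        have : 1 * j ≤ p * j := Nat.mul_le_mul_right _ (by omega)
        omega
      rw [Finset.sum_eq_zero_iff] at h
      have h3 := Finset.sum_eq_zero_iff.1 (h (i - 1) (Finset.mem_range.2 h1)) (j - 1) (Finset.mem_range.2 h2)
      rw [if_pos] at h3
      · exact one_ne_zero h3
      · rw [hj, hi]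
        congr 1 <;> omega
  · rintro ⟨e, he⟩
    refine Finset.sum_eq_zero fun i _ => Finset.sum_eq_zero fun j _ => ?_
    rw [if_neg]
    intro h
    have h1 : 2 * i + 3 ∣ 2 ^ e := ⟨j + 1, by rw [h, he]⟩
    obtain ⟨f, -, hf⟩ := (Nat.dvd_prime_pow Nat.prime_two).1 h1
    cases f with
    | zero => rw [pow_zero] at hf; omega
    | succ f => rw [pow_succ] at hf; omega

/-! ### Inputs in memory and the registers -/

namespace CSP

/-- Inputs of a certification algorithm. -/
abbrev Input (k : ℕ) : Type := (n : ℕ) × (List (Constraint k n) × ℚ≥0)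

/-- The size of an input. -/
def Input.sz {k : ℕ} (x : Input k) : ℕ := inputSize x.1 x.2.1.length x.2.2

/-- The memory that holds an input. -/
def Input.data {k : ℕ} (x : Input k) : RAM.State := RAM.init (encodeInput x.1 x.2.1 x.2.2)

theorem length_encodeConstraint {k n : ℕ} (C : Constraint k n) : (encodeConstraint C).length = 2 * k := by
  simp [encodeConstraint, List.length_flatMap, mul_comm]

theorem getD_encodeConstraint {k n : ℕ} (C : Constraint k n) (i : Fin k) :
    (encodeConstraint C).getD (2 * i) 0 = C.2 i ∧
      (encodeConstraint C).getD (2 * i + 1) 0 = if C.1 i = -1 then 1 else 0 := by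
  have h := fun j (hj : j < 2) => List.getD_flatMap
    (fun i => [(C.2 i : ℕ), if C.1 i = -1 then 1 else 0]) (c := 2)
    (fun _ => rfl) (List.finRange k) 0 (l := i) (by simp) hj
  have h0 := h 0 (by norm_num)
  have h1 := h 1 (by norm_num)
  simp only [List.getElem_finRange] at h0 h1
  exact ⟨h0, h1⟩

variable {k : ℕ} (x : Input k)

theorem Input.data_zero (i : ℕ) : x.data 0 i = (encodeInput x.1 x.2.1 x.2.2).getD i 0 := rfl

theorem Input.data_of_ne {a : ℕ} (ha : a ≠ 0) : x.data a = 0 := by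
  funext i
  rw [data, RAM.init, if_neg ha]
  rfl

theorem Input.data_constraint (l : Fin x.2.1.length) (i : Fin k) :
    x.data 0 (4 + (2 * k * l + 2 * i)) = x.2.1[l].2 i ∧
      x.data 0 (4 + (2 * k * l + 2 * i) + 1) = if x.2.1[l].1 i = -1 then 1 else 0 := by
  have h := fun j (hj : j < 2 * k) => List.getD_flatMap encodeConstraint (length_encodeConstraint (k := k))
    x.2.1 0 l.2 hj
  have h0 := (h (2 * i) (by omega)).trans (getD_encodeConstraint _ i).1
  have h1 := (h (2 * i + 1) (by omega)).trans (getD_encodeConstraint _ i).2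
  rw [data_zero, data_zero, encodeInput, List.getD_append_right _ _ _ _ (by simp),
    List.getD_append_right _ _ _ _ (by simp; omega)]
  refine ⟨Eq.trans ?_ h0, Eq.trans ?_ h1⟩
  · congr 1
    simp
  · congr 1
    simp
    omega

theorem Input.small_data : RAM.Small Input.sz (Input.data (k := k)) := by
  refine ⟨_, RAM.PolyBdd.size.add (RAM.PolyBdd.const 1), fun x a i => ?_⟩
  rcases eq_or_ne a 0 with rfl | ha
  · have hmem : ∀ v ∈ encodeInput x.1 x.2.1 x.2.2, Nat.size v ≤ x.sz + 1 := by
      intro v hv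
      simp only [encodeInput, List.mem_append, List.mem_cons, List.not_mem_nil, or_false,
        List.mem_flatMap] at hv
      have hs := RAM.size_le_self
      simp only [sz, inputSize]
      rcases hv with (rfl | rfl | rfl | rfl) | ⟨C, -, hC⟩
      · have := hs x.1; omega
      · have := hs x.2.1.length; omega
      · omega
      · omega
      · simp only [encodeConstraint, List.mem_flatMap, List.mem_cons, List.not_mem_nil, or_false] at hC
        obtain ⟨i, -, rfl | rfl⟩ := hC
        · have := hs (C.2 i); have := (C.2 i).2; omega
        · split_ifs
          · rw [Nat.size_one]; omega
          · rw [Nat.size_zero]; omega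
    rw [data_zero]
    rcases lt_or_ge i (encodeInput x.1 x.2.1 x.2.2).length with h | h
    · rw [List.getD_eq_getElem _ _ h]
      exact hmem _ (List.getElem_mem _)
    · rw [List.getD_eq_default _ _ h, Nat.size_zero]
      omega
  · rw [data_of_ne x ha]
    simp

open RAM

/-- The registers hold their intended values. -/
structure Registers (x : Input k) (d : State) : Prop where
  input : d 0 = x.data 0
  numVars : d 1 0 = x.1
  numConstraints : d 2 0 = x.2.1.length
  exponent : d 3 0 = Shape.exponent k x.1 + 1
  one : d 4 0 = 1
  two : d 5 0 = 2

theorem Registers.run {x : Input k} {d : State} (h : Registers x d) {c : Cmd}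
    (hc : ∀ a ∈ c.writes, 9 ≤ a) : Registers x (c.run 0 0 d) := by
  have h1 : ∀ a < 9, c.run 0 0 d a = d a := fun a ha =>
    c.run_of_notMem _ _ _ fun h => by have := hc a h; omega
  refine ⟨?_, ?_, ?_, ?_, ?_, ?_⟩
  · rw [h1 0 (by norm_num)]; exact h.input
  · rw [h1 1 (by norm_num)]; exact h.numVars
  · rw [h1 2 (by norm_num)]; exact h.numConstraints
  · rw [h1 3 (by norm_num)]; exact h.exponent
  · rw [h1 4 (by norm_num)]; exact h.one
  · rw [h1 5 (by norm_num)]; exact h.two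

/-- Initialization of the registers that do not need loops. -/
def basicRegisters : Cmd :=
  .seq (.nest [] 1 (.const 0) (.read 0 (.const 0)))
    (.seq (.nest [] 2 (.const 0) (.read 0 (.const 1)))
      (.seq (.nest [] 4 (.const 0) (.const 1)) (.nest [] 5 (.const 0) (.const 2))))

/-- Computation of the binary length of the number of variables. -/
def sizeRegister (k : ℕ) : Cmd :=
  .seq (.nest [1, 1] 6 ((.const 2 * .var 0 + .const 3) * (.var 1 + .const 1)) (.const 1))
    (.seq (.nest [1] 7 (.const 0) (.const 1 - .read 6 (.var 0 + .const 1)))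
      (.nest [] 3 (.const 0) (.const (2 * k + 3) * .read 7 (.const 0) + .const 1)))

theorem run_basicRegisters_of_notMem (d : State) {a : ℕ} (ha : a ∉ [1, 2, 4, 5]) :
    basicRegisters.run 0 0 d a = d a := by
  rw [Cmd.run_of_notMem]
  simpa [basicRegisters, Cmd.writes, Cmd.writes_nest] using ha

theorem run_basicRegisters (x : Input k) :
    basicRegisters.run 0 0 x.data 1 0 = x.1 ∧ basicRegisters.run 0 0 x.data 2 0 = x.2.1.length ∧
      basicRegisters.run 0 0 x.data 4 0 = 1 ∧ basicRegisters.run 0 0 x.data 5 0 = 2 := by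
  simp [basicRegisters, Cmd.run, Cmd.nest, State.set, x.data_of_ne, Tm.eval, x.data_zero, encodeInput]

theorem run_sizeRegister_of_notMem (d : State) {a : ℕ} (ha : a ∉ [3, 6, 7]) :
    (sizeRegister k).run 0 0 d a = d a := by
  rw [Cmd.run_of_notMem]
  simp only [List.mem_cons, List.not_mem_nil, or_false, not_or] at ha
  simp [sizeRegister, Cmd.writes, Cmd.writes_nest, ha]

theorem run_sizeRegister {d : State} {n : ℕ} (h1 : d 1 0 = n) (h3 : d 3 = 0) (h6 : d 6 = 0)
    (h7 : d 7 = 0) : (sizeRegister k).run 0 0 d 3 0 = Shape.exponent k n + 1 := by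
  rw [sizeRegister, Cmd.run, Cmd.run]
  set d1 := (Cmd.nest [1, 1] 6 ((.const 2 * .var 0 + .const 3) * (.var 1 + .const 1)) (.const 1)).run
    0 0 d with hd1
  have hd1' : ∀ a, a ≠ 6 → d1 a = d a := fun a ha => by
    rw [hd1, Cmd.run_of_notMem]
    rw [Cmd.writes_nest]
    simpa using ha
  -- Array `6` counts the factorizations of `c` found by the sieve; zeros at positions `1` to `n`
  -- mark the powers of two.
  have hd16 : ∀ c, d1 6 c = ∑ i ∈ Finset.range n, ∑ j ∈ Finset.range n,
      if (2 * i + 3) * (j + 1) = c then 1 else 0 := by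
    intro c
    rw [hd1, Cmd.run_nest_apply (by simp) (by simp) (by simp), h6]
    simp [nestSum, h1]
  set d2 := (Cmd.nest [1] 7 (.const 0) (.const 1 - .read 6 (.var 0 + .const 1))).run 0 0 d1 with hd2
  have hd2' : ∀ a, a ≠ 7 → d2 a = d1 a := fun a ha => by
    rw [hd2, Cmd.run_of_notMem]
    rw [Cmd.writes_nest]
    simpa using ha
  have hd27 : d2 7 0 = Nat.size n := by
    rw [hd2, Cmd.run_nest_apply (by simp) (by simp) (by simp), hd1' 7 (by norm_num), h7]
    simp only [nestSum, hd1' 1 (by norm_num), h1, Tm.eval_sub, Tm.eval_const, Tm.eval_read, Tm.eval_add,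
      Tm.eval_var, Function.update_self, if_true, Pi.zero_apply, zero_add]
    rw [← Nat.card_powers_of_two, Finset.card_filter]
    refine Finset.sum_congr rfl fun y hy => ?_
    rw [hd16]
    have h := Nat.sum_sieve_eq_zero_iff (Finset.mem_range.1 hy)
    split_ifs with he
    · rw [h.2 he]
    · have := (not_congr h).2 he
      omega
  rw [Cmd.run_nest_apply (by simp) (by simp) (by simp), hd2' 3 (by norm_num), hd1' 3 (by norm_num), h3]
  simp [nestSum, hd27, Shape.exponent]

/-- Initialization of the registers. -/
def setup (k : ℕ) : Cmd := .seq basicRegisters (sizeRegister k)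

theorem run_setup_of_le (x : Input k) {a : ℕ} (ha : 9 ≤ a) : (setup k).run 0 0 x.data a = 0 := by
  rw [setup, Cmd.run, run_sizeRegister_of_notMem, run_basicRegisters_of_notMem, x.data_of_ne]
  · omega
  · simp; omega
  · simp; omega

theorem registers_setup (x : Input k) : Registers x ((setup k).run 0 0 x.data) := by
  have h := run_basicRegisters x
  rw [setup, Cmd.run]
  refine ⟨?_, ?_, ?_, ?_, ?_, ?_⟩
  · rw [run_sizeRegister_of_notMem _ (by simp), run_basicRegisters_of_notMem _ (by simp)]
  · rw [run_sizeRegister_of_notMem _ (by simp), h.1]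
  · rw [run_sizeRegister_of_notMem _ (by simp), h.2.1]
  · refine run_sizeRegister h.1 ?_ ?_ ?_ <;>
      rw [run_basicRegisters_of_notMem _ (by simp), x.data_of_ne (by norm_num)]
  · rw [run_sizeRegister_of_notMem _ (by simp), h.2.2.1]
  · rw [run_sizeRegister_of_notMem _ (by simp), h.2.2.2]

theorem polyBdd_numVars : PolyBdd (Input.sz (k := k)) fun x => x.1 :=
  PolyBdd.size.mono fun x => by simp only [Input.sz, inputSize]; omega

theorem polyBdd_numConstraints : PolyBdd (Input.sz (k := k)) fun x => x.2.1.length :=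
  PolyBdd.size.mono fun x => by simp only [Input.sz, inputSize]; omega

theorem polyBdd_pow_exponent (A : ℕ) :
    PolyBdd (Input.sz (k := k)) fun x => A ^ (Shape.exponent k x.1 + 1) :=
  PolyBdd.pow_size polyBdd_numVars A _

theorem polyBdd_exponent : PolyBdd (Input.sz (k := k)) fun x => Shape.exponent k x.1 + 1 :=
  (polyBdd_pow_exponent 2).mono fun _ => Nat.lt_two_pow_self.le

theorem polyRun_setup : (setup k).PolyRun Input.sz (Input.data (k := k)) := by
  have h1 : basicRegisters.PolyRun Input.sz (Input.data (k := k)) := by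
    refine Cmd.Grows.polyRun ?_ Input.small_data (by simp [basicRegisters, Cmd.bounds, Cmd.bounds_nest])
      (by simp [basicRegisters, Cmd.bounds, Cmd.bounds_nest])
    refine (Cmd.grows_nest ?_ ?_ ?_).seq ((Cmd.grows_nest ?_ ?_ ?_).seq ((Cmd.grows_nest ?_ ?_ ?_).seq
      (Cmd.grows_nest ?_ ?_ ?_) ?_) ?_) ?_ <;> simp [Cmd.bounds, Cmd.bounds_nest]
  refine h1.seq ?_ (by simp [basicRegisters, Cmd.bounds, Cmd.bounds_nest])
  refine Cmd.Grows.polyRun ?_ h1.1 ?_ (by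
    simp [sizeRegister, Cmd.bounds, Cmd.bounds_nest, Cmd.writes, Cmd.writes_nest])
  · refine (Cmd.grows_nest ?_ ?_ ?_).seq ((Cmd.grows_nest ?_ ?_ ?_).seq
      (Cmd.grows_nest ?_ ?_ ?_) ?_) ?_ <;> simp [Cmd.bounds, Cmd.bounds_nest, Cmd.writes_nest]
  · intro b hb
    have : b = 1 := by simpa [sizeRegister, Cmd.bounds, Cmd.bounds_nest] using hb
    subst this
    simpa only [(run_basicRegisters _).1] using polyBdd_numVars

end CSP

/-! ### Further terms, and sums over pairs -/

namespace RAM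

namespace Tm

/-- The indicator of an equality. -/
def eq (t u : Tm) : Tm := .const 1 - ((t - u) + (u - t))

/-- The indicator of an inequality. -/
def le (t u : Tm) : Tm := .const 1 - (t - u)

/-- A power with constant exponent. -/
def pow (t : Tm) : ℕ → Tm
  | 0 => .const 1
  | r + 1 => pow t r * t

/-- A sum with a constant number of terms. -/
def sum {h : ℕ} (f : Fin h → Tm) : Tm := (List.finRange h).foldr (fun i t => f i + t) (.const 0)

variable (d : State) (env : ℕ → ℕ)

@[simp] theorem eval_eq (t u : Tm) :
    (eq t u).eval d env = if t.eval d env = u.eval d env then 1 else 0 := by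
  simp only [eq, eval_sub, eval_const, eval_add]
  split_ifs <;> omega

@[simp] theorem eval_le (t u : Tm) :
    (le t u).eval d env = if t.eval d env ≤ u.eval d env then 1 else 0 := by
  simp only [le, eval_sub, eval_const]
  split_ifs <;> omega

@[simp] theorem eval_pow (t : Tm) (r : ℕ) : (pow t r).eval d env = t.eval d env ^ r := by
  induction r with
  | zero => rfl
  | succ r ih => rw [pow, eval_mul, ih, pow_succ]

@[simp] theorem eval_sum {h : ℕ} (f : Fin h → Tm) : (sum f).eval d env = ∑ i, (f i).eval d env := by
  rw [← List.sum_ofFn, List.ofFn_eq_map, sum]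
  induction List.finRange h with
  | nil => rfl
  | cons i l ih => rw [List.foldr_cons, eval_add, ih, List.map_cons, List.sum_cons]

@[simp] theorem avoids_eq (a : ℕ) (t u : Tm) : (eq t u).Avoids a ↔ t.Avoids a ∧ u.Avoids a := by
  simp only [eq, avoids_sub, avoids_add, avoids_const]
  tauto

@[simp] theorem avoids_le (a : ℕ) (t u : Tm) : (le t u).Avoids a ↔ t.Avoids a ∧ u.Avoids a := by
  simp only [le, avoids_sub, avoids_const]
  tauto

theorem avoids_pow {a : ℕ} {t : Tm} (h : t.Avoids a) (r : ℕ) : (pow t r).Avoids a := by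
  induction r with
  | zero => trivial
  | succ r ih => exact ⟨ih, h⟩

theorem avoids_sum {a h : ℕ} {f : Fin h → Tm} (hf : ∀ i, (f i).Avoids a) : (sum f).Avoids a := by
  rw [sum]
  induction List.finRange h with
  | nil => trivial
  | cons i l ih => exact ⟨hf i, ih⟩

end Tm

/-- The values of two loop variables. -/
def pairEnv (a b : ℕ) : ℕ → ℕ := Function.update (Function.update 0 0 a) 1 b

@[simp] theorem pairEnv_zero (a b : ℕ) : pairEnv a b 0 = a := by simp [pairEnv]

@[simp] theorem pairEnv_one (a b : ℕ) : pairEnv a b 1 = b := by simp [pairEnv]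

theorem nestSum_two {d : State} {r s m n : ℕ} (hr : d r 0 = m) (hs : d s 0 = n) (i e : Tm) (c : ℕ) :
    nestSum d i e c [r, s] 0 0 = ∑ l : Fin m, ∑ l' : Fin n,
      if i.eval d (pairEnv l l') = c then e.eval d (pairEnv l l') else 0 := by
  simp only [nestSum, hr, hs]
  rw [Finset.sum_range]
  refine Finset.sum_congr rfl fun l _ => ?_
  rw [Finset.sum_range]
  rfl

theorem Cmd.run_nest_of_ne (bs : List ℕ) {a b : ℕ} (i e : Tm) (h : b ≠ a) (k : ℕ) (env : ℕ → ℕ)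
    (d : State) : (nest bs a i e).run k env d b = d b := by
  rw [run_of_notMem]
  rw [writes_nest]
  simpa using h

/-- A pair is credited to the positive or negative cell by the parity of its total number of
negations, which is the product of the two signs. -/
theorem signed_pairs {m : ℕ} (b : Fin m → ℕ) (P : Fin m → Fin m → Prop) [∀ l l', Decidable (P l l')]
    (w : Fin m → Fin m → ℕ) :
    ((∑ l, ∑ l', (if (b l + b l') % 2 = 0 ∧ P l l' then w l l' else 0) : ℕ) : ℤ) -
      ((∑ l, ∑ l', if (b l + b l') % 2 = 1 ∧ P l l' then w l l' else 0 : ℕ) : ℤ) =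
      ∑ l, ∑ l', if P l l' then (-1) ^ b l * (-1) ^ b l' * (w l l' : ℤ) else 0 := by
  push_cast
  rw [← Finset.sum_sub_distrib]
  refine Finset.sum_congr rfl fun l _ => ?_
  rw [← Finset.sum_sub_distrib]
  refine Finset.sum_congr rfl fun l' _ => ?_
  by_cases hP : P l l'
  · simp only [hP, and_true, if_true]
    rw [← pow_add]
    rcases Nat.mod_two_eq_zero_or_one (b l + b l') with h | h
    · rw [h, (Nat.even_iff.2 h).neg_one_pow]
      simp
    · rw [h, (Nat.odd_iff.2 h).neg_one_pow]
      simp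
  · simp [hP]

end RAM

/-! ### The quantities of the tests as sums over pairs of constraints -/

namespace CSP

open RAM

namespace Shape

variable {k : ℕ} (σ : Shape k)

theorem entry_coe {n : ℕ} (L : List (Constraint k n)) (j u v) : σ.entry (L : Multiset (Constraint k n)) j u v =
    ∑ l : Fin L.length, if σ.idx L[l] = j ∧ σ.row L[l] = u ∧ σ.col L[l] = v then σ.sign L[l] else 0 := by
  rw [entry, Multiset.map_coe, Multiset.sum_coe]
  exact (Fin.sum_univ_fun_getElem L _).symm

/-- Each entry is itself a sum over constraints, and summing over `j` forces equal indices. The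
program therefore runs over pairs of listed constraints and never stores the tensor of entries. -/
theorem sum_entry_mul {n : ℕ} (L : List (Constraint k n)) (u v u' v') :
    ∑ j, σ.entry (L : Multiset (Constraint k n)) j u v * σ.entry (L : Multiset (Constraint k n)) j u' v' =
    ∑ l : Fin L.length, ∑ l' : Fin L.length, if σ.idx L[l] = σ.idx L[l'] ∧
      (σ.row L[l] = u ∧ σ.col L[l] = v) ∧ σ.row L[l'] = u' ∧ σ.col L[l'] = v' then
        σ.sign L[l] * σ.sign L[l'] else 0 := by
  simp only [entry_coe, Finset.sum_mul_sum]
  rw [Finset.sum_comm]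
  refine Finset.sum_congr rfl fun l _ => ?_
  rw [Finset.sum_comm]
  refine Finset.sum_congr rfl fun l' _ => ?_
  rw [Finset.sum_eq_single (σ.idx L[l])]
  · rw [ite_zero_mul_ite_zero]
    refine if_congr ?_ rfl rfl
    rw [eq_comm (a := σ.idx L[l'])]
    tauto
  · intro j _ hj
    rw [if_neg (fun h => hj h.1.symm), zero_mul]
  · simp

theorem diag_coe {n : ℕ} (L : List (Constraint k n)) : σ.diag (L : Multiset (Constraint k n)) =
    ∑ l : Fin L.length, ∑ l' : Fin L.length, if σ.idx L[l] = σ.idx L[l'] ∧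
      σ.row L[l] = σ.row L[l'] ∧ σ.col L[l] = σ.col L[l'] then σ.sign L[l] * σ.sign L[l'] else 0 := by
  have h1 : σ.diag (L : Multiset (Constraint k n)) =
      ∑ u, ∑ v, ∑ j, σ.entry (L : Multiset (Constraint k n)) j u v * σ.entry (L : Multiset (Constraint k n)) j u v := by
    rw [diag, Finset.sum_comm]
    refine Finset.sum_congr rfl fun u _ => ?_
    rw [Finset.sum_comm]
    exact Finset.sum_congr rfl fun v _ => Finset.sum_congr rfl fun j _ => sq _
  rw [h1]
  simp only [sum_entry_mul]
  have h2 : ∀ f : (Fin σ.h → Fin n) → (Fin σ.h → Fin n) → Fin L.length → Fin L.length → ℤ,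
      ∑ u, ∑ v, ∑ l, ∑ l', f u v l l' = ∑ l, ∑ l', ∑ u, ∑ v, f u v l l' := by
    intro f
    have h3 : ∀ g : (Fin σ.h → Fin n) → (Fin σ.h → Fin n) → Fin L.length → ℤ,
        ∑ u, ∑ v, ∑ l, g u v l = ∑ l, ∑ u, ∑ v, g u v l := fun g =>
      (Finset.sum_congr rfl fun u _ => Finset.sum_comm).trans Finset.sum_comm
    rw [h3]
    exact Finset.sum_congr rfl fun l _ => h3 _
  rw [h2]
  refine Finset.sum_congr rfl fun l _ => Finset.sum_congr rfl fun l' _ => ?_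
  rw [Finset.sum_eq_single (σ.row L[l]), Finset.sum_eq_single (σ.col L[l])]
  · refine if_congr ?_ rfl rfl
    rw [eq_comm (a := σ.row L[l']), eq_comm (a := σ.col L[l'])]
    tauto
  · intro v _ hv
    rw [if_neg (fun h => hv h.2.1.2.symm)]
  · simp
  · intro u _ hu
    exact Finset.sum_eq_zero fun v _ => by rw [if_neg (fun h => hu h.2.1.1.symm)]
  · simp

/-- The number of negations at the positions of the shape. -/
def negations {n : ℕ} (C : Constraint k n) : ℕ :=
  ∑ i, (if C.1 (σ.pos (.inl i)) = -1 then 1 else 0) +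
    (∑ i, (if C.1 (σ.pos (.inr (.inl i))) = -1 then 1 else 0) +
      ∑ i, (if C.1 (σ.pos (.inr (.inr i))) = -1 then 1 else 0))

theorem sign_eq {n : ℕ} (C : Constraint k n) : σ.sign C = (-1) ^ σ.negations C := by
  have h : ∀ u : ℤˣ, (u : ℤ) = (-1) ^ (if u = -1 then 1 else 0) := by
    intro u
    rcases Int.units_eq_one_or u with rfl | rfl <;> rfl
  rw [sign, negations, Fintype.prod_sum_type, Fintype.prod_sum_type, pow_add, pow_add,
    ← Finset.prod_pow_eq_pow_sum, ← Finset.prod_pow_eq_pow_sum, ← Finset.prod_pow_eq_pow_sum]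
  simp only [← h]

end Shape

variable {k : ℕ}

/-- The variable of a constraint at a position. -/
def varTm (l : Tm) (i : Fin k) : Tm := .read 0 (.const 4 + (.const (2 * k) * l + .const (2 * i)))

/-- The sign bit of a constraint at a position. -/
def bitTm (l : Tm) (i : Fin k) : Tm :=
  .read 0 (.const 4 + (.const (2 * k) * l + .const (2 * i)) + .const 1)

/-- The number of variables as a term. -/
def numVarsTm : Tm := .read 1 (.const 0)

/-- The code of the variables of a constraint at some positions. -/
def codeTm {h : ℕ} (l : Tm) (τ : Fin h → Fin k) : Tm :=
  .sum fun i : Fin h => varTm l (τ i) * .pow numVarsTm i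

/-- The number of negations of a constraint at the positions of a shape. -/
def negationsTm (σ : Shape k) (l : Tm) : Tm :=
  .sum (fun i : Fin σ.a => bitTm l (σ.pos (.inl i))) +
    (.sum (fun i : Fin σ.h => bitTm l (σ.pos (.inr (.inl i)))) +
      .sum (fun i : Fin σ.h => bitTm l (σ.pos (.inr (.inr i)))))

/-- The code of the index of a constraint. -/
def idxTm (σ : Shape k) (l : Tm) : Tm := codeTm l fun i : Fin σ.a => σ.pos (.inl i)

/-- The code of the row of a constraint. -/
def rowTm (σ : Shape k) (l : Tm) : Tm := codeTm l fun i : Fin σ.h => σ.pos (.inr (.inl i))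

/-- The code of the column of a constraint. -/
def colTm (σ : Shape k) (l : Tm) : Tm := codeTm l fun i : Fin σ.h => σ.pos (.inr (.inr i))

section Evaluation

variable {x : Input k} {d : State} (hd : Registers x d) {env : ℕ → ℕ} {t : Tm}
  {l : Fin x.2.1.length} (ht : t.eval d env = l)
include hd ht

theorem eval_codeTm {h : ℕ} (τ : Fin h → Fin k) :
    (codeTm t τ).eval d env = (finFunctionFinEquiv fun i => x.2.1[l].2 (τ i) : Fin (x.1 ^ h)) := by
  rw [finFunctionFinEquiv_apply, codeTm, Tm.eval_sum]
  refine Finset.sum_congr rfl fun i _ => ?_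
  simp only [varTm, numVarsTm, Tm.eval_mul, Tm.eval_read, Tm.eval_add, Tm.eval_const, Tm.eval_pow, ht,
    hd.input, hd.numVars, (x.data_constraint l (τ i)).1]

theorem eval_idxTm (σ : Shape k) :
    (idxTm σ t).eval d env = (finFunctionFinEquiv (σ.idx x.2.1[l]) : Fin (x.1 ^ σ.a)) :=
  eval_codeTm hd ht _

theorem eval_rowTm (σ : Shape k) :
    (rowTm σ t).eval d env = (finFunctionFinEquiv (σ.row x.2.1[l]) : Fin (x.1 ^ σ.h)) :=
  eval_codeTm hd ht _

theorem eval_colTm (σ : Shape k) :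
    (colTm σ t).eval d env = (finFunctionFinEquiv (σ.col x.2.1[l]) : Fin (x.1 ^ σ.h)) :=
  eval_codeTm hd ht _

theorem eval_negationsTm (σ : Shape k) :
    (negationsTm σ t).eval d env = σ.negations x.2.1[l] := by
  simp only [negationsTm, Shape.negations, bitTm, Tm.eval_add, Tm.eval_sum, Tm.eval_read, Tm.eval_mul,
    Tm.eval_const, ht, hd.input, (x.data_constraint l _).2]

end Evaluation

theorem avoids_codeTm {a h : ℕ} (ha : 1 < a) {t : Tm} (ht : t.Avoids a) (τ : Fin h → Fin k) :
    (codeTm t τ).Avoids a := by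
  refine Tm.avoids_sum fun i => ?_
  rw [Tm.avoids_mul]
  refine ⟨?_, Tm.avoids_pow ?_ _⟩
  · simp [varTm, ht]
    omega
  · simp [numVarsTm]
    omega

theorem avoids_negationsTm {a : ℕ} (ha : 1 < a) {t : Tm} (ht : t.Avoids a) (σ : Shape k) :
    (negationsTm σ t).Avoids a := by
  have h : ∀ i : Fin k, (bitTm t i).Avoids a := by
    intro i
    simp [bitTm, ht]
    omega
  exact ⟨Tm.avoids_sum fun i => h _, Tm.avoids_sum fun i => h _, Tm.avoids_sum fun i => h _⟩

/-- The code of a pair of rows. -/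
def pairEquiv (n h : ℕ) : (Fin h → Fin n) × (Fin h → Fin n) ≃ Fin (n ^ h * n ^ h) :=
  (Equiv.prodCongr finFunctionFinEquiv finFunctionFinEquiv).trans finProdFinEquiv

theorem pairEquiv_val {n h : ℕ} (u u' : Fin h → Fin n) : (pairEquiv n h (u, u') : ℕ) =
    (finFunctionFinEquiv u' : Fin (n ^ h)) + n ^ h * (finFunctionFinEquiv u : Fin (n ^ h)) := rfl

/-- The computation of the sum of the squares of the entries. -/
def diagCmd (σ : Shape k) (a : ℕ) : Cmd :=
  .nest [2, 2] a ((negationsTm σ (.var 0) + negationsTm σ (.var 1)) % .const 2)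
    (.eq (idxTm σ (.var 0)) (idxTm σ (.var 1)) * (.eq (rowTm σ (.var 0)) (rowTm σ (.var 1)) *
      .eq (colTm σ (.var 0)) (colTm σ (.var 1))))

/-- The computation of the matrix. -/
def offMatCmd (σ : Shape k) (a : ℕ) : Cmd :=
  .nest [2, 2] a (.pair ((negationsTm σ (.var 0) + negationsTm σ (.var 1)) % .const 2)
      (.pair (rowTm σ (.var 0) + .pow numVarsTm σ.h * rowTm σ (.var 1))
        (colTm σ (.var 0) + .pow numVarsTm σ.h * colTm σ (.var 1))))
    (.eq (idxTm σ (.var 0)) (idxTm σ (.var 1)) * (.const 1 -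
      .eq (rowTm σ (.var 0)) (rowTm σ (.var 1)) * .eq (colTm σ (.var 0)) (colTm σ (.var 1))))

theorem run_diagCmd (σ : Shape k) {x : Input k} {d : State} (hd : Registers x d) {a : ℕ} (ha : 2 < a)
    (h0 : d a = 0) : ((diagCmd σ a).run 0 0 d a 0 : ℤ) - (diagCmd σ a).run 0 0 d a 1 =
      σ.diag (x.2.1 : Multiset (Constraint k x.1)) := by
  have hv : ∀ c, (diagCmd σ a).run 0 0 d a c = ∑ l : Fin x.2.1.length, ∑ l' : Fin x.2.1.length,
      if (σ.negations x.2.1[l] + σ.negations x.2.1[l']) % 2 = c ∧ True then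
        (if σ.idx x.2.1[l] = σ.idx x.2.1[l'] ∧ σ.row x.2.1[l] = σ.row x.2.1[l'] ∧
          σ.col x.2.1[l] = σ.col x.2.1[l'] then 1 else 0) else 0 := by
    intro c
    rw [diagCmd, Cmd.run_nest_apply, h0, nestSum_two hd.numConstraints hd.numConstraints,
      Pi.zero_apply, zero_add]
    · refine Finset.sum_congr rfl fun l _ => Finset.sum_congr rfl fun l' _ => ?_
      have e0 : (Tm.var 0).eval d (pairEnv l l') = l := by simp
      have e1 : (Tm.var 1).eval d (pairEnv l l') = l' := by simp
      simp only [Tm.eval_mod, Tm.eval_add, Tm.eval_mul, Tm.eval_eq,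
        eval_idxTm hd e0, eval_idxTm hd e1, eval_rowTm hd e0, eval_rowTm hd e1, eval_colTm hd e0,
        eval_colTm hd e1, eval_negationsTm hd e0, eval_negationsTm hd e1,
        Fin.val_inj, EmbeddingLike.apply_eq_iff_eq, Tm.eval_const, and_true]
      refine if_congr Iff.rfl ?_ rfl
      simp only [mul_ite, mul_one, mul_zero, ← ite_and]
      refine if_congr ?_ rfl rfl
      tauto
    · exact ⟨⟨avoids_negationsTm (by omega) (Tm.avoids_var _ _) _, avoids_negationsTm (by omega) (Tm.avoids_var _ _) _⟩, trivial⟩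
    · simp only [Tm.avoids_mul, Tm.avoids_eq, idxTm, rowTm, colTm]
      exact ⟨⟨avoids_codeTm (by omega) (Tm.avoids_var _ _) _, avoids_codeTm (by omega) (Tm.avoids_var _ _) _⟩,
        ⟨avoids_codeTm (by omega) (Tm.avoids_var _ _) _, avoids_codeTm (by omega) (Tm.avoids_var _ _) _⟩,
        avoids_codeTm (by omega) (Tm.avoids_var _ _) _, avoids_codeTm (by omega) (Tm.avoids_var _ _) _⟩
    · simp; omega
  rw [hv, hv, signed_pairs, σ.diag_coe]
  refine Finset.sum_congr rfl fun l _ => Finset.sum_congr rfl fun l' _ => ?_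
  rw [if_pos trivial, ← σ.sign_eq, ← σ.sign_eq]
  split_ifs <;> simp

theorem run_offMatCmd (σ : Shape k) {x : Input k} {d : State} (hd : Registers x d) {a : ℕ}
    (ha : 2 < a) (h0 : d a = 0) (u v : (Fin σ.h → Fin x.1) × (Fin σ.h → Fin x.1)) :
    signedEntry ((offMatCmd σ a).run 0 0 d a) (pairEquiv x.1 σ.h u) (pairEquiv x.1 σ.h v) =
      σ.offMat (x.2.1 : Multiset (Constraint k x.1)) u v := by
  -- In the code of a pair the second component is the low digit. The constraint of the outer loop
  -- thus supplies the second components of `u` and `v`, and that of the inner loop the first.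
  have hv : ∀ s, (offMatCmd σ a).run 0 0 d a (pairCode s (pairCode (pairEquiv x.1 σ.h u)
      (pairEquiv x.1 σ.h v))) = ∑ l : Fin x.2.1.length, ∑ l' : Fin x.2.1.length,
      if (σ.negations x.2.1[l] + σ.negations x.2.1[l']) % 2 = s ∧
        ((σ.row x.2.1[l'], σ.row x.2.1[l]) = u ∧ (σ.col x.2.1[l'], σ.col x.2.1[l]) = v) then
        (if σ.idx x.2.1[l] = σ.idx x.2.1[l'] ∧ ¬ (σ.row x.2.1[l] = σ.row x.2.1[l'] ∧
          σ.col x.2.1[l] = σ.col x.2.1[l']) then 1 else 0) else 0 := by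
    intro s
    rw [offMatCmd, Cmd.run_nest_apply, h0, nestSum_two hd.numConstraints hd.numConstraints,
      Pi.zero_apply, zero_add]
    · refine Finset.sum_congr rfl fun l _ => Finset.sum_congr rfl fun l' _ => ?_
      have e0 : (Tm.var 0).eval d (pairEnv l l') = l := by simp
      have e1 : (Tm.var 1).eval d (pairEnv l l') = l' := by simp
      simp only [Tm.eval_mod, Tm.eval_add, Tm.eval_mul, Tm.eval_eq, Tm.eval_sub, Tm.eval_pair,
        numVarsTm, Tm.eval_pow, Tm.eval_read, hd.numVars, eval_idxTm hd e0, eval_idxTm hd e1,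
        eval_rowTm hd e0, eval_rowTm hd e1, eval_colTm hd e0, eval_colTm hd e1, eval_negationsTm hd e0, eval_negationsTm hd e1,
        ← pairEquiv_val, pairCode_inj,
        Fin.val_inj, EmbeddingLike.apply_eq_iff_eq, Tm.eval_const]
      refine if_congr Iff.rfl ?_ rfl
      split_ifs <;> first | rfl | tauto
    · simp only [Tm.avoids_pair, Tm.avoids_mod, Tm.avoids_add, Tm.avoids_mul, Tm.avoids_const,
        rowTm, colTm, and_true]
      have hp : (Tm.pow numVarsTm σ.h).Avoids a := Tm.avoids_pow (by simp [numVarsTm]; omega) _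
      exact ⟨⟨avoids_negationsTm (by omega) (Tm.avoids_var _ _) _, avoids_negationsTm (by omega) (Tm.avoids_var _ _) _⟩,
        ⟨avoids_codeTm (by omega) (Tm.avoids_var _ _) _, hp, avoids_codeTm (by omega) (Tm.avoids_var _ _) _⟩,
        avoids_codeTm (by omega) (Tm.avoids_var _ _) _, hp, avoids_codeTm (by omega) (Tm.avoids_var _ _) _⟩
    · simp only [Tm.avoids_mul, Tm.avoids_eq, Tm.avoids_sub, Tm.avoids_const, idxTm, rowTm, colTm, true_and]
      exact ⟨⟨avoids_codeTm (by omega) (Tm.avoids_var _ _) _, avoids_codeTm (by omega) (Tm.avoids_var _ _) _⟩,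
        ⟨avoids_codeTm (by omega) (Tm.avoids_var _ _) _, avoids_codeTm (by omega) (Tm.avoids_var _ _) _⟩,
        avoids_codeTm (by omega) (Tm.avoids_var _ _) _, avoids_codeTm (by omega) (Tm.avoids_var _ _) _⟩
    · simp; omega
  rw [signedEntry, hv, hv, signed_pairs, Shape.offMat, Matrix.of_apply, σ.sum_entry_mul]
  obtain ⟨u₁, u₂⟩ := u
  obtain ⟨v₁, v₂⟩ := v
  simp only [Prod.mk.injEq]
  split_ifs with h
  · refine Finset.sum_eq_zero fun l _ => Finset.sum_eq_zero fun l' _ => ?_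
    split_ifs with h1 h2
    · exact (h2.2 ⟨by rw [h1.1.2, h1.1.1, h.1], by rw [h1.2.2, h1.2.1, h.2]⟩).elim
    · simp
    · rfl
  · refine Finset.sum_congr rfl fun l _ => Finset.sum_congr rfl fun l' _ => ?_
    rw [← σ.sign_eq, ← σ.sign_eq]
    by_cases h1 : (σ.row x.2.1[l'] = u₁ ∧ σ.row x.2.1[l] = u₂) ∧
        σ.col x.2.1[l'] = v₁ ∧ σ.col x.2.1[l] = v₂
    · rw [if_pos h1]
      by_cases h2 : σ.idx x.2.1[l] = σ.idx x.2.1[l']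
      · have c1 : ¬ (σ.row x.2.1[l] = σ.row x.2.1[l'] ∧ σ.col x.2.1[l] = σ.col x.2.1[l']) := by
          rw [h1.1.1, h1.1.2, h1.2.1, h1.2.2]
          exact h
        rw [if_pos (And.intro h2 c1),
          if_pos (And.intro h2 (And.intro ⟨h1.1.2, h1.2.2⟩ ⟨h1.1.1, h1.2.1⟩))]
        simp
      · rw [if_neg (fun h3 => h2 h3.1), if_neg (fun h3 => h2 h3.1)]
        simp
    · rw [if_neg h1, if_neg]
      tauto

end CSP

/-! ### Gram matrices and powers of numbers -/

namespace RAM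

/-- The computation of a multiple of the Gram matrix of the rows of a matrix. -/
def Cmd.gram (b B M : ℕ) (f : Tm) : Cmd :=
  .nest [b, b, b, 5, 5] M (.pair ((.var 3 + .var 4) % .const 2) (.pair (.var 0) (.var 1)))
    (.read B (.pair (.var 3) (.pair (.var 0) (.var 2))) *
      .read B (.pair (.var 4) (.pair (.var 1) (.var 2))) * f)

theorem Cmd.run_gram {b B M D Y : ℕ} {f : Tm} {d : State} (hM : 5 < M) (hB : B ≠ M) (hbM : b ≠ M)
    (hf : f.Avoids M) (hfY : ∀ env, f.eval d env = Y) (h5 : d 5 0 = 2) (hb : d b 0 = D) (h0 : d M = 0) :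
    signedMatrix ((gram b B M f).run 0 0 d M) D =
      (Y : ℤ) • (signedMatrix (d B) D * (signedMatrix (d B) D).transpose) := by
  have hv : ∀ (i j : Fin D) s, (gram b B M f).run 0 0 d M (pairCode s (pairCode i j)) =
      ∑ l ∈ Finset.range D, ∑ s₁ ∈ Finset.range 2, ∑ s₂ ∈ Finset.range 2,
        if (s₁ + s₂) % 2 = s then
          d B (pairCode s₁ (pairCode i l)) * d B (pairCode s₂ (pairCode j l)) * Y else 0 := by
    intro i j s
    rw [gram, run_nest_apply (by simp) (by simp [hf]; omega) (by simp; omega), h0, Pi.zero_apply, zero_add]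
    simp only [nestSum, Tm.eval_pair, Tm.eval_add, Tm.eval_mod, Tm.eval_mul, Tm.eval_read, Tm.eval_var,
      Tm.eval_const, Function.update_apply, hb, h5, pairCode_inj, hfY]
    exact sum_product_at i.2 j.2 (fun s₁ s₂ i' j' l =>
      d B (pairCode s₁ (pairCode i' l)) * d B (pairCode s₂ (pairCode j' l)) * Y) s
  ext i j
  rw [signedMatrix, Matrix.of_apply, signedEntry, hv, hv,
    signed_product D (fun s l => d B (pairCode s (pairCode i l))) (fun s l => d B (pairCode s (pairCode j l)))]
  rw [Matrix.smul_apply, Matrix.mul_apply, smul_eq_mul]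
  rfl

/-- Taking determinants of `1 × 1` matrices lets the program for matrix powers compute powers of
numbers. -/
theorem signedMatrix_one_pow (f g : ℕ → ℕ) (r : ℕ) (h : signedMatrix f 1 = signedMatrix g 1 ^ r) :
    signedEntry f 0 0 = signedEntry g 0 0 ^ r := by
  have h1 := congrArg Matrix.det h
  rw [Matrix.det_pow, Matrix.det_fin_one, Matrix.det_fin_one] at h1
  exact h1

/-- A scalar placed in front of the Gram matrix is raised to the required power together with it, so
the factor in the second test needs no separate computation. -/
theorem trace_reindex_gram {X Z : Type*} [Fintype X] [DecidableEq X] [Fintype Z] [DecidableEq Z]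
    (e : X ≃ Z) (A : Matrix X X ℤ) (c : ℤ) (r : ℕ) :
    ((c • (Matrix.reindex e e A * (Matrix.reindex e e A).transpose)) ^ r).trace =
      c ^ r * ((A * A.transpose) ^ r).trace := by
  have h1 : Matrix.reindex e e A * (Matrix.reindex e e A).transpose =
      Matrix.reindexAlgEquiv ℤ ℤ e (A * A.transpose) := by
    rw [map_mul]
    rfl
  rw [h1, smul_pow, ← map_pow, Matrix.trace_smul, smul_eq_mul]
  congr 1
  exact Equiv.sum_comp e.symm fun x => ((A * A.transpose) ^ r) x x

end RAM

/-! ### The program for the tests of one shape -/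

namespace CSP

open RAM

variable {k : ℕ}

/-- The number of constraints as a term. -/
def numConstraintsTm : Tm := .read 2 (.const 0)

/-- The numerator of the accuracy as a term. -/
def numTm : Tm := .read 0 (.const 2)

/-- The denominator of the accuracy as a term. -/
def denTm : Tm := .read 0 (.const 3)

theorem Registers.num {x : Input k} {d : State} (hd : Registers x d) : d 0 2 = x.2.2.num := by
  rw [hd.input, x.data_zero]
  simp [encodeInput]

theorem Registers.den {x : Input k} {d : State} (hd : Registers x d) : d 0 3 = x.2.2.den := by
  rw [hd.input, x.data_zero]
  simp [encodeInput]

/-- The factor of the sum of the squares in the first test. -/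
def diagFactorTm (σ : Shape k) : Tm :=
  .const 2 * .pow numVarsTm σ.a * (.const (4 ^ (k + 1)) * .pow denTm 2)

/-- The factor of the trace in the second test. -/
def traceFactorTm (σ : Shape k) : Tm :=
  .const 2 * .pow numVarsTm σ.a * (.pow numVarsTm σ.h * .pow numVarsTm σ.h) *
    (.const (4 ^ (k + 1)) * .pow denTm 2)

/-- The right-hand side of the tests. -/
def thresholdTm : Tm := .pow numTm 2 * .pow numConstraintsTm 2

theorem avoids_diagFactorTm (σ : Shape k) {a : ℕ} (ha : 9 ≤ a) : (diagFactorTm σ).Avoids a := by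
  have h1 : numVarsTm.Avoids a := by simp [numVarsTm]; omega
  have h2 : denTm.Avoids a := by simp [denTm]; omega
  simp only [diagFactorTm, Tm.avoids_mul, Tm.avoids_const, Tm.avoids_pow h1, Tm.avoids_pow h2, and_true]

theorem avoids_traceFactorTm (σ : Shape k) {a : ℕ} (ha : 9 ≤ a) : (traceFactorTm σ).Avoids a := by
  have h1 : numVarsTm.Avoids a := by simp [numVarsTm]; omega
  have h2 : denTm.Avoids a := by simp [denTm]; omega
  simp only [traceFactorTm, Tm.avoids_mul, Tm.avoids_const, Tm.avoids_pow h1, Tm.avoids_pow h2, and_true]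

theorem avoids_thresholdTm {a : ℕ} (ha : 9 ≤ a) : thresholdTm.Avoids a := by
  have h1 : numTm.Avoids a := by simp [numTm]; omega
  have h2 : numConstraintsTm.Avoids a := by simp [numConstraintsTm]; omega
  simp only [thresholdTm, Tm.avoids_mul, Tm.avoids_pow h1, Tm.avoids_pow h2, and_true]

/-- The count of the failing tests. -/
def testCmd (σ : Shape k) (β : ℕ) : Cmd :=
  .nest [] 9 (.const 0) (.const 1 -
    .le (diagFactorTm σ * .read (β + 1) (.const 0))
      (thresholdTm + diagFactorTm σ * .read (β + 1) (.const 1)) *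
    .le (.read (β + 9) (.const 0) +
        .read (β + 7) (.pair (.const 0) (.pair (.const 1) (.pair (.const 0) (.const 0)))))
      (.read (β + 7) (.pair (.const 0) (.pair (.const 0) (.pair (.const 0) (.const 0)))) +
        .read (β + 9) (.const 1)))

/-- The computation of the trace of a matrix. -/
def traceCmd (β : ℕ) : Cmd :=
  .nest [5, β] (β + 9) (.var 0)
    (.read (β + 4) (.pair (.const 0) (.pair (.var 0) (.pair (.var 1) (.var 1)))))

/-- The number of rows of the matrix. -/
def dimCmd (σ : Shape k) (β : ℕ) : Cmd :=
  .nest [] β (.const 0) (.pow numVarsTm σ.h * .pow numVarsTm σ.h)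

/-- The square of the right-hand side of the tests, as a matrix. -/
def thresholdCmd (β : ℕ) : Cmd :=
  .nest [] (β + 6) (.pair (.const 0) (.pair (.const 0) (.const 0))) (.pow thresholdTm 2)

/-- The tests of a shape, with auxiliary arrays from `β` on. -/
def shapeCmd (σ : Shape k) (β : ℕ) : Cmd :=
  .seq (dimCmd σ β) (.seq (diagCmd σ (β + 1)) (.seq (offMatCmd σ (β + 2))
    (.seq (.gram β (β + 2) (β + 3) (.pow (traceFactorTm σ) 2))
      (.seq (.matPow β (β + 3) (β + 4) (β + 5)) (.seq (thresholdCmd β)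
        (.seq (.matPow 4 (β + 6) (β + 7) (β + 8)) (.seq (traceCmd β) (testCmd σ β))))))))

theorem writes_shapeCmd (σ : Shape k) (β : ℕ) : (shapeCmd σ β).writes =
    [β, β + 1, β + 2, β + 3, β + 4, β + 5, β + 4, β + 6, β + 7, β + 8, β + 7, β + 9, 9] := by
  simp [shapeCmd, Cmd.writes, dimCmd, diagCmd, offMatCmd, Cmd.gram, Cmd.writes_nest, Cmd.writes_matPow,
    thresholdCmd, traceCmd, testCmd]

theorem run_traceCmd {β D : ℕ} {d : State} (h5 : d 5 0 = 2) (hb : d β 0 = D)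
    (h0 : d (β + 9) = 0) : ((traceCmd β).run 0 0 d (β + 9) 0 : ℤ) - (traceCmd β).run 0 0 d (β + 9) 1 =
      (signedMatrix (fun c => d (β + 4) (pairCode 0 c)) D).trace := by
  have hv : ∀ s : Fin 2, (traceCmd β).run 0 0 d (β + 9) s =
      ∑ i : Fin D, d (β + 4) (pairCode 0 (pairCode s (pairCode i i))) := by
    intro s
    rw [traceCmd, Cmd.run_nest_apply (by simp) (by simp) (by simp), h0, nestSum_two h5 hb,
      Pi.zero_apply, zero_add]
    simp only [Tm.eval_var, pairEnv_zero, pairEnv_one, Tm.eval_read, Tm.eval_pair, Tm.eval_const,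
      Fin.val_inj]
    rw [Finset.sum_eq_single s]
    · simp
    · intro s' _ h
      simp [h]
    · simp
  have h := hv 0
  have h' := hv 1
  simp only [Fin.val_zero, Fin.val_one] at h h'
  rw [h, h', Matrix.trace, Nat.cast_sum, Nat.cast_sum, ← Finset.sum_sub_distrib]
  rfl

-- The Gram matrix is scaled by `X²` and raised to the power `exponent + 1`, giving the factor `X^(2
-- * exponent + 2)` of the second test. The threshold `Y²` is raised to the same power in dimension
-- `1`.
open Classical in
theorem run_shapeCmd (σ : Shape k) {β : ℕ} (hβ : 9 < β) {x : Input k} {d : State}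
    (hd : Registers x d) (h0 : ∀ a, β ≤ a → d a = 0) :
    (shapeCmd σ β).run 0 0 d 9 0 =
      d 9 0 + if σ.Test (x.2.1 : Multiset (Constraint k x.1)) x.2.2 then 0 else 1 := by
  rw [shapeCmd]
  simp only [Cmd.run]
  obtain ⟨d1, hd1⟩ : ∃ d1, d1 = (dimCmd σ β).run 0 0 d := ⟨_, rfl⟩
  rw [← hd1]
  obtain ⟨d2, hd2⟩ : ∃ d2, d2 = (diagCmd σ (β + 1)).run 0 0 d1 := ⟨_, rfl⟩
  rw [← hd2]
  obtain ⟨d3, hd3⟩ : ∃ d3, d3 = (offMatCmd σ (β + 2)).run 0 0 d2 := ⟨_, rfl⟩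
  rw [← hd3]
  obtain ⟨d4, hd4⟩ : ∃ d4, d4 = (Cmd.gram β (β + 2) (β + 3) (.pow (traceFactorTm σ) 2)).run 0 0 d3 :=
    ⟨_, rfl⟩
  rw [← hd4]
  obtain ⟨d5, hd5⟩ : ∃ d5, d5 = (Cmd.matPow β (β + 3) (β + 4) (β + 5)).run 0 0 d4 := ⟨_, rfl⟩
  rw [← hd5]
  obtain ⟨d6, hd6⟩ : ∃ d6, d6 = (thresholdCmd β).run 0 0 d5 := ⟨_, rfl⟩
  rw [← hd6]
  obtain ⟨d7, hd7⟩ : ∃ d7, d7 = (Cmd.matPow 4 (β + 6) (β + 7) (β + 8)).run 0 0 d6 := ⟨_, rfl⟩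
  rw [← hd7]
  obtain ⟨d8, hd8⟩ : ∃ d8, d8 = (traceCmd β).run 0 0 d7 := ⟨_, rfl⟩
  rw [← hd8]
  -- Each stage changes only its own arrays; these facts carry every intermediate result to the
  -- place where it is used.
  have f1 : ∀ a, a ≠ β → d1 a = d a := fun a ha => by rw [hd1, dimCmd, Cmd.run_nest_of_ne _ _ _ ha]
  have f2 : ∀ a, a ≠ β + 1 → d2 a = d1 a := fun a ha => by rw [hd2, diagCmd, Cmd.run_nest_of_ne _ _ _ ha]
  have f3 : ∀ a, a ≠ β + 2 → d3 a = d2 a := fun a ha => by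
    rw [hd3, offMatCmd, Cmd.run_nest_of_ne _ _ _ ha]
  have f4 : ∀ a, a ≠ β + 3 → d4 a = d3 a := fun a ha => by
    rw [hd4, Cmd.gram, Cmd.run_nest_of_ne _ _ _ ha]
  have f5 : ∀ a, a ≠ β + 4 → a ≠ β + 5 → d5 a = d4 a := fun a h1 h2 => by
    rw [hd5, Cmd.run_of_notMem]
    simp [Cmd.writes_matPow, h1, h2]
  have f6 : ∀ a, a ≠ β + 6 → d6 a = d5 a := fun a ha => by
    rw [hd6, thresholdCmd, Cmd.run_nest_of_ne _ _ _ ha]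
  have f7 : ∀ a, a ≠ β + 7 → a ≠ β + 8 → d7 a = d6 a := fun a h1 h2 => by
    rw [hd7, Cmd.run_of_notMem]
    simp [Cmd.writes_matPow, h1, h2]
  have f8 : ∀ a, a ≠ β + 9 → d8 a = d7 a := fun a ha => by
    rw [hd8, traceCmd, Cmd.run_nest_of_ne _ _ _ ha]
  have r1 : Registers x d1 := by
    rw [hd1]; exact hd.run (by simp [dimCmd, Cmd.writes_nest]; omega)
  have r2 : Registers x d2 := by
    rw [hd2]; exact r1.run (by simp [diagCmd, Cmd.writes_nest]; omega)
  have r3 : Registers x d3 := by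
    rw [hd3]; exact r2.run (by simp [offMatCmd, Cmd.writes_nest]; omega)
  have r4 : Registers x d4 := by
    rw [hd4]; exact r3.run (by simp [Cmd.gram, Cmd.writes_nest]; omega)
  have r5 : Registers x d5 := by
    rw [hd5]; exact r4.run (by simp [Cmd.writes_matPow]; omega)
  have r6 : Registers x d6 := by
    rw [hd6]; exact r5.run (by simp [thresholdCmd, Cmd.writes_nest]; omega)
  have r7 : Registers x d7 := by
    rw [hd7]; exact r6.run (by simp [Cmd.writes_matPow]; omega)
  have r8 : Registers x d8 := by
    rw [hd8]; exact r7.run (by simp [traceCmd, Cmd.writes_nest])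
  set n := x.1 with hn
  set D := n ^ σ.h * n ^ σ.h with hD
  set I : Instance k n := (x.2.1 : Multiset (Constraint k x.1)) with hI
  set X : ℕ := 2 * n ^ σ.a * (n ^ σ.h * n ^ σ.h) * (4 ^ (k + 1) * x.2.2.den ^ 2) with hX
  set Y : ℕ := x.2.2.num ^ 2 * x.2.1.length ^ 2 with hY
  have v1 : d1 β 0 = D := by
    have hp : numVarsTm.Avoids β := by simp [numVarsTm]; omega
    rw [hd1, dimCmd, Cmd.run_nest_apply, h0 β le_rfl]
    · simp [nestSum, numVarsTm, hd.numVars, hD, hn]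
    · trivial
    · exact ⟨Tm.avoids_pow hp _, Tm.avoids_pow hp _⟩
    · simp
  have v2 : (d2 (β + 1) 0 : ℤ) - d2 (β + 1) 1 = σ.diag I := by
    rw [hd2]
    exact run_diagCmd σ r1 (by omega) (by rw [f1 _ (by omega), h0 _ (by omega)])
  have v3 : signedMatrix (d3 (β + 2)) D =
      Matrix.reindex (pairEquiv n σ.h) (pairEquiv n σ.h) (σ.offMat I) := by
    ext i j
    have h := run_offMatCmd σ r2 (a := β + 2) (by omega)
      (by rw [f2 _ (by omega), f1 _ (by omega), h0 _ (by omega)])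
      ((pairEquiv n σ.h).symm i) ((pairEquiv n σ.h).symm j)
    rw [Equiv.apply_symm_apply, Equiv.apply_symm_apply, ← hd3] at h
    exact h
  have v4 : signedMatrix (d4 (β + 3)) D = ((X ^ 2 : ℕ) : ℤ) •
      (signedMatrix (d3 (β + 2)) D * (signedMatrix (d3 (β + 2)) D).transpose) := by
    rw [hd4]
    refine Cmd.run_gram (by omega) (by omega) (by omega)
      (Tm.avoids_pow (avoids_traceFactorTm σ (by omega)) _) (fun env => ?_) r3.two ?_ ?_
    · simp [traceFactorTm, numVarsTm, denTm, r3.numVars, r3.den, hX, hn]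
    · rw [f3 _ (by omega), f2 _ (by omega), v1]
    · rw [f3 _ (by omega), f2 _ (by omega), f1 _ (by omega), h0 _ (by omega)]
  have v5 : signedMatrix (fun c => d5 (β + 4) (pairCode 0 c)) D =
      signedMatrix (d4 (β + 3)) D ^ (Shape.exponent k n + 1) := by
    rw [hd5, ← r4.exponent]
    refine Cmd.run_matPow (by omega) (by omega) (by omega) (by omega) (by omega) (by omega) (by omega)
      r4.two ?_ fun c => ?_
    · rw [f4 _ (by omega), f3 _ (by omega), f2 _ (by omega), v1]
    · rw [f4 _ (by omega), f3 _ (by omega), f2 _ (by omega), f1 _ (by omega), h0 _ (by omega),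
        f4 _ (by omega), f3 _ (by omega), f2 _ (by omega), f1 _ (by omega), h0 _ (by omega)]
      exact ⟨rfl, rfl⟩
  have z5 : ∀ a, β + 6 ≤ a → d5 a = 0 := fun a ha => by
    rw [f5 _ (by omega) (by omega), f4 _ (by omega), f3 _ (by omega), f2 _ (by omega), f1 _ (by omega),
      h0 _ (by omega)]
  have v6 : signedEntry (d6 (β + 6)) 0 0 = ((Y ^ 2 : ℕ) : ℤ) := by
    have h : ∀ c, d6 (β + 6) c = if pairCode 0 (pairCode 0 0) = c then Y ^ 2 else 0 := by
      intro c
      rw [hd6, thresholdCmd, Cmd.run_nest_apply (by simp)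
        (Tm.avoids_pow (avoids_thresholdTm (by omega)) _) (by simp), z5 _ le_rfl]
      simp [nestSum, thresholdTm, numTm, numConstraintsTm, r5.num, r5.numConstraints, hY]
    rw [signedEntry, h, h]
    simp
  have v7 : signedEntry (fun c => d7 (β + 7) (pairCode 0 c)) 0 0 =
      ((Y ^ 2 : ℕ) : ℤ) ^ (Shape.exponent k n + 1) := by
    rw [← v6]
    refine signedMatrix_one_pow _ _ _ ?_
    rw [hd7, ← r6.exponent]
    refine Cmd.run_matPow (by omega) (by omega) (by omega) (by omega) (by omega) (by omega) (by omega)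
      r6.two r6.one fun c => ?_
    rw [f6 _ (by omega), z5 _ (by omega), f6 _ (by omega), z5 _ (by omega)]
    exact ⟨rfl, rfl⟩
  have v8 : (d8 (β + 9) 0 : ℤ) - d8 (β + 9) 1 =
      ((X ^ 2 : ℕ) : ℤ) ^ (Shape.exponent k n + 1) * σ.traceMoment I := by
    rw [hd8, run_traceCmd r7.two (D := D)]
    · rw [f7 _ (by omega) (by omega), f6 _ (by omega), v5, v4, v3, trace_reindex_gram, Shape.traceMoment]
    · rw [f7 _ (by omega) (by omega), f6 _ (by omega), f5 _ (by omega) (by omega), f4 _ (by omega),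
        f3 _ (by omega), f2 _ (by omega), v1]
    · rw [f7 _ (by omega) (by omega), f6 _ (by omega), z5 _ (by omega)]
  have w1 : d8 (β + 1) = d2 (β + 1) := by
    rw [f8 _ (by omega), f7 _ (by omega) (by omega), f6 _ (by omega), f5 _ (by omega) (by omega),
      f4 _ (by omega), f3 _ (by omega)]
  have w7 : d8 (β + 7) = d7 (β + 7) := f8 _ (by omega)
  have w9 : d8 9 0 = d 9 0 := by
    rw [f8 _ (by omega), f7 _ (by omega) (by omega), f6 _ (by omega), f5 _ (by omega) (by omega),
      f4 _ (by omega), f3 _ (by omega), f2 _ (by omega), f1 _ (by omega)]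
  -- Integers are stored as differences of natural numbers, so the negative parts are moved across
  -- the inequality to avoid truncated subtraction.
  have t1 : (2 * n ^ σ.a * (4 ^ (k + 1) * x.2.2.den ^ 2) * d2 (β + 1) 0 ≤
      Y + 2 * n ^ σ.a * (4 ^ (k + 1) * x.2.2.den ^ 2) * d2 (β + 1) 1) ↔
      2 * (n : ℤ) ^ σ.a * σ.diag I * (4 ^ (k + 1) * (x.2.2.den : ℤ) ^ 2) ≤
      (x.2.2.num : ℤ) ^ 2 * (Multiset.card I : ℤ) ^ 2 := by
    rw [← v2, hI, Multiset.coe_card, ← Nat.cast_le (α := ℤ), hY]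
    push_cast
    constructor <;> intro h <;> linarith
  have t2 : (d8 (β + 9) 0 + d7 (β + 7) (pairCode 0 (pairCode 1 (pairCode 0 0))) ≤
      d7 (β + 7) (pairCode 0 (pairCode 0 (pairCode 0 0))) + d8 (β + 9) 1) ↔
      σ.traceMoment I * (2 * (n : ℤ) ^ σ.a * ((n : ℤ) ^ σ.h * (n : ℤ) ^ σ.h) *
      (4 ^ (k + 1) * (x.2.2.den : ℤ) ^ 2)) ^ (2 * Shape.exponent k n + 2) ≤
      ((x.2.2.num : ℤ) ^ 2 * (Multiset.card I : ℤ) ^ 2) ^ (2 * Shape.exponent k n + 2) := by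
    rw [signedEntry] at v7
    have e1 : (2 * (n : ℤ) ^ σ.a * ((n : ℤ) ^ σ.h * (n : ℤ) ^ σ.h) *
      (4 ^ (k + 1) * (x.2.2.den : ℤ) ^ 2)) ^ (2 * Shape.exponent k n + 2) =
        ((X ^ 2 : ℕ) : ℤ) ^ (Shape.exponent k n + 1) := by
      rw [show 2 * Shape.exponent k n + 2 = 2 * (Shape.exponent k n + 1) by ring, pow_mul, hX]
      push_cast
      rfl
    have e2 : ((x.2.2.num : ℤ) ^ 2 * (Multiset.card I : ℤ) ^ 2) ^ (2 * Shape.exponent k n + 2) =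
        ((Y ^ 2 : ℕ) : ℤ) ^ (Shape.exponent k n + 1) := by
      rw [show 2 * Shape.exponent k n + 2 = 2 * (Shape.exponent k n + 1) by ring, pow_mul, hY, hI,
        Multiset.coe_card]
      push_cast
      rfl
    rw [e1, e2, mul_comm, ← v8, ← v7, ← Nat.cast_le (α := ℤ)]
    push_cast
    constructor <;> intro h <;> linarith
  have hT : σ.Test I x.2.2 ↔ _ := (and_congr t1 t2).symm
  rw [testCmd, Cmd.run_nest_apply (by simp) ?_ (by simp), w9]
  · congr 1
    simp only [nestSum, Tm.eval_const, if_true, Tm.eval_sub, Tm.eval_mul, Tm.eval_le, Tm.eval_add,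
      Tm.eval_read, Tm.eval_pair, w1, w7, diagFactorTm, thresholdTm, numVarsTm, denTm, numTm,
      numConstraintsTm, Tm.eval_pow, r8.numVars, r8.den, r8.num, r8.numConstraints, hT]
    split_ifs <;> first | rfl | tauto
  · have h1 := avoids_diagFactorTm σ (a := 9) le_rfl
    have h2 := avoids_thresholdTm (a := 9) le_rfl
    simp [h1, h2]
    omega

end CSP

/-! ### Polynomial running time and the complete program -/

namespace CSP

open RAM

variable {k : ℕ}

/-- The data are small, the registers are set, and the number in cell `0` of `β` is small. -/
structure Ready (β : ℕ) (D : Input k → State) : Prop where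
  small : Small Input.sz D
  registers : ∀ x, Registers x (D x)
  dim : PolyBdd Input.sz fun x => D x β 0

/-- The command preserves the registers and runs in polynomial time when they are set. -/
structure Tame (k β : ℕ) (c : Cmd) : Prop where
  writes : ∀ a ∈ c.writes, 9 ≤ a ∧ a ≠ β
  bounds : ∀ b ∈ c.bounds, b < 9 ∨ b = β
  polyRun : ∀ D : Input k → State, Ready β D → c.PolyRun Input.sz D

theorem Tame.ready {β : ℕ} {c : Cmd} (hc : Tame k β c) {D : Input k → State} (hD : Ready β D) :
    Ready β fun x => c.run 0 0 (D x) := by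
  refine ⟨(hc.polyRun D hD).1, fun x => (hD.registers x).run fun a ha => (hc.writes a ha).1, ?_⟩
  refine hD.dim.mono fun x => ?_
  rw [Cmd.run_of_notMem _ _ _ _ fun h => (hc.writes β h).2 rfl]

theorem Tame.seq {β : ℕ} {c c' : Cmd} (hc : Tame k β c) (hc' : Tame k β c') :
    Tame k β (.seq c c') := by
  refine ⟨fun a ha => ?_, fun b hb => ?_, fun D hD => ?_⟩
  · rw [Cmd.writes, List.mem_append] at ha
    exact ha.elim (hc.writes a) (hc'.writes a)
  · rw [Cmd.bounds, List.mem_append] at hb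
    exact hb.elim (hc.bounds b) (hc'.bounds b)
  · refine (hc.polyRun D hD).seq (hc'.polyRun _ (hc.ready hD)) fun b hb hb' => ?_
    have h1 := hc'.writes b hb'
    have h2 := hc.bounds b hb
    omega

theorem Ready.polyBdd_two {β : ℕ} {D : Input k → State} (hD : Ready β D) :
    PolyBdd Input.sz fun x => D x 5 0 :=
  (PolyBdd.const 2).mono fun x => (hD.registers x).two.le

theorem Tame.nest {β a : ℕ} {i e : Tm} {bs : List ℕ} (ha : 9 ≤ a) (haβ : a ≠ β)
    (hbs : ∀ b ∈ bs, b = 2 ∨ b = 5 ∨ b = β) (hi : i.Avoids a) (he : e.Avoids a) :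
    Tame k β (.nest bs a i e) := by
  refine ⟨fun b hb => ?_, fun b hb => ?_, fun D hD => ?_⟩
  · rw [Cmd.writes_nest, List.mem_singleton] at hb
    rw [hb]
    exact ⟨ha, haβ⟩
  · rw [Cmd.bounds_nest] at hb
    have := hbs b hb
    omega
  · refine Cmd.polyRun_nest hD.small (fun b hb => ?_) hi he fun h => ?_
    · rcases hbs b hb with rfl | rfl | rfl
      · exact polyBdd_numConstraints.mono fun x => (hD.registers x).numConstraints.le
      · exact hD.polyBdd_two
      · exact hD.dim
    · have := hbs a h
      omega

theorem Tame.matPow {β b M T W : ℕ} (hb : b = 4 ∨ b = β) (hT : 9 ≤ T) (hW : 9 ≤ W) (hTβ : T ≠ β)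
    (hWβ : W ≠ β) (hTW : T ≠ W) (hMT : M ≠ T) (hMW : M ≠ W) : Tame k β (.matPow b M T W) := by
  refine ⟨fun a ha => ?_, fun a ha => ?_, fun D hD => ?_⟩
  · simp only [Cmd.writes_matPow, List.mem_cons, List.not_mem_nil, or_false] at ha
    omega
  · simp only [Cmd.bounds_matPow, List.mem_cons, List.not_mem_nil, or_false] at ha
    omega
  · have h3 : ∀ x, D x 3 0 = Shape.exponent k x.1 + 1 := fun x => (hD.registers x).exponent
    refine Cmd.polyRun_matPow (by omega) (by omega) hTW hMT hMW (by omega) (by omega) hD.small ?_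
      hD.polyBdd_two ?_ fun A => ?_
    · rcases hb with rfl | rfl
      · exact (PolyBdd.const 1).mono fun x => (hD.registers x).one.le
      · exact hD.dim
    · simpa only [h3] using polyBdd_exponent
    · simpa only [h3] using polyBdd_pow_exponent A

theorem avoids_diagCmd (σ : Shape k) {a : ℕ} (ha : 1 < a) :
    ((negationsTm σ (.var 0) + negationsTm σ (.var 1)) % .const 2).Avoids a ∧
      ((rowTm σ (.var 0)).Avoids a ∧ (rowTm σ (.var 1)).Avoids a) ∧
      ((colTm σ (.var 0)).Avoids a ∧ (colTm σ (.var 1)).Avoids a) ∧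
      (idxTm σ (.var 0)).Avoids a ∧ (idxTm σ (.var 1)).Avoids a := by
  refine ⟨⟨⟨avoids_negationsTm ha ?_ _, avoids_negationsTm ha ?_ _⟩, ?_⟩, ⟨avoids_codeTm ha ?_ _,
    avoids_codeTm ha ?_ _⟩, ⟨avoids_codeTm ha ?_ _, avoids_codeTm ha ?_ _⟩, avoids_codeTm ha ?_ _,
    avoids_codeTm ha ?_ _⟩ <;> trivial

/-- The first stage writes the dimension to `β`, which `Tame` forbids, and is treated directly.
After it the dimension is known to be polynomial in the input size and all later stages are tame. -/
theorem polyRun_shapeCmd (σ : Shape k) {β : ℕ} (hβ : 9 < β) {D : Input k → State}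
    (hD : Small Input.sz D) (hr : ∀ x, Registers x (D x)) (h0 : ∀ x, D x β = 0) :
    (shapeCmd σ β).PolyRun Input.sz D := by
  have hp : ∀ a, 9 ≤ a → (Tm.pow numVarsTm σ.h).Avoids a := fun a ha =>
    Tm.avoids_pow (by simp [numVarsTm]; omega) _
  have h1 : (dimCmd σ β).PolyRun Input.sz D :=
    Cmd.polyRun_nest hD (by simp) (by trivial) ⟨hp _ hβ.le, hp _ hβ.le⟩ (by simp)
  have hready : Ready β fun x => (dimCmd σ β).run 0 0 (D x) := by
    refine ⟨h1.1, fun x => (hr x).run (by simp [dimCmd, Cmd.writes_nest]; omega), ?_⟩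
    refine ((polyBdd_numVars.pow σ.h).mul (polyBdd_numVars.pow σ.h)).mono fun x => ?_
    rw [dimCmd, Cmd.run_nest_apply, h0]
    · simp [nestSum, numVarsTm, (hr x).numVars]
    · trivial
    · exact ⟨hp _ hβ.le, hp _ hβ.le⟩
    · simp
  refine h1.seq (Tame.polyRun (β := β) ?_ _ hready) (by simp [dimCmd, Cmd.bounds_nest])
  refine Tame.seq ?_ (Tame.seq ?_ (Tame.seq ?_ (Tame.seq ?_ (Tame.seq ?_ (Tame.seq ?_
    (Tame.seq ?_ ?_))))))
  · have h := avoids_diagCmd σ (a := β + 1) (by omega)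
    refine Tame.nest (by omega) (by omega) (by simp) h.1 ?_
    simp [h]
  · have h := avoids_diagCmd σ (a := β + 2) (by omega)
    refine Tame.nest (by omega) (by omega) (by simp) ?_ ?_
    · simp only [Tm.avoids_pair, Tm.avoids_add, Tm.avoids_mul]
      exact ⟨h.1, ⟨h.2.1.1, hp _ (by omega), h.2.1.2⟩, h.2.2.1.1, hp _ (by omega), h.2.2.1.2⟩
    · simp [h]
  · refine Tame.nest (by omega) (by omega) (by simp) (by simp) ?_
    have := Tm.avoids_pow (avoids_traceFactorTm σ (a := β + 3) (by omega)) 2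
    simp [this]
  · exact Tame.matPow (.inr rfl) (by omega) (by omega) (by omega) (by omega) (by omega) (by omega)
      (by omega)
  · exact Tame.nest (by omega) (by omega) (by simp) (by simp)
      (Tm.avoids_pow (avoids_thresholdTm (by omega)) 2)
  · exact Tame.matPow (.inl rfl) (by omega) (by omega) (by omega) (by omega) (by omega) (by omega)
      (by omega)
  · exact Tame.nest (by omega) (by omega) (by simp) (by simp) (by simp)
  · refine Tame.nest le_rfl (by omega) (by simp) (by simp) ?_
    have h1 := avoids_diagFactorTm σ (a := 9) le_rfl
    have h2 := avoids_thresholdTm (a := 9) le_rfl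
    simp [h1, h2]
    omega

/-- The tests of several shapes. -/
def shapesCmd : List (Shape k) → ℕ → Cmd
  | [], _ => .nest [] 9 (.const 0) (.const 0)
  | σ :: l, β => .seq (shapeCmd σ β) (shapesCmd l (β + 10))

theorem le_of_mem_writes_shapeCmd (σ : Shape k) {a β : ℕ} (h : a ∈ (shapeCmd σ β).writes) :
    a = 9 ∨ β ≤ a ∧ a < β + 10 := by
  simp only [writes_shapeCmd, List.mem_cons, List.not_mem_nil, or_false] at h
  omega

theorem bounds_shapeCmd (σ : Shape k) {b β : ℕ} (h : b ∈ (shapeCmd σ β).bounds) : b < 9 ∨ b = β := by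
  simp only [shapeCmd, Cmd.bounds, dimCmd, diagCmd, offMatCmd, Cmd.gram, Cmd.bounds_nest,
    Cmd.bounds_matPow, thresholdCmd, traceCmd, testCmd, List.mem_append, List.mem_cons,
    List.not_mem_nil, or_false, false_or] at h
  omega

theorem writes_shapesCmd (l : List (Shape k)) {a β : ℕ} (h : a ∈ (shapesCmd l β).writes) :
    a = 9 ∨ β ≤ a := by
  induction l generalizing β with
  | nil =>
    left
    simpa [shapesCmd, Cmd.writes_nest] using h
  | cons σ l ih =>
    rw [shapesCmd, Cmd.writes, List.mem_append] at h
    rcases h with h | h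
    · have := le_of_mem_writes_shapeCmd σ h
      omega
    · have := ih h
      omega

theorem Registers.run_shapeCmd (σ : Shape k) {β : ℕ} (hβ : 9 < β) {x : Input k} {d : State}
    (hd : Registers x d) (h0 : ∀ a, β ≤ a → d a = 0) :
    Registers x ((shapeCmd σ β).run 0 0 d) ∧ ∀ a, β + 10 ≤ a → (shapeCmd σ β).run 0 0 d a = 0 := by
  refine ⟨hd.run fun a ha => ?_, fun a ha => ?_⟩
  · have := le_of_mem_writes_shapeCmd σ ha
    omega
  · rw [Cmd.run_of_notMem _ _ _ _ fun h => ?_, h0 a (by omega)]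
    have := le_of_mem_writes_shapeCmd σ h
    omega

theorem polyRun_shapesCmd (l : List (Shape k)) {β : ℕ} (hβ : 9 < β) {D : Input k → State}
    (hD : Small Input.sz D) (hr : ∀ x, Registers x (D x)) (h0 : ∀ x a, β ≤ a → D x a = 0) :
    (shapesCmd l β).PolyRun Input.sz D := by
  induction l generalizing β D with
  | nil => exact Cmd.polyRun_nest hD (by simp) (by simp) (by simp) (by simp)
  | cons σ l ih =>
    have h1 := polyRun_shapeCmd σ hβ hD hr fun x => h0 x β le_rfl
    refine h1.seq (ih (by omega) h1.1 (fun x => ((hr x).run_shapeCmd σ hβ (h0 x)).1)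
      fun x => ((hr x).run_shapeCmd σ hβ (h0 x)).2) fun b hb hb' => ?_
    have h2 := bounds_shapeCmd σ hb
    have h3 := writes_shapesCmd l hb'
    omega

/-- Cell `0` of array `9` counts failing tests and never decreases. Every shape works in its own
block of ten arrays, still zero when it starts. -/
theorem run_shapesCmd (l : List (Shape k)) {β : ℕ} (hβ : 9 < β) {x : Input k} {d : State}
    (hd : Registers x d) (h0 : ∀ a, β ≤ a → d a = 0) :
    (shapesCmd l β).run 0 0 d 9 0 = 0 ↔
      d 9 0 = 0 ∧ ∀ σ ∈ l, σ.Test (x.2.1 : Multiset (Constraint k x.1)) x.2.2 := by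
  induction l generalizing β d with
  | nil =>
    rw [shapesCmd, Cmd.run_nest_apply (by simp) (by simp) (by simp)]
    simp [nestSum]
  | cons σ l ih =>
    have h1 := hd.run_shapeCmd σ hβ h0
    rw [shapesCmd, Cmd.run, ih (by omega) h1.1 h1.2, CSP.run_shapeCmd σ hβ hd h0, List.forall_mem_cons]
    split_ifs with h <;> simp [h]

/-- The certification algorithm runs in polynomial time. -/
theorem certify_isPolyTime {t : ℕ} : IsPolyTime (certify (k := k) t) := by
  have hset := polyRun_setup (k := k)
  have hreg := registers_setup (k := k)
  have hzero : ∀ (x : Input k) (a : ℕ), 10 ≤ a → (setup k).run 0 0 x.data a = 0 := fun x a ha =>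
    run_setup_of_le x (by omega)
  have hrun := hset.seq (polyRun_shapesCmd (shapes k t) (β := 10) (by norm_num) hset.1 hreg hzero)
    fun b hb hb' => by
      have h1 := writes_shapesCmd _ hb'
      simp only [setup, basicRegisters, sizeRegister, Cmd.bounds, Cmd.bounds_nest, List.mem_append,
        List.mem_cons, List.not_mem_nil, or_false, false_or] at hb
      omega
  obtain ⟨p, q, hpq⟩ := hrun.exists_outputsInTime
    -- The output is `1` if `γ ≥ 1`; otherwise truncated subtraction makes it `1` exactly when no
    -- test has failed.
    (.const 1 - (.const 1 - .le denTm numTm) * .read 9 (.const 0))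
    (fun x => encodeInput x.1 x.2.1 x.2.2) fun _ => rfl
  refine ⟨p, q, fun n L γ => ?_⟩
  have h := hpq ⟨n, L, γ⟩
  have hfin : Registers ⟨n, L, γ⟩ ((Cmd.seq (setup k) (shapesCmd (shapes k t) 10)).run 0 0
      (Input.data ⟨n, L, γ⟩)) := (hreg _).run fun a ha => by
    have := writes_shapesCmd _ ha
    omega
  have hout := run_shapesCmd (shapes k t) (β := 10) (by norm_num) (hreg ⟨n, L, γ⟩) (hzero _)
  rw [run_setup_of_le _ le_rfl] at hout
  suffices e : (if certify t n (L : Instance k n) γ then 1 else 0) =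
      (Tm.const 1 - (Tm.const 1 - .le denTm numTm) * .read 9 (.const 0)).eval
        ((Cmd.seq (setup k) (shapesCmd (shapes k t) 10)).run 0 0 (Input.data ⟨n, L, γ⟩)) 0 by
    rw [e]
    exact h
  have hnum := hfin.num
  have hden := hfin.den
  rw [Cmd.run] at hnum hden
  simp only [Tm.eval_sub, Tm.eval_const, Tm.eval_mul, Tm.eval_le, Tm.eval_read, denTm, numTm, hnum,
    hden, Cmd.run]
  simp only [Pi.zero_apply, true_and] at hout
  rw [certify]
  simp only [decide_eq_true_eq, ← hout]
  by_cases h1 : γ.den ≤ γ.num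
  · simp [h1]
  · simp only [h1, false_or, if_false]
    split_ifs <;> omega

end CSP

/-- For `A n I γ`, the answer `true` stands for the assertion `Opt(I) ≤ 1 - δ + γ`, and `false` for
the answer "fail". -/
theorem mainTheorem1 :
    ∃ K : ℕ, ∀ (k t : ℕ), 2 ≤ t → t ≤ k →
      ∀ (P : (Fin k → ℤˣ) → Bool) (δ : ℝ), CSP.IsFarFromTWiseSupporting P t δ →
        ∃ A : (n : ℕ) → CSP.Instance k n → ℚ≥0 → Bool,
          CSP.IsPolyTime A ∧
          (∀ (n : ℕ) (I : CSP.Instance k n) (γ : ℚ≥0),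
            A n I γ = true → CSP.opt P I ≤ 1 - δ + (γ : ℝ)) ∧
          (∀ (p : ℕ → unitInterval) (γ : ℕ → ℚ≥0), (∀ n, 0 < γ n) →
            (∀ᶠ n : ℕ in atTop,
              (k : ℝ) ^ (K * t) * (n : ℝ) ^ ((t : ℝ) / 2) * Real.log n ^ 5 / (γ n : ℝ) ^ 2
                ≤ 2 ^ k * (n : ℝ) ^ k * (p n : ℝ)) →
            Tendsto (fun n => CSP.prob k n (p n) (fun I => A n I (γ n) = false))
              atTop (𝓝 0)) := by
  -- No power of `k` is needed, because `k` is fixed while `n` tends to infinity and `log⁵ n`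
  -- exceeds what the moment bound requires.
  refine ⟨0, fun k t ht htk P δ hP => ⟨CSP.certify t, CSP.certify_isPolyTime,
    fun n I γ h => CSP.certify_sound hP n I γ h, fun p γ hγ h => ?_⟩⟩
  refine CSP.tendsto_prob_certify_false ht htk p γ hγ ?_
  simpa using h
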